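/- A (finite, open) quantum graph $\mathcal Q=(V,E,L,\mathbf n)$ is a finite graph $(V,E)$ with a length $L(e)>0$ for each edge and a number $\mathbf n(v)\in\{0,1,2,\dots\}$ of half-infinite edges (leads) attached to each vertex $v$. Here graphs are simple (an edge is a set of two vertices) and finite quantum graphs are assumed to have at least one edge. Let $d(v)$ be the number of edges at $v$, $\mathcal L_{\mathcal Q}=\sum_{e\in E}L(e)$, and let $B(\mathcal Q)$ be the set of bonds, i.e. oriented edges $b$, with origin $o_b$, terminus $t_b$, reverse $\hat b$ and length $L_b$. For $D,n_0\in\mathbb N$ and $0<L_{min}\le L_{max}$, let $\mathfrak Q'=\mathfrak Q'_{D,n_0,L_{min},L_{max}}$ be the set of finite quantum graphs with $d(v)\le D$, $\mathbf n(v)\le n_0$ and $\mathbf n(v)\ne d(v)$ for all $v\in V$, and $L_{min}\le L(e)\le L_{max}$ for all $e\in E$. *Resonances.* A number $z\in\mathbb C$ is a resonance of $\mathcal Q$, $z\in\mathrm{Res}(\mathcal Q)$, if there is a family $f\neq 0$ of $C^2$ functions $f_b$ on $[0,L_b]$ for the bonds $b$ (with $f_b(x)=f_{\hat b}(L_b-x)$)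 and on $[0,\infty)$ for the leads such that $-f_b''=z^2f_b$ for all bonds and leads $b$, $f_b(x)=f_b(0)e^{izx}$ on each lead, the values $f_b(0)$ agree for all bonds and leads $b$ starting at a given vertex, and at each vertex the sum of the derivatives $f_b'(0)$ over all bonds and leads starting there is $0$. Its multiplicity $m_{\mathcal Q}(z)$ is the order of vanishing at $z$ (possibly $0$ if $z=0$) of $\det(\mathrm{Id}-U_{\mathcal Q})$, where $U_{\mathcal Q}(z)$ is the matrix indexed by $B(\mathcal Q)$ with entries $U_{\mathcal Q}(z)_{b,b'}=\Big(\frac{2}{\mathbf n(v)+d(v)}-\delta_{b,\hat b'}\Big)e^{izL_{b'}}$ if $o_b=t_{b'}=v$, and $0$ if $o_b\ne t_{b'}$. Let $\mu_{\mathcal Q}=\frac1{\mathcal L_{\mathcal Q}}\sum_{z\in\mathrm{Res}(\mathcal Q)}m_{\mathcal Q}(z)\,\delta_z$. *Benjamini–Schramm convergence.* Let $\mathrm{ROQ}$ be the set of isomorphism classes $[\mathcal Q,b_0]$ of (possibly infinite, locally finite) quantum graphs with a root bond $b_0$, where isomorphisms preserve the graph, the lengths, $\mathbf n$, and the origin and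 terminus of the root. Let $\mathrm d([\mathcal Q_1,b_1],[\mathcal Q_2,b_2])$ be the infimum of the $\varepsilon>0$ such that there is a root-preserving isomorphism between the graphs induced on the balls of radius $\lfloor\varepsilon^{-1}\rfloor$ around $o_{b_1}$ and $o_{b_2}$ which preserves $\mathbf n$ and changes the length of each edge of the ball by less than $\varepsilon$. The sequence $(\mathcal Q_N)$ converges to a Borel probability measure $\mathbb P$ on $\mathrm{ROQ}$ in the Benjamini–Schramm sense if the measures $\nu_{\mathcal Q_N}=\frac1{|B(\mathcal Q_N)|}\sum_{b\in B(\mathcal Q_N)}\delta_{[\mathcal Q_N,b]}$ converge weakly to $\mathbb P$ for the topology of $\mathrm d$. **Theorem.** Let $D,n_0\in\mathbb N$, $0<L_{min}\le L_{max}$, $Y=-\frac{\ln(D+n_0)}{L_{min}}$, and $\Omega_{a,b}=\{z\in\mathbb C:\ a<\mathrm{Im}\,z<b\}$. There are numbers $M(y)$, depending only on $y,D,n_0,L_{min},L_{max}$, and for each Borel probability measure $\mathbb P$ on $\mathrm{ROQ}$ a function $\Lambda_{\mathbb P}:\Omega_{-\infty,Y}\cup\Omega_{0,+\infty}\to\mathbb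 C$ such that: - $|\Lambda_{\mathbb P}(x+iy)|\le M(y)$ for all $y\in(-\infty,Y)\cup(0,+\infty)$ and all $x\in\mathbb R$; - if $(\mathcal Q_N)$ is a sequence in $\mathfrak Q'$ that converges to $\mathbb P$ in the Benjamini–Schramm sense, if $y_1<Y$, $y_2>0$, $\varepsilon>0$, and if $g$ is holomorphic and integrable on $\Omega_{y_1-\varepsilon,y_2+\varepsilon}$, then $g$ is $\mu_{\mathcal Q_N}$-integrable for each $N$, the functions $x\mapsto g(x+iy_j)\Lambda_{\mathbb P}(x+iy_j)$, $j=1,2$, are integrable on $\mathbb R$, and $$\langle\mu_{\mathcal Q_N},g\rangle=\int_{\mathbb C} g\,d\mu_{\mathcal Q_N}\ \xrightarrow[N\to\infty]{}\ \sum_{j=1,2}\int_{\mathbb R}g(x+iy_j)\,\Lambda_{\mathbb P}(x+iy_j)\,dx .$$ -/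

import Mathlib

open MeasureTheory Filter Topology
open scoped ENNReal

/-- An (open) quantum graph `(V, E, L, n)`: a locally finite simple graph, a positive length for each
edge, and the number `n v` of leads (infinite edges) attached to each vertex `v`. -/
structure QuantumGraph where
  V : Type
  G : SimpleGraph V
  locallyFinite : ∀ v, (G.neighborSet v).Finite
  L : G.edgeSet → ℝ
  L_pos : ∀ e, 0 < L e
  n : V → ℕ

namespace QuantumGraph

/-- The bonds: oriented (internal) edges. The origin of `b` is `b.fst`, its terminus is `b.snd`, and
the reverse bond is `b.symm`. -/
abbrev Bond (Q : QuantumGraph) : Type := Q.G.Dart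

/-- The external bonds: the pairs `(v, k)`, where `k` runs through a set of `n v` elements. -/
abbrev Lead (Q : QuantumGraph) : Type := Σ v : Q.V, Fin (Q.n v)

/-- The length of the edge joining two adjacent vertices. -/
def edgeLength (Q : QuantumGraph) {u v : Q.V} (h : Q.G.Adj u v) : ℝ := Q.L ⟨s(u, v), h⟩

/-- The length `L_b` of the edge underlying the bond `b`. -/
def bondLength (Q : QuantumGraph) (b : Q.Bond) : ℝ := Q.edgeLength b.adj

/-- The (internal) degree `d(v)` of a vertex. -/
noncomputable def deg (Q : QuantumGraph) (v : Q.V) : ℕ := (Q.G.neighborSet v).ncard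

noncomputable instance fintypeBond (Q : QuantumGraph) [Finite Q.V] : Fintype Q.Bond :=
  haveI : Finite Q.Bond := Finite.of_injective _ (SimpleGraph.Dart.toProd_injective (G := Q.G))
  Fintype.ofFinite _

noncomputable instance fintypeEdge (Q : QuantumGraph) [Finite Q.V] : Fintype Q.G.edgeSet :=
  Fintype.ofFinite _

/-- The total length of the internal part of a finite quantum graph. -/
noncomputable def totalLength (Q : QuantumGraph) [Finite Q.V] : ℝ := ∑ e : Q.G.edgeSet, Q.L e

/-- Uniformly bounded data: degrees at most `D`, at most `n₀` leads at each vertex, and edge lengths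
between `Lmin` and `Lmax`. -/
structure IsBounded (Q : QuantumGraph) (D n₀ : ℕ) (Lmin Lmax : ℝ) : Prop where
  deg_le : ∀ v, Q.deg v ≤ D
  n_le : ∀ v, Q.n v ≤ n₀
  le_L : ∀ e, Lmin ≤ Q.L e
  L_le : ∀ e, Q.L e ≤ Lmax

/-- A quantum graph is unbalanced if no vertex has as many leads as internal edges. -/
def IsUnbalanced (Q : QuantumGraph) : Prop := ∀ v, Q.n v ≠ Q.deg v

/-! Scattering resonances -/

/-- A collection of functions `f_b`, one for each internal bond (only its values on `[0, L_b]`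
matter) and one for each lead (only its values on `[0, ∞)` matter). -/
structure WaveFunction (Q : QuantumGraph) where
  int : Q.Bond → ℝ → ℂ
  ext : Q.Lead → ℝ → ℂ

/-- `f` is a `C²` function on the quantum graph. -/
structure WaveFunction.IsC2 {Q : QuantumGraph} (f : Q.WaveFunction) : Prop where
  int : ∀ b, ContDiffOn ℝ 2 (f.int b) (Set.Icc 0 (Q.bondLength b))
  ext : ∀ l, ContDiffOn ℝ 2 (f.ext l) (Set.Ici 0)
  symm : ∀ b, ∀ x ∈ Set.Icc 0 (Q.bondLength b), f.int b x = f.int b.symm (Q.bondLength b - x)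

open Classical in
/-- Kirchhoff boundary conditions: continuity and current conservation at each vertex. -/
structure WaveFunction.IsKirchhoff {Q : QuantumGraph} [Finite Q.V] (f : Q.WaveFunction) : Prop where
  continuity : ∃ a : Q.V → ℂ, (∀ b, f.int b 0 = a b.fst) ∧ ∀ l, f.ext l 0 = a l.1
  current : ∀ v, ∑ b : Q.Bond with b.fst = v,
        derivWithin (f.int b) (Set.Icc 0 (Q.bondLength b)) 0
      + ∑ k : Fin (Q.n v), derivWithin (f.ext ⟨v, k⟩) (Set.Ici 0) 0 = 0

/-- `f` is not identically zero on the quantum graph. -/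
def WaveFunction.IsNontrivial {Q : QuantumGraph} (f : Q.WaveFunction) : Prop :=
  (∃ b, ∃ x ∈ Set.Icc 0 (Q.bondLength b), f.int b x ≠ 0) ∨
    ∃ l, ∃ x ∈ Set.Ici (0 : ℝ), f.ext l x ≠ 0

/-- `z` is a scattering resonance: there is a nontrivial `C²` function satisfying the Kirchhoff
conditions, `- f'' = z² f` on each edge and lead, and `f_b(x) = f_b(0) exp (i z x)` on each lead. -/
def IsResonance (Q : QuantumGraph) [Finite Q.V] (z : ℂ) : Prop :=
  ∃ f : Q.WaveFunction, f.IsC2 ∧ f.IsKirchhoff ∧ f.IsNontrivial ∧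
    (∀ b, ∀ x ∈ Set.Icc 0 (Q.bondLength b),
      - iteratedDerivWithin 2 (f.int b) (Set.Icc 0 (Q.bondLength b)) x = z ^ 2 * f.int b x) ∧
    (∀ l, ∀ x ∈ Set.Ici (0 : ℝ),
      - iteratedDerivWithin 2 (f.ext l) (Set.Ici 0) x = z ^ 2 * f.ext l x) ∧
    (∀ l, ∀ x ∈ Set.Ici (0 : ℝ), f.ext l x = f.ext l 0 * Complex.exp (Complex.I * z * x))

/-- The set of resonances. -/
def Res (Q : QuantumGraph) [Finite Q.V] : Set ℂ := {z | Q.IsResonance z}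

open Classical in
/-- The vertex scattering coefficients `σ_{b,b'}`. -/
noncomputable def sigma (Q : QuantumGraph) (b b' : Q.Bond) : ℂ :=
  if b.fst = b'.fst then
    2 / ((Q.n b.fst : ℂ) + (Q.deg b.fst : ℂ)) - (if b' = b then 1 else 0)
  else 0

/-- The matrix whose entry at `(b, b')` is the coefficient `σ` at `b` and the reverse of `b'`. -/
noncomputable def S (Q : QuantumGraph) : Matrix Q.Bond Q.Bond ℂ :=
  Matrix.of fun b b' => Q.sigma b b'.symm

open Classical in
/-- The diagonal matrix with entries `exp (i z L_b)`. -/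
noncomputable def DMat (Q : QuantumGraph) (z : ℂ) : Matrix Q.Bond Q.Bond ℂ :=
  Matrix.diagonal fun b => Complex.exp (Complex.I * z * (Q.bondLength b : ℂ))

/-- `U(z) = S D(z)`. -/
noncomputable def U (Q : QuantumGraph) [Finite Q.V] (z : ℂ) : Matrix Q.Bond Q.Bond ℂ :=
  Q.S * Q.DMat z

open Classical in
/-- The secular function `det (Id - U(z))`. -/
noncomputable def secular (Q : QuantumGraph) [Finite Q.V] (z : ℂ) : ℂ := (1 - Q.U z).det

/-- The multiplicity of a resonance (also at `z = 0`): its order as a zero of the secular function. -/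
noncomputable def multiplicity (Q : QuantumGraph) [Finite Q.V] (z : ℂ) : ℕ :=
  analyticOrderNatAt Q.secular z

/-- The normalized resonance measure: the sum of the Dirac masses at the resonances, repeated with
multiplicity, divided by the total length. -/
noncomputable def resonanceMeasure (Q : QuantumGraph) [Finite Q.V] : Measure ℂ :=
  ENNReal.ofReal (Q.totalLength)⁻¹ •
    Measure.sum fun z : Q.Res => (Q.multiplicity z : ℝ≥0∞) • Measure.dirac (z : ℂ)

/-- The vertices at combinatorial distance at most `r` from `v`. -/
def ball (Q : QuantumGraph) (v : Q.V) (r : ℕ) : Set Q.V := {w | Q.G.edist v w ≤ r}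

end QuantumGraph

/-- A quantum graph together with a root bond. -/
structure RootedQuantumGraph where
  Q : QuantumGraph
  root : Q.Bond

namespace RootedQuantumGraph

/-- Equivalence of rooted quantum graphs: a graph isomorphism that respects the root, the lengths,
and the numbers of leads. -/
def Equivalent (A B : RootedQuantumGraph) : Prop :=
  ∃ φ : A.Q.G ≃g B.Q.G, φ A.root.fst = B.root.fst ∧ φ A.root.snd = B.root.snd ∧
    (∀ (u v : A.Q.V) (h : A.Q.G.Adj u v), B.Q.edgeLength (φ.map_adj_iff.2 h) = A.Q.edgeLength h) ∧
    ∀ v, B.Q.n (φ v) = A.Q.n v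

theorem Equivalent.refl (A : RootedQuantumGraph) : A.Equivalent A :=
  ⟨SimpleGraph.Iso.refl, rfl, rfl, fun _ _ _ => rfl, fun _ => rfl⟩

theorem Equivalent.symm {A B : RootedQuantumGraph} : A.Equivalent B → B.Equivalent A := by
  rintro ⟨φ, h1, h2, h3, h4⟩
  refine ⟨φ.symm, by simp [← h1], by simp [← h2], fun u v h => ?_, fun v => ?_⟩
  · rw [← h3]
    simp [QuantumGraph.edgeLength]
  · rw [← h4]
    simp

theorem Equivalent.trans {A B C : RootedQuantumGraph} :
    A.Equivalent B → B.Equivalent C → A.Equivalent C := by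
  rintro ⟨φ, h1, h2, h3, h4⟩ ⟨ψ, k1, k2, k3, k4⟩
  refine ⟨φ.trans ψ, by simp [h1, k1], by simp [h2, k2], fun u v h => ?_, fun v => ?_⟩
  · rw [← h3 u v h, ← k3 _ _ (φ.map_adj_iff.2 h)]
    rfl
  · rw [← h4, ← k4]
    rfl

instance setoid : Setoid RootedQuantumGraph :=
  ⟨Equivalent, Equivalent.refl, Equivalent.symm, Equivalent.trans⟩

/-- The balls of radius `⌊ε⁻¹⌋` around the origins of the roots are isomorphic as rooted graphs with
leads, and the lengths of corresponding edges differ by less than `ε`. (In a ball of radius zero the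
terminus of the root is not visible.) -/
def Close (ε : ℝ) (A B : RootedQuantumGraph) : Prop :=
  ∃ φ : A.Q.G.induce (A.Q.ball A.root.fst ⌊ε⁻¹⌋₊) ≃g B.Q.G.induce (B.Q.ball B.root.fst ⌊ε⁻¹⌋₊),
    (∀ v : A.Q.ball A.root.fst ⌊ε⁻¹⌋₊, (v : A.Q.V) = A.root.fst → (φ v : B.Q.V) = B.root.fst) ∧
    (∀ v : A.Q.ball A.root.fst ⌊ε⁻¹⌋₊, (v : A.Q.V) = A.root.snd → (φ v : B.Q.V) = B.root.snd) ∧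
    (∀ v, B.Q.n (φ v) = A.Q.n v) ∧
    ∀ u v (h : (A.Q.G.induce (A.Q.ball A.root.fst ⌊ε⁻¹⌋₊)).Adj u v),
      |B.Q.edgeLength (SimpleGraph.induce_adj.1 (φ.map_adj_iff.2 h)) -
        A.Q.edgeLength (SimpleGraph.induce_adj.1 h)| < ε

end RootedQuantumGraph

/-- The set of equivalence classes of rooted quantum graphs. -/
def ROQ : Type 1 := Quotient RootedQuantumGraph.setoid

namespace ROQ

/-- The equivalence class of `Q` rooted at the bond `b`. -/
def mk (Q : QuantumGraph) (b : Q.Bond) : ROQ := Quotient.mk RootedQuantumGraph.setoid ⟨Q, b⟩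

/-- The distance on equivalence classes: the infimum of the `ε > 0` for which representatives are
`ε`-close (this does not depend on the representatives; the infimum of the empty set is `∞`). -/
noncomputable def distance (X Y : ROQ) : ℝ≥0∞ :=
  sInf {t | ∃ ε : ℝ, 0 < ε ∧ t = ENNReal.ofReal ε ∧ ∃ A B : RootedQuantumGraph,
    mk A.Q A.root = X ∧ mk B.Q B.root = Y ∧ A.Close ε B}

/-- The topology of the distance: a set is open iff it contains a ball around each of its points. -/
instance : TopologicalSpace ROQ where
  IsOpen s := ∀ X ∈ s, ∃ ε > 0, ∀ Y, distance X Y < ε → Y ∈ s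
  isOpen_univ := fun _ _ => ⟨1, one_pos, fun _ _ => Set.mem_univ _⟩
  isOpen_inter := by
    rintro s t hs ht X ⟨h1, h2⟩
    obtain ⟨a, ha, h⟩ := hs X h1
    obtain ⟨b, hb, k⟩ := ht X h2
    exact ⟨min a b, lt_min ha hb, fun Y hY =>
      ⟨h Y (hY.trans_le (min_le_left _ _)), k Y (hY.trans_le (min_le_right _ _))⟩⟩
  isOpen_sUnion := by
    rintro S hS X ⟨s, hs, hX⟩
    obtain ⟨a, ha, h⟩ := hS s hs X hX
    exact ⟨a, ha, fun Y hY => ⟨s, hs, h Y hY⟩⟩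

instance : MeasurableSpace ROQ := borel ROQ

instance : BorelSpace ROQ := ⟨rfl⟩

end ROQ

namespace QuantumGraph

/-- The law `ν_Q` of the finite quantum graph `Q` rooted at a uniformly random bond. -/
noncomputable def rootedLaw (Q : QuantumGraph) [Finite Q.V] [Nonempty Q.Bond] :
    ProbabilityMeasure ROQ :=
  ⟨(Fintype.card Q.Bond : ℝ≥0∞)⁻¹ • ∑ b : Q.Bond, Measure.dirac (ROQ.mk Q b), ⟨by
    simp only [Measure.smul_apply, Measure.coe_finsetSum, Finset.sum_apply, measure_univ,
      Finset.sum_const, Finset.card_univ, nsmul_eq_mul, mul_one, smul_eq_mul]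
    exact ENNReal.inv_mul_cancel (by simp) (by simp)⟩⟩

/-- Benjamini-Schramm convergence: weak convergence of the laws of the uniformly rooted graphs. -/
def BSConvergesTo (Q : ℕ → QuantumGraph) [∀ N, Finite (Q N).V] [∀ N, Nonempty (Q N).Bond]
    (P : ProbabilityMeasure ROQ) : Prop :=
  Tendsto (fun N => (Q N).rootedLaw) atTop (𝓝 P)

end QuantumGraph

/-- The number `Y(D, n₀, Lmin) = - ln (D + n₀) / Lmin`. -/
noncomputable def stripBottom (D n₀ : ℕ) (Lmin : ℝ) : ℝ := - Real.log ((D : ℝ) + n₀) / Lmin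

/-- The horizontal strip `a < Im z < b`. -/
def strip (a b : ℝ) : Set ℂ := {z | a < z.im ∧ z.im < b}

/-! The secular function `F = det (1 - S D(z))` is entire, and its zeros with their orders carry the
resonance measure. Its zeros lie between the lines Im z = y₁ and Im z = y₂, so a weighted argument
principle (`HasStripZeros.hasSum`) writes the sum of m(w) g(w) over the zeros as (2πi)⁻¹ times the
integral of g F'/F along the lower line minus the one along the upper line. It then suffices that
F'/F, divided by the total length, converges pointwise and boundedly on each line.

Above the real axis the vertex scattering matrix is an ℓ² contraction and `D(z)` has norm at most
exp(-Lmin Im z). The Neumann series then gives i F'/F as a sum over closed walks of bonds, each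
weighted by the length of its starting bond (`hasSum_logDeriv_propDet`). Below the strip one uses
the functional equation det(1 - S D(z)) = det(-S) exp(2iz𝓛) det(1 - S⁻¹ D(-z)), with 𝓛 the total
length. Since no vertex is balanced, S is invertible; up to reversal of bonds its inverse is a
matrix of the same form with 2/(d - n) in place of 2/(d + n), of norm at most max(1, D + n₀). Hence
the Neumann series converges again as soon as Im z < Y.

The closed walks with k + 1 steps from a root bond only see a ball around it and depend continuously
on the lengths, so their sum is a continuous function on `ROQ`. Summing over k with geometric bounds
and averaging over the root turns F'/F, normalized by the total length, into a quotient of two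
expectations under the law of the rooted graph: the walk series over the root length. Weak
convergence passes to the limit in this quotient, and dominated convergence passes to the limit in
the line integrals.

Two points need care. The vertical sides of the contour must not contribute: F is almost periodic
along the real direction, so a zero-free vertical segment, with its bound on F'/F, recurs
arbitrarily far to the left and to the right, while an integrable holomorphic g tends to zero there.
The sum over the zeros must also converge absolutely: the number of zeros in a unit window is
bounded by testing the same formula against a kernel with positive real part, and the mean value
inequality compares the sum with the area integral of |g|. -/

/-! Integrals along the boundary of a rectangle -/

/-- The closed rectangle `[a, b] × [c, d]`. -/
def closedRect (a b c d : ℝ) : Set ℂ := Set.Icc a b ×ℂ Set.Icc c d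

/-- The open rectangle `(a, b) × (c, d)`. -/
def openRect (a b c d : ℝ) : Set ℂ := Set.Ioo a b ×ℂ Set.Ioo c d

/-- The boundary of the rectangle `[a, b] × [c, d]`. -/
def rectFrame (a b c d : ℝ) : Set ℂ := closedRect a b c d \ openRect a b c d

/-- The counterclockwise integral along the boundary of a rectangle. -/
noncomputable def rectIntegral (f : ℂ → ℂ) (a b c d : ℝ) : ℂ :=
  (∫ x : ℝ in a..b, f (x + c * Complex.I)) - (∫ x : ℝ in a..b, f (x + d * Complex.I)) +
    Complex.I * (∫ y : ℝ in c..d, f (b + y * Complex.I)) -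
    Complex.I * (∫ y : ℝ in c..d, f (a + y * Complex.I))

section Rect

variable {a b c d : ℝ} {f g : ℂ → ℂ} {w : ℂ}

theorem mem_closedRect {z : ℂ} :
    z ∈ closedRect a b c d ↔ (a ≤ z.re ∧ z.re ≤ b) ∧ c ≤ z.im ∧ z.im ≤ d := Iff.rfl

theorem mem_openRect {z : ℂ} :
    z ∈ openRect a b c d ↔ (a < z.re ∧ z.re < b) ∧ c < z.im ∧ z.im < d := Iff.rfl

theorem isCompact_closedRect : IsCompact (closedRect a b c d) :=
  isCompact_Icc.reProdIm isCompact_Icc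

theorem bottom_mem_rectFrame (h : c ≤ d) {x : ℝ} (hx : x ∈ Set.Icc a b) :
    (x + c * Complex.I : ℂ) ∈ rectFrame a b c d := by
  simp [rectFrame, mem_closedRect, mem_openRect, h, hx.1, hx.2]

theorem top_mem_rectFrame (h : c ≤ d) {x : ℝ} (hx : x ∈ Set.Icc a b) :
    (x + d * Complex.I : ℂ) ∈ rectFrame a b c d := by
  simp [rectFrame, mem_closedRect, mem_openRect, h, hx.1, hx.2]

theorem left_mem_rectFrame (h : a ≤ b) {y : ℝ} (hy : y ∈ Set.Icc c d) :
    (a + y * Complex.I : ℂ) ∈ rectFrame a b c d := by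
  simp [rectFrame, mem_closedRect, mem_openRect, h, hy.1, hy.2]

theorem right_mem_rectFrame (h : a ≤ b) {y : ℝ} (hy : y ∈ Set.Icc c d) :
    (b + y * Complex.I : ℂ) ∈ rectFrame a b c d := by
  simp [rectFrame, mem_closedRect, mem_openRect, h, hy.1, hy.2]

theorem intervalIntegrable_bottom (hab : a ≤ b) (hcd : c ≤ d)
    (hf : ContinuousOn f (rectFrame a b c d)) :
    IntervalIntegrable (fun x : ℝ => f (x + c * Complex.I)) volume a b := by
  refine ContinuousOn.intervalIntegrable_of_Icc hab (hf.comp (by fun_prop) fun x hx => ?_)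
  exact bottom_mem_rectFrame hcd hx

theorem intervalIntegrable_top (hab : a ≤ b) (hcd : c ≤ d)
    (hf : ContinuousOn f (rectFrame a b c d)) :
    IntervalIntegrable (fun x : ℝ => f (x + d * Complex.I)) volume a b := by
  refine ContinuousOn.intervalIntegrable_of_Icc hab (hf.comp (by fun_prop) fun x hx => ?_)
  exact top_mem_rectFrame hcd hx

theorem intervalIntegrable_left (hab : a ≤ b) (hcd : c ≤ d)
    (hf : ContinuousOn f (rectFrame a b c d)) :
    IntervalIntegrable (fun y : ℝ => f (a + y * Complex.I)) volume c d := by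
  refine ContinuousOn.intervalIntegrable_of_Icc hcd (hf.comp (by fun_prop) fun x hx => ?_)
  exact left_mem_rectFrame hab hx

theorem intervalIntegrable_right (hab : a ≤ b) (hcd : c ≤ d)
    (hf : ContinuousOn f (rectFrame a b c d)) :
    IntervalIntegrable (fun y : ℝ => f (b + y * Complex.I)) volume c d := by
  refine ContinuousOn.intervalIntegrable_of_Icc hcd (hf.comp (by fun_prop) fun x hx => ?_)
  exact right_mem_rectFrame hab hx

theorem rectIntegral_congr (hab : a ≤ b) (hcd : c ≤ d) (h : Set.EqOn f g (rectFrame a b c d)) :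
    rectIntegral f a b c d = rectIntegral g a b c d := by
  unfold rectIntegral
  congr 1; congr 1; congr 1
  · refine intervalIntegral.integral_congr fun x hx => h ?_
    rw [Set.uIcc_of_le hab] at hx
    exact bottom_mem_rectFrame hcd hx
  · refine intervalIntegral.integral_congr fun x hx => h ?_
    rw [Set.uIcc_of_le hab] at hx
    exact top_mem_rectFrame hcd hx
  · congr 1
    refine intervalIntegral.integral_congr fun x hx => h ?_
    rw [Set.uIcc_of_le hcd] at hx
    exact right_mem_rectFrame hab hx
  · congr 1
    refine intervalIntegral.integral_congr fun x hx => h ?_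
    rw [Set.uIcc_of_le hcd] at hx
    exact left_mem_rectFrame hab hx

theorem rectIntegral_add (hab : a ≤ b) (hcd : c ≤ d) (hf : ContinuousOn f (rectFrame a b c d))
    (hg : ContinuousOn g (rectFrame a b c d)) :
    rectIntegral (fun z => f z + g z) a b c d =
      rectIntegral f a b c d + rectIntegral g a b c d := by
  unfold rectIntegral
  rw [intervalIntegral.integral_add (intervalIntegrable_bottom hab hcd hf)
      (intervalIntegrable_bottom hab hcd hg),
    intervalIntegral.integral_add (intervalIntegrable_top hab hcd hf)
      (intervalIntegrable_top hab hcd hg),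
    intervalIntegral.integral_add (intervalIntegrable_right hab hcd hf)
      (intervalIntegrable_right hab hcd hg),
    intervalIntegral.integral_add (intervalIntegrable_left hab hcd hf)
      (intervalIntegrable_left hab hcd hg)]
  ring

theorem rectIntegral_const_mul (k : ℂ) :
    rectIntegral (fun z => k * f z) a b c d = k * rectIntegral f a b c d := by
  simp only [rectIntegral, intervalIntegral.integral_const_mul]
  ring

theorem rectIntegral_sum {ι : Type*} (s : Finset ι) {F : ι → ℂ → ℂ} (hab : a ≤ b) (hcd : c ≤ d)
    (hF : ∀ i ∈ s, ContinuousOn (F i) (rectFrame a b c d)) :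
    rectIntegral (fun z => ∑ i ∈ s, F i z) a b c d = ∑ i ∈ s, rectIntegral (F i) a b c d := by
  classical
  induction s using Finset.induction_on with
  | empty => simp [rectIntegral]
  | insert i s hi ih =>
    simp only [Finset.sum_insert hi]
    rw [rectIntegral_add hab hcd (hF i (Finset.mem_insert_self i s))
      (continuousOn_finsetSum _ fun j hj => hF j (Finset.mem_insert_of_mem hj)),
      ih fun j hj => hF j (Finset.mem_insert_of_mem hj)]

theorem rectIntegral_eq_zero (hab : a ≤ b) (hcd : c ≤ d)
    (hf : DifferentiableOn ℂ f (closedRect a b c d)) : rectIntegral f a b c d = 0 := by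
  have := Complex.integral_boundary_rect_eq_zero_of_differentiableOn f ⟨a, c⟩ ⟨b, d⟩
    (by rw [Set.uIcc_of_le hab, Set.uIcc_of_le hcd]; exact hf)
  simpa [rectIntegral, smul_eq_mul] using this

/-- The principal logarithm of z - w is a primitive on the bottom, right and top sides. The left
side crosses its cut, so log(-(z - w)) serves there. All terms cancel except the two jumps by πi at
the left corners. -/
theorem rectIntegral_inv_sub (hw : w ∈ openRect a b c d) :
    rectIntegral (fun z => (z - w)⁻¹) a b c d = 2 * Real.pi * Complex.I := by
  obtain ⟨⟨h1, h2⟩, h3, h4⟩ := hw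
  have hor : ∀ y : ℝ, y ≠ w.im → (∫ x : ℝ in a..b, (x + y * Complex.I - w)⁻¹) =
      Complex.log (b + y * Complex.I - w) - Complex.log (a + y * Complex.I - w) := by
    intro y hy
    have hne : ∀ x : ℝ, (x + y * Complex.I - w : ℂ) ∈ Complex.slitPlane := fun x => by
      refine Or.inr ?_
      simpa [sub_eq_zero] using hy
    have hd : ∀ x : ℝ, HasDerivAt (fun x : ℝ => Complex.log (x + y * Complex.I - w))
        (x + y * Complex.I - w)⁻¹ x := fun x => by
      have := (((Complex.ofRealCLM.hasDerivAt (x := x)).add_const (y * Complex.I)).sub_const w).clog_real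
        (hne x)
      simpa using this
    refine intervalIntegral.integral_eq_sub_of_hasDerivAt (fun x _ => hd x) ?_
    refine Continuous.intervalIntegrable ?_ _ _
    exact Continuous.inv₀ (by fun_prop) fun x => Complex.slitPlane_ne_zero (hne x)
  have hright : Complex.I * (∫ y : ℝ in c..d, (b + y * Complex.I - w)⁻¹) =
      Complex.log (b + d * Complex.I - w) - Complex.log (b + c * Complex.I - w) := by
    have hne : ∀ y : ℝ, (b + y * Complex.I - w : ℂ) ∈ Complex.slitPlane := fun x => by
      refine Or.inl ?_
      simpa using h2
    have hd : ∀ y : ℝ, HasDerivAt (fun y : ℝ => Complex.log (b + y * Complex.I - w))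
        (Complex.I * (b + y * Complex.I - w)⁻¹) y := fun y => by
      have := ((((Complex.ofRealCLM.hasDerivAt (x := y)).mul_const Complex.I).const_add
        (b : ℂ)).sub_const w).clog_real (hne y)
      simpa [div_eq_mul_inv] using this
    rw [← intervalIntegral.integral_const_mul]
    refine intervalIntegral.integral_eq_sub_of_hasDerivAt (fun x _ => hd x) ?_
    refine Continuous.intervalIntegrable ?_ _ _
    exact continuous_const.mul
      (Continuous.inv₀ (by fun_prop) fun x => Complex.slitPlane_ne_zero (hne x))
  have hleft : Complex.I * (∫ y : ℝ in c..d, (a + y * Complex.I - w)⁻¹) =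
      Complex.log (-(a + d * Complex.I - w)) - Complex.log (-(a + c * Complex.I - w)) := by
    have hne : ∀ y : ℝ, (-(a + y * Complex.I - w) : ℂ) ∈ Complex.slitPlane := fun x => by
      refine Or.inl ?_
      simpa using h1
    have hd : ∀ y : ℝ, HasDerivAt (fun y : ℝ => Complex.log (-(a + y * Complex.I - w)))
        (Complex.I * (a + y * Complex.I - w)⁻¹) y := fun y => by
      have := ((((Complex.ofRealCLM.hasDerivAt (x := y)).mul_const Complex.I).const_add
        (a : ℂ)).sub_const w).neg.clog_real (hne y)
      have h5 : HasDerivAt (fun y : ℝ => Complex.log (-(a + y * Complex.I - w)))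
        (-((1 : ℝ) * Complex.I) / -(a + y * Complex.I - w)) y := this
      rwa [Complex.ofReal_one, one_mul, neg_div_neg_eq, div_eq_mul_inv] at h5
    rw [← intervalIntegral.integral_const_mul]
    refine intervalIntegral.integral_eq_sub_of_hasDerivAt (fun x _ => hd x) ?_
    refine Continuous.intervalIntegrable ?_ _ _
    refine continuous_const.mul
      (Continuous.inv₀ (by fun_prop) fun x => ?_)
    exact neg_ne_zero.1 (Complex.slitPlane_ne_zero (hne x))
  have hTL : Complex.log (-(a + d * Complex.I - w)) =
      Complex.log (a + d * Complex.I - w) - Real.pi * Complex.I := by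
    rw [Complex.log, Complex.arg_neg_eq_arg_sub_pi_of_im_pos (by simpa using h4), Complex.log]
    simp only [norm_neg]
    push_cast
    ring
  have hBL : Complex.log (-(a + c * Complex.I - w)) =
      Complex.log (a + c * Complex.I - w) + Real.pi * Complex.I := by
    rw [Complex.log, Complex.arg_neg_eq_arg_add_pi_of_im_neg (by simpa using h3), Complex.log]
    simp only [norm_neg]
    push_cast
    ring
  unfold rectIntegral
  rw [hor c h3.ne, hor d h4.ne', hright, hleft, hTL, hBL]
  ring

theorem sub_ne_zero_of_mem_rectFrame (hw : w ∈ openRect a b c d) {z : ℂ}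
    (hz : z ∈ rectFrame a b c d) : z - w ≠ 0 := by
  intro h
  rw [sub_eq_zero] at h
  exact hz.2 (h ▸ hw)

theorem openRect_subset_closedRect : openRect a b c d ⊆ closedRect a b c d :=
  fun _ h => ⟨⟨h.1.1.le, h.1.2.le⟩, h.2.1.le, h.2.2.le⟩

/-- Cauchy's integral formula for a rectangle. -/
theorem rectIntegral_mul_inv_sub {U : Set ℂ} (hU : IsOpen U) (hg : DifferentiableOn ℂ g U)
    (hUR : closedRect a b c d ⊆ U) (hab : a ≤ b) (hcd : c ≤ d) (hw : w ∈ openRect a b c d) :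
    rectIntegral (fun z => g z * (z - w)⁻¹) a b c d = 2 * Real.pi * Complex.I * g w := by
  have hUw : U ∈ 𝓝 w := hU.mem_nhds (hUR (openRect_subset_closedRect hw))
  -- The difference quotient at w has a removable singularity, so only g(w)/(z - w) contributes to
  -- the integral.
  have hds : DifferentiableOn ℂ (dslope g w) U := (Complex.differentiableOn_dslope hUw).2 hg
  have hinv : ContinuousOn (fun z : ℂ => g w * (z - w)⁻¹) (rectFrame a b c d) :=
    continuousOn_const.mul ((continuousOn_id.sub continuousOn_const).inv₀ fun z hz =>
      sub_ne_zero_of_mem_rectFrame hw hz)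
  rw [rectIntegral_congr (g := fun z => dslope g w z + g w * (z - w)⁻¹) hab hcd,
    rectIntegral_add hab hcd (hds.continuousOn.mono (Set.sdiff_subset.trans hUR)) hinv,
    rectIntegral_eq_zero hab hcd (hds.mono hUR), rectIntegral_const_mul,
    rectIntegral_inv_sub hw]
  · ring
  · intro z hz
    have h0 := sub_ne_zero_of_mem_rectFrame hw hz
    have : z ≠ w := sub_ne_zero.1 h0
    simp only [dslope_of_ne _ this, slope_def_field]
    field_simp
    ring

end Rect

/-! The weighted argument principle -/

section ArgumentPrinciple

variable {F : ℂ → ℂ}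

theorem analyticOrderAt_ne_top_of_entire (hF : Differentiable ℂ F) {z₀ : ℂ} (h : F z₀ ≠ 0) (z : ℂ) :
    analyticOrderAt F z ≠ ⊤ := by
  have hA : AnalyticOnNhd ℂ F Set.univ := hF.differentiableOn.analyticOnNhd isOpen_univ
  refine hA.analyticOrderAt_ne_top_of_isPreconnected isPreconnected_univ (Set.mem_univ z₀)
    (Set.mem_univ z) ?_
  rw [(hF.analyticAt z₀).analyticOrderAt_eq_zero.2 h]
  simp

/-- An entire function divided by the factor `(z - w) ^ m`, where `m` is its order at `w`. -/
theorem exists_entire_eq_pow_mul (hF : Differentiable ℂ F) {w : ℂ} (hw : analyticOrderAt F w ≠ ⊤) :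
    ∃ H : ℂ → ℂ, Differentiable ℂ H ∧ H w ≠ 0 ∧
      ∀ z, F z = (z - w) ^ analyticOrderNatAt F w * H z := by
  obtain ⟨g, hg, hg0, hFg⟩ := ((hF.analyticAt w).analyticOrderNatAt_eq_iff hw).1 rfl
  set m := analyticOrderNatAt F w
  classical
  refine ⟨Function.update (fun z => F z / (z - w) ^ m) w (g w), ?_, by simpa using hg0, ?_⟩
  · intro z
    rcases eq_or_ne z w with rfl | hz
    · refine hg.differentiableAt.congr_of_eventuallyEq ?_
      filter_upwards [hFg] with y hy
      rcases eq_or_ne y z with rfl | hyz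
      · simp
      · rw [Function.update_of_ne hyz, hy, smul_eq_mul, mul_div_cancel_left₀]
        exact pow_ne_zero _ (sub_ne_zero.2 hyz)
    · have : DifferentiableAt ℂ (fun z => F z / (z - w) ^ m) z :=
        (hF z).div (by fun_prop) (pow_ne_zero _ (sub_ne_zero.2 hz))
      refine this.congr_of_eventuallyEq ?_
      filter_upwards [eventually_ne_nhds hz] with y hy
      rw [Function.update_of_ne hy]
  · intro z
    rcases eq_or_ne z w with rfl | hz
    · simpa using hFg.self_of_nhds
    · rw [Function.update_of_ne hz, mul_div_cancel₀]
      exact pow_ne_zero _ (sub_ne_zero.2 hz)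

/-- The zeros in Z are divided out one at a time. The factors already removed do not vanish at the
next point, so the order of the quotient there is still that of F. -/
theorem exists_entire_eq_prod_mul (hF : Differentiable ℂ F) {z₀ : ℂ} (h0 : F z₀ ≠ 0)
    (Z : Finset ℂ) :
    ∃ H : ℂ → ℂ, Differentiable ℂ H ∧ (∀ w ∈ Z, H w ≠ 0) ∧
      ∀ z, F z = (∏ w ∈ Z, (z - w) ^ analyticOrderNatAt F w) * H z := by
  classical
  induction Z using Finset.induction_on with
  | empty => exact ⟨F, hF, by simp, by simp⟩
  | insert w Z hw ih =>
    obtain ⟨H, hH, hH0, hFH⟩ := ih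
    have hHz : H z₀ ≠ 0 := fun h => h0 (by rw [hFH, h, mul_zero])
    have hPd : Differentiable ℂ fun z => ∏ v ∈ Z, (z - v) ^ analyticOrderNatAt F v := by
      fun_prop
    have hPw : ∏ v ∈ Z, (w - v) ^ analyticOrderNatAt F v ≠ 0 := by
      refine Finset.prod_ne_zero_iff.2 fun v hv => pow_ne_zero _ (sub_ne_zero.2 ?_)
      rintro rfl
      exact hw hv
    have hord : analyticOrderNatAt F w = analyticOrderNatAt H w := by
      have hFeq : F = (fun z => ∏ v ∈ Z, (z - v) ^ analyticOrderNatAt F v) * H := funext hFH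
      have h1 : analyticOrderAt (fun z => ∏ v ∈ Z, (z - v) ^ analyticOrderNatAt F v) w = 0 :=
        (hPd.analyticAt w).analyticOrderAt_eq_zero.2 hPw
      have : analyticOrderAt F w = analyticOrderAt H w := by
        conv_lhs => rw [hFeq]
        rw [analyticOrderAt_mul (hPd.analyticAt w) (hH.analyticAt w), h1, zero_add]
      simp only [analyticOrderNatAt, this]
    obtain ⟨K, hK, hK0, hHK⟩ :=
      exists_entire_eq_pow_mul hH (analyticOrderAt_ne_top_of_entire hH hHz w)
    refine ⟨K, hK, fun v hv => ?_, fun z => ?_⟩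
    · rcases Finset.mem_insert.1 hv with rfl | hv
      · exact hK0
      · intro h
        exact hH0 v hv (by rw [hHK, h, mul_zero])
    · rw [Finset.prod_insert hw, hFH, hHK, ← hord]
      ring

theorem finite_zeros_of_isCompact (hF : Differentiable ℂ F) {z₀ : ℂ} (h0 : F z₀ ≠ 0) {K : Set ℂ}
    (hK : IsCompact K) : (K ∩ {z | F z = 0}).Finite := by
  have hA : AnalyticOnNhd ℂ F Set.univ := hF.differentiableOn.analyticOnNhd isOpen_univ
  have h1 := hA.preimage_zero_mem_codiscrete h0
  have h2 : F ⁻¹' {0}ᶜ ∈ codiscreteWithin K := codiscreteWithin_mono (Set.subset_univ K) h1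
  have h3 := hK.finite_sdiff_of_mem_codiscreteWithin h2
  refine h3.subset fun z hz => ⟨hz.1, ?_⟩
  simpa using hz.2

/-- Once the zeros are factored out, the logarithmic derivative is a finite sum of simple poles plus
that of a function without zeros in the rectangle. Cauchy's formula evaluates the former and
Cauchy's theorem kills the latter. -/
theorem rectIntegral_mul_logDeriv (hF : Differentiable ℂ F) {a b c d : ℝ} (hab : a ≤ b)
    (hcd : c ≤ d) (hF0 : ∀ z ∈ rectFrame a b c d, F z ≠ 0) {g : ℂ → ℂ} {U : Set ℂ} (hU : IsOpen U)
    (hg : DifferentiableOn ℂ g U) (hUR : closedRect a b c d ⊆ U) (Z : Finset ℂ)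
    (hZ : ∀ z, z ∈ Z ↔ z ∈ closedRect a b c d ∧ F z = 0) :
    rectIntegral (fun z => g z * logDeriv F z) a b c d =
      2 * Real.pi * Complex.I * ∑ w ∈ Z, (analyticOrderNatAt F w : ℂ) * g w := by
  have hcorner : (a + c * Complex.I : ℂ) ∈ rectFrame a b c d :=
    bottom_mem_rectFrame hcd ⟨le_rfl, hab⟩
  obtain ⟨H, hH, hH0, hFH⟩ := exists_entire_eq_prod_mul hF (hF0 _ hcorner) Z
  have hZo : ∀ w ∈ Z, w ∈ openRect a b c d := fun w hw => by
    by_contra h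
    exact hF0 w ⟨((hZ w).1 hw).1, h⟩ ((hZ w).1 hw).2
  have hHR : ∀ z ∈ closedRect a b c d, H z ≠ 0 := fun z hz => by
    by_cases hzZ : z ∈ Z
    · exact hH0 z hzZ
    · intro h
      exact hzZ ((hZ z).2 ⟨hz, by rw [hFH, h, mul_zero]⟩)
  have hlog : ∀ z ∈ rectFrame a b c d, logDeriv F z =
      (∑ w ∈ Z, (analyticOrderNatAt F w : ℂ) * (z - w)⁻¹) + logDeriv H z := by
    intro z hz
    have hne : ∀ w ∈ Z, (z - w) ^ analyticOrderNatAt F w ≠ 0 := fun w hw =>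
      pow_ne_zero _ (sub_ne_zero_of_mem_rectFrame (hZo w hw) hz)
    have hFeq : F = fun z => (∏ w ∈ Z, (z - w) ^ analyticOrderNatAt F w) * H z := funext hFH
    conv_lhs => rw [hFeq]
    rw [logDeriv_mul z (f := fun z => ∏ w ∈ Z, (z - w) ^ analyticOrderNatAt F w)
      (Finset.prod_ne_zero_iff.2 hne) (hHR z hz.1) (by fun_prop) (hH z)]
    congr 1
    rw [logDeriv_prod (f := fun w z => (z - w) ^ analyticOrderNatAt F w) hne
      (fun w _ => by fun_prop)]
    refine Finset.sum_congr rfl fun w hw => ?_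
    rw [logDeriv_fun_pow (by fun_prop), logDeriv_apply]
    simp
  have hgc : ContinuousOn g (rectFrame a b c d) :=
    hg.continuousOn.mono (Set.sdiff_subset.trans hUR)
  have hlH : DifferentiableOn ℂ (fun z => g z * logDeriv H z) (closedRect a b c d) := by
    refine (hg.mono hUR).mul ?_
    have hd : Differentiable ℂ (deriv H) := fun z =>
      (hH.analyticAt z).deriv.differentiableAt
    exact hd.differentiableOn.div hH.differentiableOn hHR
  have hterm : ∀ w ∈ Z, ContinuousOn (fun z => (analyticOrderNatAt F w : ℂ) * (g z * (z - w)⁻¹))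
      (rectFrame a b c d) := fun w hw =>
    continuousOn_const.mul (hgc.mul ((continuousOn_id.sub continuousOn_const).inv₀ fun z hz =>
      sub_ne_zero_of_mem_rectFrame (hZo w hw) hz))
  rw [rectIntegral_congr (g := fun z =>
      (∑ w ∈ Z, (analyticOrderNatAt F w : ℂ) * (g z * (z - w)⁻¹)) + g z * logDeriv H z) hab hcd,
    rectIntegral_add hab hcd (continuousOn_finsetSum _ hterm)
      (hlH.continuousOn.mono Set.sdiff_subset),
    rectIntegral_eq_zero hab hcd hlH, rectIntegral_sum Z hab hcd hterm, add_zero, Finset.mul_sum]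
  · refine Finset.sum_congr rfl fun w hw => ?_
    rw [rectIntegral_const_mul, rectIntegral_mul_inv_sub hU hg hUR hab hcd (hZo w hw)]
    ring
  · intro z hz
    simp only [hlog z hz, mul_add, Finset.mul_sum]
    congr 1
    exact Finset.sum_congr rfl fun w _ => by ring

end ArgumentPrinciple

/-! Holomorphic integrable functions on a strip -/

section SubMean

variable {g : ℂ → ℂ}

/-- The mean value property on a circle, with the angle in (-π, π) to match polar coordinates, so
that integration over ρ gives the area form. -/
theorem two_pi_mul_enorm_le_lintegral_circle {z : ℂ} {ρ r : ℝ} (hρ : 0 < ρ) (hr : ρ < r)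
    (hg : DifferentiableOn ℂ g (Metric.ball z r)) :
    ENNReal.ofReal (2 * Real.pi) * ‖g z‖ₑ ≤
      ∫⁻ θ in Set.Ioo (-Real.pi) Real.pi, ‖g (z + Complex.polarCoord.symm (ρ, θ))‖ₑ := by
  have hsub : Metric.closedBall z ρ ⊆ Metric.ball z r := Metric.closedBall_subset_ball hr
  have hd : DiffContOnCl ℂ g (Metric.ball z |ρ|) := by
    rw [abs_of_pos hρ]
    exact (hg.mono (by rw [closure_ball _ hρ.ne']; exact hsub)).diffContOnCl
  have h1 := hd.circleAverage
  have h2 : (2 * Real.pi : ℂ) * g z = ∫ θ in (0 : ℝ)..2 * Real.pi, g (circleMap z ρ θ) := by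
    rw [← h1, Real.circleAverage_def]
    rw [Complex.real_smul]
    push_cast
    rw [← mul_assoc, mul_inv_cancel₀ (by simp [Real.pi_ne_zero]), one_mul]
  have h3 : ∫ θ in (0 : ℝ)..2 * Real.pi, g (circleMap z ρ θ) =
      ∫ θ in (-Real.pi)..Real.pi, g (circleMap z ρ θ) := by
    have hp : Function.Periodic (fun θ => g (circleMap z ρ θ)) (2 * Real.pi) := fun θ => by
      simp only [periodic_circleMap z ρ θ]
    have := hp.intervalIntegral_add_eq 0 (-Real.pi)
    rw [zero_add] at this
    rw [this]
    congr 1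
    ring
  have h4 : ∀ θ, circleMap z ρ θ = z + Complex.polarCoord.symm (ρ, θ) := fun θ => by
    simp [circleMap, Complex.polarCoord_symm_apply, Complex.exp_mul_I]
  calc ENNReal.ofReal (2 * Real.pi) * ‖g z‖ₑ = ‖(2 * Real.pi : ℂ) * g z‖ₑ := by
        rw [enorm_mul]
        congr 1
        rw [← ofReal_norm]
        congr 1
        simp [abs_of_pos Real.pi_pos]
    _ = ‖∫ θ in Set.Ioo (-Real.pi) Real.pi, g (circleMap z ρ θ)‖ₑ := by
        rw [h2, h3, intervalIntegral.integral_of_le (by linarith [Real.pi_pos]),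
          integral_Ioc_eq_integral_Ioo]
    _ ≤ ∫⁻ θ in Set.Ioo (-Real.pi) Real.pi, ‖g (circleMap z ρ θ)‖ₑ := enorm_integral_le_lintegral_enorm _
    _ = _ := by simp only [h4]

/-- The area form of the mean value inequality. -/
theorem mul_enorm_le_lintegral_ball {z : ℂ} {r : ℝ} (hr : 0 < r)
    (hg : DifferentiableOn ℂ g (Metric.ball z r)) :
    ENNReal.ofReal (Real.pi * r ^ 2) * ‖g z‖ₑ ≤ ∫⁻ w in Metric.ball z r, ‖g w‖ₑ := by
  classical
  -- Extended by zero off the disc and recentred at the origin, so that the polar change of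
  -- variables on the whole plane applies.
  set f : ℂ → ℝ≥0∞ := fun w => (Metric.ball z r).indicator (fun w => ‖g w‖ₑ) (z + w) with hf
  have hm0 : Measurable ((Metric.ball z r).indicator fun w => ‖g w‖ₑ) := by
    have : ((Metric.ball z r).indicator fun w => ‖g w‖ₑ) =
        (Metric.ball z r).piecewise (fun w => ‖g w‖ₑ) fun _ => 0 :=
      (Set.piecewise_eq_indicator).symm
    rw [this]
    exact (hg.continuousOn.enorm).measurable_piecewise continuousOn_const
      Metric.isOpen_ball.measurableSet
  have hm : Measurable f := hm0.comp (measurable_const_add z)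
  have h1 : ∫⁻ w in Metric.ball z r, ‖g w‖ₑ = ∫⁻ w, f w := by
    rw [← lintegral_indicator Metric.isOpen_ball.measurableSet]
    exact (lintegral_add_left_eq_self _ z).symm
  have hp : Measurable fun p : ℝ × ℝ => ENNReal.ofReal p.1 • f (Complex.polarCoord.symm p) := by
    have hfst : Measurable fun p : ℝ × ℝ => ENNReal.ofReal p.1 := by fun_prop
    refine hfst.smul (hm.comp ?_)
    have : Continuous fun p : ℝ × ℝ => (p.1 * (Real.cos p.2 + Real.sin p.2 * Complex.I) : ℂ) := by
      fun_prop
    have h2 : (fun p : ℝ × ℝ => Complex.polarCoord.symm p) =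
        fun p : ℝ × ℝ => (p.1 * (Real.cos p.2 + Real.sin p.2 * Complex.I) : ℂ) :=
      funext fun p => Complex.polarCoord_symm_apply p
    exact (h2 ▸ this.measurable :)
  rw [h1, ← Complex.lintegral_comp_polarCoord_symm, polarCoord_target, Measure.volume_eq_prod,
    ← Measure.prod_restrict, lintegral_prod _ hp.aemeasurable]
  have h5 : ∀ ρ ∈ Set.Ioo 0 r, ENNReal.ofReal ρ * (ENNReal.ofReal (2 * Real.pi) * ‖g z‖ₑ) ≤
      ∫⁻ θ in Set.Ioo (-Real.pi) Real.pi,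
        ENNReal.ofReal ρ • f (Complex.polarCoord.symm (ρ, θ)) := by
    intro ρ hρ
    simp only [smul_eq_mul]
    rw [lintegral_const_mul' _ _ ENNReal.ofReal_ne_top]
    gcongr
    refine (two_pi_mul_enorm_le_lintegral_circle hρ.1 hρ.2 hg).trans (lintegral_mono fun θ => ?_)
    simp only [hf]
    rw [Set.indicator_of_mem]
    simp [abs_of_pos hρ.1, hρ.2]
  calc ENNReal.ofReal (Real.pi * r ^ 2) * ‖g z‖ₑ
      = ∫⁻ ρ in Set.Ioo 0 r, ENNReal.ofReal ρ * (ENNReal.ofReal (2 * Real.pi) * ‖g z‖ₑ) := by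
        rw [lintegral_mul_const _ (by fun_prop), ← mul_assoc]
        congr 1
        rw [← ofReal_integral_eq_lintegral_ofReal, ← integral_Ioc_eq_integral_Ioo,
          ← intervalIntegral.integral_of_le hr.le, integral_id, ← ENNReal.ofReal_mul' (by positivity)]
        · congr 1
          ring
        · rw [← IntegrableOn, ← integrableOn_Ioc_iff_integrableOn_Ioo,
            ← intervalIntegrable_iff_integrableOn_Ioc_of_le hr.le]
          exact continuous_id.intervalIntegrable _ _
        · refine (ae_restrict_iff' measurableSet_Ioo).2 (Eventually.of_forall fun x hx => hx.1.le)
    _ ≤ ∫⁻ ρ in Set.Ioo 0 r, ∫⁻ θ in Set.Ioo (-Real.pi) Real.pi,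
        ENNReal.ofReal ρ • f (Complex.polarCoord.symm (ρ, θ)) :=
      setLIntegral_mono' measurableSet_Ioo h5
    _ ≤ _ := lintegral_mono_set Set.Ioo_subset_Ioi_self

end SubMean

section Strip

variable {g : ℂ → ℂ} {α β : ℝ}

theorem isOpen_strip : IsOpen (strip α β) :=
  (isOpen_Ioi.preimage Complex.continuous_im).inter (isOpen_Iio.preimage Complex.continuous_im)

theorem ball_subset_strip {z : ℂ} {r : ℝ} (h1 : α + r ≤ z.im) (h2 : z.im + r ≤ β) :
    Metric.ball z r ⊆ strip α β := fun w hw => by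
  have h3 : |(w - z).im| < r := (Complex.abs_im_le_norm _).trans_lt (by simpa [dist_eq_norm] using hw)
  rw [Complex.sub_im, abs_lt] at h3
  exact ⟨by linarith [h3.1], by linarith [h3.2]⟩

theorem measurable_indicator_strip (hg : ContinuousOn g (strip α β)) :
    Measurable ((strip α β).indicator fun w => ‖g w‖ₑ) := by
  classical
  rw [← Set.piecewise_eq_indicator]
  exact hg.enorm.measurable_piecewise continuousOn_const isOpen_strip.measurableSet

theorem mul_enorm_le_lintegral_strip (hg : DifferentiableOn ℂ g (strip α β)) {z : ℂ} {r : ℝ}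
    (hr : 0 < r) (h1 : α + r ≤ z.im) (h2 : z.im + r ≤ β) :
    ENNReal.ofReal (Real.pi * r ^ 2) * ‖g z‖ₑ ≤
      ∫⁻ w, (Metric.ball z r).indicator ((strip α β).indicator fun w => ‖g w‖ₑ) w := by
  refine (mul_enorm_le_lintegral_ball hr (hg.mono (ball_subset_strip h1 h2))).trans_eq ?_
  rw [lintegral_indicator Metric.isOpen_ball.measurableSet]
  refine setLIntegral_congr_fun Metric.isOpen_ball.measurableSet fun w hw => ?_
  rw [Set.indicator_of_mem (ball_subset_strip h1 h2 hw)]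

theorem lintegral_strip_ne_top (hgi : IntegrableOn g (strip α β) volume) :
    ∫⁻ w, (strip α β).indicator (fun w => ‖g w‖ₑ) w ≠ ∞ := by
  rw [lintegral_indicator isOpen_strip.measurableSet]
  exact hgi.2.ne

/-- The mean value inequality bounds |g| at a point of the line by its average over a disc of fixed
radius r inside the strip. After Tonelli, each w of the strip is counted for x in an interval of
length 2r only. -/
theorem integrable_line (hg : DifferentiableOn ℂ g (strip α β))
    (hgi : IntegrableOn g (strip α β) volume) {y : ℝ} (h1 : α < y) (h2 : y < β) :
    Integrable fun x : ℝ => g (x + y * Complex.I) := by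
  obtain ⟨r, hr, hr1, hr2⟩ : ∃ r > 0, α + r ≤ y ∧ y + r ≤ β :=
    ⟨min (y - α) (β - y), lt_min (by linarith) (by linarith),
      by linarith [min_le_left (y - α) (β - y)], by linarith [min_le_right (y - α) (β - y)]⟩
  have hmeas := measurable_indicator_strip hg.continuousOn
  set G := (strip α β).indicator fun w => ‖g w‖ₑ with hG
  have hcont : Continuous fun x : ℝ => g (x + y * Complex.I) := by
    rw [← continuousOn_univ]
    exact hg.continuousOn.comp (by fun_prop) fun x _ => by simp [strip, h1, h2]
  refine ⟨hcont.aestronglyMeasurable, ?_⟩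
  have hpt : ∀ x : ℝ, ENNReal.ofReal (Real.pi * r ^ 2) * ‖g (x + y * Complex.I)‖ₑ ≤
      ∫⁻ w, (Set.Ioo (w.re - r) (w.re + r)).indicator (fun _ => G w) x := by
    intro x
    refine (mul_enorm_le_lintegral_strip hg hr (by simpa using hr1) (by simpa using hr2)).trans
      (lintegral_mono fun w => ?_)
    by_cases hw : w ∈ Metric.ball (x + y * Complex.I : ℂ) r
    · have h3 : |(w - (x + y * Complex.I)).re| < r :=
        (Complex.abs_re_le_norm _).trans_lt (by simpa [dist_eq_norm] using hw)
      simp only [Complex.sub_re, Complex.add_re, Complex.ofReal_re, Complex.mul_re, Complex.I_re,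
        mul_zero, Complex.ofReal_im, Complex.I_im, zero_mul, sub_zero, add_zero, abs_lt] at h3
      rw [Set.indicator_of_mem hw, Set.indicator_of_mem (s := Set.Ioo (w.re - r) (w.re + r)) (by constructor <;> linarith [h3.1, h3.2])]
    · rw [Set.indicator_of_notMem hw]
      exact zero_le
  have hmeas2 : Measurable fun p : ℝ × ℂ =>
      (Set.Ioo (p.2.re - r) (p.2.re + r)).indicator (fun _ => G p.2) p.1 := by
    have hs : MeasurableSet {p : ℝ × ℂ | p.1 ∈ Set.Ioo (p.2.re - r) (p.2.re + r)} := by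
      refine IsOpen.measurableSet ?_
      have hre : Continuous fun p : ℝ × ℂ => p.2.re := Complex.continuous_re.comp continuous_snd
      exact (isOpen_lt (hre.sub continuous_const) continuous_fst).inter
        (isOpen_lt continuous_fst (hre.add continuous_const))
    exact (hmeas.comp measurable_snd).indicator hs
  have hfin : ENNReal.ofReal (Real.pi * r ^ 2) * ∫⁻ x : ℝ, ‖g (x + y * Complex.I)‖ₑ < ∞ := by
    rw [← lintegral_const_mul' _ _ ENNReal.ofReal_ne_top]
    refine (lintegral_mono hpt).trans_lt ?_
    rw [lintegral_lintegral_swap hmeas2.aemeasurable]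
    have : ∀ w : ℂ, ∫⁻ x, (Set.Ioo (w.re - r) (w.re + r)).indicator (fun _ => G w) x =
        G w * ENNReal.ofReal (2 * r) := fun w => by
      rw [lintegral_indicator measurableSet_Ioo, setLIntegral_const, Real.volume_Ioo]
      congr 2
      ring
    simp only [this]
    rw [lintegral_mul_const _ hmeas]
    exact ENNReal.mul_lt_top (lintegral_strip_ne_top hgi).lt_top ENNReal.ofReal_lt_top
  rw [hasFiniteIntegral_iff_enorm]
  refine lt_top_iff_ne_top.2 fun h => ?_
  rw [h, ENNReal.mul_top (by simpa using by positivity)] at hfin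
  exact lt_irrefl _ hfin

/-- A function that tends to zero uniformly on `y₁ ≤ Im z ≤ y₂` as `|Re z| → ∞`. -/
def DecaysOnStrip (g : ℂ → ℂ) (y₁ y₂ : ℝ) : Prop :=
  ∀ u : ℕ → ℝ, Tendsto (fun n => |u n|) atTop atTop → ∀ δ > 0, ∀ᶠ n in atTop,
    ∀ y ∈ Set.Icc y₁ y₂, ‖g (u n + y * Complex.I)‖ ≤ δ

/-- The discs centred on the segment Re z = u(n) lie in the slab |Re w - u(n)| < r, and the integral
of |g| over this slab tends to zero by dominated convergence. The bound is uniform in the height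
because the slab does not depend on it. -/
theorem decaysOnStrip_of_integrableOn (hg : DifferentiableOn ℂ g (strip α β))
    (hgi : IntegrableOn g (strip α β) volume) {y₁ y₂ : ℝ} (h1 : α < y₁) (h2 : y₂ < β) :
    DecaysOnStrip g y₁ y₂ := by
  obtain ⟨r, hr, hr1, hr2⟩ : ∃ r > 0, α + r ≤ y₁ ∧ y₂ + r ≤ β :=
    ⟨min (y₁ - α) (β - y₂), lt_min (by linarith) (by linarith),
      by linarith [min_le_left (y₁ - α) (β - y₂)], by linarith [min_le_right (y₁ - α) (β - y₂)]⟩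
  have hmeas := measurable_indicator_strip hg.continuousOn
  set G := (strip α β).indicator fun w => ‖g w‖ₑ with hG
  intro u hu δ hδ
  have hlim : Tendsto (fun n => ∫⁻ w, {w : ℂ | |w.re - u n| < r}.indicator G w) atTop (𝓝 0) := by
    have hz : ∫⁻ _ : ℂ, (0 : ℝ≥0∞) = 0 := lintegral_zero
    rw [← hz]
    refine tendsto_lintegral_of_dominated_convergence G (fun n => hmeas.indicator ?_)
      (fun n => Eventually.of_forall fun w => Set.indicator_le_self _ _ _)
      (lintegral_strip_ne_top hgi) (Eventually.of_forall fun w => ?_)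
    · refine IsOpen.measurableSet (isOpen_lt ?_ continuous_const)
      exact (Complex.continuous_re.sub continuous_const).abs
    · refine tendsto_const_nhds.congr' ?_
      filter_upwards [hu.eventually_ge_atTop (|w.re| + r)] with n hn
      rw [Set.indicator_of_notMem]
      simp only [Set.mem_ofPred_eq, not_lt]
      have := abs_sub_abs_le_abs_sub (u n) w.re
      rw [abs_sub_comm] at this
      linarith
  have hpos : 0 < ENNReal.ofReal (Real.pi * r ^ 2) * ENNReal.ofReal δ := by
    rw [← ENNReal.ofReal_mul (by positivity)]
    exact ENNReal.ofReal_pos.2 (by positivity)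
  filter_upwards [hlim.eventually_lt_const hpos] with n hn y hy
  have h3 := mul_enorm_le_lintegral_strip hg hr (z := u n + y * Complex.I)
    (by simpa using by linarith [hy.1]) (by simpa using by linarith [hy.2])
  have h4 : ∫⁻ w, (Metric.ball (u n + y * Complex.I : ℂ) r).indicator G w ≤
      ∫⁻ w, {w : ℂ | |w.re - u n| < r}.indicator G w := by
    refine lintegral_mono fun w => Set.indicator_le_indicator_of_subset ?_ (fun _ => zero_le) w
    intro w hw
    have h3 : |(w - (u n + y * Complex.I)).re| < r :=
      (Complex.abs_re_le_norm _).trans_lt (by simpa [dist_eq_norm] using hw)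
    simpa using h3
  have h5 := (ENNReal.mul_lt_mul_iff_right (by simpa using by positivity) ENNReal.ofReal_ne_top).1
    ((h3.trans h4).trans_lt hn)
  rw [← ofReal_norm, ENNReal.ofReal_lt_ofReal_iff hδ] at h5
  exact h5.le

end Strip

/-! The trace formula for entire functions whose zeros lie in a strip -/

/-- An entire function whose zeros lie in the strip `y₁ < Im z < y₂`, and whose logarithmic derivative
is bounded on the two boundary lines and on vertical segments tending to infinity on both sides. -/
structure HasStripZeros (F : ℂ → ℂ) (y₁ y₂ : ℝ) : Prop where
  lt : y₁ < y₂
  differentiable : Differentiable ℂ F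
  mem_strip : ∀ z, F z = 0 → z ∈ strip y₁ y₂
  bound : ∃ B, ∀ x : ℝ, ‖logDeriv F (x + y₁ * Complex.I)‖ ≤ B ∧ ‖logDeriv F (x + y₂ * Complex.I)‖ ≤ B
  vertical : ∃ (u v : ℕ → ℝ) (C : ℝ), Tendsto u atTop atBot ∧ Tendsto v atTop atTop ∧
    ∀ n, ∀ y ∈ Set.Icc y₁ y₂,
      (F (u n + y * Complex.I) ≠ 0 ∧ ‖logDeriv F (u n + y * Complex.I)‖ ≤ C) ∧
      F (v n + y * Complex.I) ≠ 0 ∧ ‖logDeriv F (v n + y * Complex.I)‖ ≤ C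

namespace HasStripZeros

variable {F g : ℂ → ℂ} {y₁ y₂ : ℝ}

theorem ne_zero_bottom (hF : HasStripZeros F y₁ y₂) (x : ℝ) : F (x + y₁ * Complex.I) ≠ 0 :=
  fun h => absurd (hF.mem_strip _ h).1 (by simp)

theorem ne_zero_top (hF : HasStripZeros F y₁ y₂) (x : ℝ) : F (x + y₂ * Complex.I) ≠ 0 :=
  fun h => absurd (hF.mem_strip _ h).2 (by simp)

theorem continuousAt_logDeriv (hF : HasStripZeros F y₁ y₂) {z : ℂ} (hz : F z ≠ 0) :
    ContinuousAt (logDeriv F) z :=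
  ((hF.differentiable.analyticAt z).deriv.continuousAt).div
    (hF.differentiable.continuous.continuousAt) hz

theorem continuous_logDeriv_line (hF : HasStripZeros F y₁ y₂) {y : ℝ}
    (hy : ∀ x : ℝ, F (x + y * Complex.I) ≠ 0) :
    Continuous fun x : ℝ => logDeriv F (x + y * Complex.I) := by
  refine continuous_iff_continuousAt.2 fun x => ?_
  exact ContinuousAt.comp (f := fun x : ℝ => (x + y * Complex.I : ℂ))
    (hF.continuousAt_logDeriv (hy x)) (by fun_prop)

theorem integrable_mul_logDeriv (hF : HasStripZeros F y₁ y₂) {y B : ℝ}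
    (hy : ∀ x : ℝ, F (x + y * Complex.I) ≠ 0) (hB : ∀ x : ℝ, ‖logDeriv F (x + y * Complex.I)‖ ≤ B)
    (hg : Integrable fun x : ℝ => g (x + y * Complex.I)) :
    Integrable fun x : ℝ => g (x + y * Complex.I) * logDeriv F (x + y * Complex.I) :=
  hg.mul_bdd (hF.continuous_logDeriv_line hy).aestronglyMeasurable (Eventually.of_forall hB)

/-- The zeros of `F` in a rectangle. -/
theorem finite_zeros (hF : HasStripZeros F y₁ y₂) (a b : ℝ) :
    (closedRect a b y₁ y₂ ∩ {z | F z = 0}).Finite :=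
  finite_zeros_of_isCompact hF.differentiable (hF.ne_zero_bottom 0) isCompact_closedRect

theorem countable_zeros (hF : HasStripZeros F y₁ y₂) : {z | F z = 0}.Countable := by
  have : {z | F z = 0} ⊆ ⋃ n : ℕ, (closedRect (-n) n y₁ y₂ ∩ {z | F z = 0}) := by
    intro z hz
    obtain ⟨n, hn⟩ := exists_nat_ge |z.re|
    exact Set.mem_iUnion.2 ⟨n, ⟨abs_le.1 hn, (hF.mem_strip z hz).1.le, (hF.mem_strip z hz).2.le⟩, hz⟩
  exact (Set.countable_iUnion fun n : ℕ => (hF.finite_zeros _ _).countable).mono this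

/-- Argument principle on rectangles bounded by the good vertical segments, whose contribution
vanishes as g decays. Absolute convergence is not yet known, so the limit is along one exhaustion of
the zeros. The domain of g is an arbitrary open neighbourhood of the closed strip, so that
meromorphic test functions with poles off it are allowed. -/
theorem exists_tendsto (hF : HasStripZeros F y₁ y₂) :
    ∃ Z : ℕ → Finset ℂ, (∀ n, ∀ z ∈ Z n, F z = 0) ∧ (∀ z, F z = 0 → ∀ᶠ n in atTop, z ∈ Z n) ∧
      ∀ (g : ℂ → ℂ) (U : Set ℂ), IsOpen U → DifferentiableOn ℂ g U →
        (∀ z : ℂ, y₁ ≤ z.im → z.im ≤ y₂ → z ∈ U) →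
        Integrable (fun x : ℝ => g (x + y₁ * Complex.I)) →
        Integrable (fun x : ℝ => g (x + y₂ * Complex.I)) → DecaysOnStrip g y₁ y₂ →
        Tendsto (fun n => ∑ w ∈ Z n, (analyticOrderNatAt F w : ℂ) * g w) atTop
          (𝓝 ((2 * Real.pi * Complex.I)⁻¹ *
            ((∫ x : ℝ, g (x + y₁ * Complex.I) * logDeriv F (x + y₁ * Complex.I)) -
              ∫ x : ℝ, g (x + y₂ * Complex.I) * logDeriv F (x + y₂ * Complex.I)))) := by
  obtain ⟨u, v, C, hu, hv, hC⟩ := hF.vertical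
  obtain ⟨B, hB⟩ := hF.bound
  have huv : ∀ᶠ n in atTop, u n ≤ v n := by
    filter_upwards [hu.eventually_le_atBot 0, hv.eventually_ge_atTop 0] with n h1 h2
    exact h1.trans h2
  have hfin : ∀ n, (closedRect (u n) (v n) y₁ y₂ ∩ {z | F z = 0}).Finite := fun n =>
    hF.finite_zeros _ _
  have hmemZ : ∀ n z, z ∈ (hfin n).toFinset ↔ z ∈ closedRect (u n) (v n) y₁ y₂ ∧ F z = 0 :=
    fun n z => by simp
  refine ⟨fun n => (hfin n).toFinset, fun n z hz => ((hmemZ n z).1 hz).2, fun z hz => ?_, ?_⟩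
  · filter_upwards [hu.eventually_le_atBot z.re, hv.eventually_ge_atTop z.re] with n h1 h2
    rw [hmemZ]
    exact ⟨⟨⟨h1, h2⟩, (hF.mem_strip z hz).1.le, (hF.mem_strip z hz).2.le⟩, hz⟩
  intro g U hU hg hsU hg1 hg2 hdec
  have hsum : ∀ᶠ n in atTop, (2 * Real.pi * Complex.I)⁻¹ *
      rectIntegral (fun z => g z * logDeriv F z) (u n) (v n) y₁ y₂ =
      ∑ w ∈ (hfin n).toFinset, (analyticOrderNatAt F w : ℂ) * g w := by
    filter_upwards [huv] with n hn
    rw [rectIntegral_mul_logDeriv hF.differentiable hn hF.lt.le ?_ hU hg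
      (fun z hz => hsU z hz.2.1 hz.2.2) (hfin n).toFinset (hmemZ n), inv_mul_cancel_left₀]
    · simp [Real.pi_ne_zero]
    · intro z hz h0
      have hs := hF.mem_strip z h0
      refine hz.2 ⟨⟨lt_of_le_of_ne hz.1.1.1 fun h => ?_, lt_of_le_of_ne hz.1.1.2 fun h => ?_⟩, hs⟩
      · refine (hC n z.im ⟨hs.1.le, hs.2.le⟩).1.1 ?_
        rwa [h, Complex.re_add_im]
      · refine (hC n z.im ⟨hs.1.le, hs.2.le⟩).2.1 ?_
        rwa [← h, Complex.re_add_im]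
  refine Tendsto.congr' hsum (Tendsto.const_mul _ ?_)
  have hint1 := intervalIntegral_tendsto_integral
    (hF.integrable_mul_logDeriv hF.ne_zero_bottom (fun x => (hB x).1) hg1) hu hv
  have hint2 := intervalIntegral_tendsto_integral
    (hF.integrable_mul_logDeriv hF.ne_zero_top (fun x => (hB x).2) hg2) hu hv
  have hside : ∀ t : ℕ → ℝ, Tendsto (fun n => |t n|) atTop atTop →
      (∀ n, ∀ y ∈ Set.Icc y₁ y₂, ‖logDeriv F (t n + y * Complex.I)‖ ≤ C) →
      Tendsto (fun n => Complex.I * ∫ y in y₁..y₂, g (t n + y * Complex.I) *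
        logDeriv F (t n + y * Complex.I)) atTop (𝓝 0) := by
    intro t ht htC
    have hC0 : 0 ≤ C := (norm_nonneg _).trans (htC 0 y₁ ⟨le_rfl, hF.lt.le⟩)
    have hL : 0 < y₂ - y₁ := sub_pos.2 hF.lt
    rw [Metric.tendsto_nhds]
    intro η hη
    filter_upwards [hdec t ht (η / 2 / ((C + 1) * (y₂ - y₁))) (by positivity)] with n hn
    rw [dist_zero_right, norm_mul, Complex.norm_I, one_mul]
    have hb : ∀ y ∈ Set.uIoc y₁ y₂, ‖g (t n + y * Complex.I) * logDeriv F (t n + y * Complex.I)‖ ≤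
        η / 2 / ((C + 1) * (y₂ - y₁)) * (C + 1) := by
      intro y hy
      rw [Set.uIoc_of_le hF.lt.le] at hy
      have hy' : y ∈ Set.Icc y₁ y₂ := ⟨hy.1.le, hy.2⟩
      rw [norm_mul]
      exact mul_le_mul (hn y hy') ((htC n y hy').trans (by linarith)) (norm_nonneg _)
        (by positivity)
    refine (intervalIntegral.norm_integral_le_of_norm_le_const hb).trans_lt ?_
    rw [abs_of_pos hL]
    have : η / 2 / ((C + 1) * (y₂ - y₁)) * (C + 1) * (y₂ - y₁) = η / 2 := by
      field_simp
    linarith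
  have h1 := hside u (tendsto_abs_atBot_atTop.comp hu) fun n y hy => (hC n y hy).1.2
  have h2 := hside v (tendsto_abs_atTop_atTop.comp hv) fun n y hy => (hC n y hy).2.2
  have h3 := ((hint1.sub hint2).add h2).sub h1
  simpa only [rectIntegral, add_zero, sub_zero] using h3

/-- The number of zeros with real part in a unit window is bounded uniformly. -/
theorem exists_card_bound (hF : HasStripZeros F y₁ y₂) :
    ∃ C : ℝ, ∀ (s : ℝ) (T : Finset ℂ), (∀ z ∈ T, F z = 0 ∧ |z.re - s| ≤ 1) →
      ∑ z ∈ T, (analyticOrderNatAt F z : ℝ) ≤ C := by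
  obtain ⟨Z, hZ0, hZ, hlim⟩ := hF.exists_tendsto
  obtain ⟨B, hB⟩ := hF.bound
  -- With this A the function A + (z - s)² has real part at least 1 + (Re z - s)² on the closed
  -- strip, so its inverse h has positive real part there and is dominated by a Cauchy kernel of
  -- total mass π, whatever s is.
  set A : ℝ := 1 + y₁ ^ 2 + y₂ ^ 2 with hA
  have hA1 : 1 ≤ A := by nlinarith [sq_nonneg y₁, sq_nonneg y₂]
  have hB0 : 0 ≤ B := (norm_nonneg _).trans (hB 0).1
  refine ⟨(2 * A + 1) ^ 2 * B, fun s T hT => ?_⟩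
  set k : ℂ → ℂ := fun z => A + (z - s) ^ 2 with hk
  set h : ℂ → ℂ := fun z => (k z)⁻¹ with hh
  have hkc : Differentiable ℂ k := by fun_prop
  have hkre : ∀ z : ℂ, (k z).re = A + (z.re - s) ^ 2 - z.im ^ 2 := fun z => by
    simp [hk, pow_two]
    ring
  have hsq : ∀ y : ℝ, y₁ ≤ y → y ≤ y₂ → y ^ 2 ≤ y₁ ^ 2 + y₂ ^ 2 := fun y hy1 hy2 => by
    rcases le_total 0 y with h0 | h0
    · nlinarith [sq_nonneg y₁]
    · nlinarith [sq_nonneg y₂]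
  have hkre1 : ∀ z : ℂ, y₁ ≤ z.im → z.im ≤ y₂ → 1 + (z.re - s) ^ 2 ≤ (k z).re := fun z h1 h2 => by
    rw [hkre, hA]
    linarith [hsq _ h1 h2]
  have hhb : ∀ z : ℂ, y₁ ≤ z.im → z.im ≤ y₂ → ‖h z‖ ≤ (1 + (z.re - s) ^ 2)⁻¹ := fun z h1 h2 => by
    rw [hh, norm_inv]
    exact inv_anti₀ (by positivity) ((hkre1 z h1 h2).trans (Complex.re_le_norm _))
  have hint0 : Integrable fun x : ℝ => (1 + (x - s) ^ 2)⁻¹ :=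
    integrable_inv_one_add_sq.comp_sub_right s
  have hint0v : ∫ x : ℝ, (1 + (x - s) ^ 2)⁻¹ = Real.pi := by
    rw [integral_sub_right_eq_self (fun x : ℝ => (1 + x ^ 2)⁻¹) s, integral_univ_inv_one_add_sq]
  have hline : ∀ y : ℝ, y₁ ≤ y → y ≤ y₂ →
      Integrable fun x : ℝ => h (x + y * Complex.I) := fun y hy1 hy2 => by
    refine hint0.mono' ?_ (Eventually.of_forall fun x => ?_)
    · refine Continuous.aestronglyMeasurable (Continuous.inv₀ (by fun_prop) fun x hx => ?_)
      have := hkre1 (x + y * Complex.I) (by simpa using hy1) (by simpa using hy2)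
      rw [hx] at this
      simp only [Complex.zero_re] at this
      nlinarith [sq_nonneg ((x + y * Complex.I : ℂ).re - s)]
    · have := hhb (x + y * Complex.I) (by simpa using hy1) (by simpa using hy2)
      simpa using this
  have hdec : DecaysOnStrip h y₁ y₂ := by
    intro u hu δ hδ
    filter_upwards [hu.eventually_ge_atTop (|s| + 1 + δ⁻¹)] with n hn y hy
    refine (hhb _ (by simpa using hy.1) (by simpa using hy.2)).trans ?_
    simp only [Complex.add_re, Complex.ofReal_re, Complex.mul_re, Complex.I_re, mul_zero,
      Complex.ofReal_im, Complex.I_im, zero_mul, sub_zero, add_zero]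
    have h1 : 1 + δ⁻¹ ≤ |u n - s| := by linarith [abs_sub_abs_le_abs_sub (u n) s]
    have hδ' : 0 < δ⁻¹ := inv_pos.2 hδ
    refine inv_le_of_inv_le₀ hδ ?_
    rw [← sq_abs]
    nlinarith
  have hU : IsOpen {z | k z ≠ 0} := isOpen_ne_fun hkc.continuous continuous_const
  have ht := hlim h {z | k z ≠ 0} hU (fun z hz => (hkc z).differentiableWithinAt.inv hz)
    (fun z h1 h2 h0 => by
      have := hkre1 z h1 h2
      rw [h0, Complex.zero_re] at this
      nlinarith [sq_nonneg (z.re - s)]) (hline y₁ le_rfl hF.lt.le) (hline y₂ hF.lt.le le_rfl) hdec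
  have hlineB : ∀ y : ℝ, y₁ ≤ y → y ≤ y₂ → (∀ x : ℝ, ‖logDeriv F (x + y * Complex.I)‖ ≤ B) →
      ‖∫ x : ℝ, h (x + y * Complex.I) * logDeriv F (x + y * Complex.I)‖ ≤ Real.pi * B := by
    intro y hy1 hy2 hyB
    refine (norm_integral_le_of_norm_le (hint0.mul_const B) (Eventually.of_forall fun x => ?_)).trans_eq
      (by rw [integral_mul_const, hint0v])
    rw [norm_mul]
    have := hhb (x + y * Complex.I) (by simpa using hy1) (by simpa using hy2)
    exact mul_le_mul (by simpa using this) (hyB x) (norm_nonneg _) (by positivity)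
  have hre0 : ∀ z, F z = 0 → 0 ≤ (h z).re := fun z hz => by
    have hs := hF.mem_strip z hz
    rw [hh, Complex.inv_re]
    have := hkre1 z hs.1.le hs.2.le
    exact div_nonneg (by nlinarith [sq_nonneg (z.re - s)]) (Complex.normSq_nonneg _)
  -- In the window |A + (z - s)²| ≤ 2A + 1, and Re h is the real part of A + (z - s)², which is at
  -- least 1, divided by the square of this modulus.
  have hre1 : ∀ z ∈ T, ((2 * A + 1) ^ 2)⁻¹ ≤ (h z).re := fun z hz => by
    have hs := hF.mem_strip z (hT z hz).1
    have h1 : (z.re - s) ^ 2 ≤ 1 := by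
      rw [← sq_abs]
      nlinarith [(hT z hz).2, abs_nonneg (z.re - s)]
    have h2 := hsq z.im hs.1.le hs.2.le
    have hkr := hkre1 z hs.1.le hs.2.le
    have hkpos : 0 < ‖k z‖ := lt_of_lt_of_le (by positivity) (hkr.trans (Complex.re_le_norm _))
    have hnorm : ‖k z‖ ≤ 2 * A + 1 := by
      refine (norm_add_le _ _).trans ?_
      rw [norm_pow, Complex.sq_norm, Complex.normSq_apply, Complex.norm_real, Real.norm_eq_abs,
        abs_of_pos (by linarith)]
      simp only [Complex.sub_re, Complex.ofReal_re, Complex.sub_im, Complex.ofReal_im, sub_zero]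
      nlinarith
    rw [hh, Complex.inv_re, ← Complex.sq_norm]
    calc ((2 * A + 1) ^ 2)⁻¹ ≤ (‖k z‖ ^ 2)⁻¹ := by gcongr
      _ = 1 / ‖k z‖ ^ 2 := (one_div _).symm
      _ ≤ _ := by
        gcongr
        nlinarith [sq_nonneg (z.re - s)]
  -- The zeros outside T contribute nonnegatively to Re Σ m h, so they may be dropped. The two lines
  -- together contribute at most 2πB/(2π) = B.
  have hsum : ((2 * A + 1) ^ 2)⁻¹ * ∑ z ∈ T, (analyticOrderNatAt F z : ℝ) ≤ B := by
    have hle := le_of_tendsto_of_tendsto (tendsto_const_nhds (x := ((2 * A + 1) ^ 2)⁻¹ *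
      ∑ z ∈ T, (analyticOrderNatAt F z : ℝ))) (Complex.continuous_re.continuousAt.tendsto.comp ht) ?_
    · refine hle.trans ((Complex.re_le_norm _).trans ?_)
      rw [norm_mul, norm_inv]
      have hpi : ‖(2 * Real.pi * Complex.I : ℂ)‖ = 2 * Real.pi := by
        simp [abs_of_pos Real.pi_pos]
      rw [hpi, inv_mul_le_iff₀ (by positivity)]
      refine (norm_sub_le _ _).trans ?_
      linarith [hlineB y₁ le_rfl hF.lt.le fun x => (hB x).1,
        hlineB y₂ hF.lt.le le_rfl fun x => (hB x).2]
    · have hTZ : ∀ᶠ n in atTop, ∀ z ∈ T, z ∈ Z n :=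
        (Filter.eventually_all_finset T).2 fun z hz => hZ z (hT z hz).1
      filter_upwards [hTZ] with n hn
      simp only [Function.comp_apply, Complex.re_sum]
      rw [Finset.mul_sum]
      have hterm : ∀ z, ((analyticOrderNatAt F z : ℂ) * h z).re =
          (analyticOrderNatAt F z : ℝ) * (h z).re := fun z => by simp
      simp only [hterm]
      calc ∑ z ∈ T, ((2 * A + 1) ^ 2)⁻¹ * (analyticOrderNatAt F z : ℝ)
          ≤ ∑ z ∈ T, (analyticOrderNatAt F z : ℝ) * (h z).re := by
            refine Finset.sum_le_sum fun z hz => ?_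
            rw [mul_comm]
            exact mul_le_mul_of_nonneg_left (hre1 z hz) (Nat.cast_nonneg _)
        _ ≤ _ := Finset.sum_le_sum_of_subset_of_nonneg hn fun z hz _ =>
            mul_nonneg (Nat.cast_nonneg _) (hre0 z (hZ0 n z hz))
  rwa [inv_mul_le_iff₀ (by positivity)] at hsum

/-- Each |g(z)| is bounded by its average over a disc of radius r = min(ε, 1) around the zero z. The
zeros whose disc contains a given w have real part within 1 of Re w, so they number at most C with
multiplicity, and the sum is at most C/(πr²) times the integral of |g|. -/
theorem summable_norm (hF : HasStripZeros F y₁ y₂) {ε : ℝ} (hε : 0 < ε)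
    (hg : DifferentiableOn ℂ g (strip (y₁ - ε) (y₂ + ε)))
    (hgi : IntegrableOn g (strip (y₁ - ε) (y₂ + ε)) volume) :
    Summable fun z => ‖(analyticOrderNatAt F z : ℂ) * g z‖ := by
  classical
  obtain ⟨C, hC⟩ := hF.exists_card_bound
  have hmeas := measurable_indicator_strip hg.continuousOn
  have hGfin := lintegral_strip_ne_top hgi
  set G := (strip (y₁ - ε) (y₂ + ε)).indicator fun w => ‖g w‖ₑ with hG
  set r := min ε 1 with hr
  have hr0 : 0 < r := lt_min hε one_pos
  have hrε : r ≤ ε := min_le_left _ _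
  have hr1 : r ≤ 1 := min_le_right _ _
  have hbound : ∀ T : Finset ℂ, ENNReal.ofReal (Real.pi * r ^ 2) *
      ∑ z ∈ T, ENNReal.ofReal ‖(analyticOrderNatAt F z : ℂ) * g z‖ ≤ ENNReal.ofReal C * ∫⁻ w, G w := by
    intro T
    have hpt : ∀ z ∈ T, ENNReal.ofReal (Real.pi * r ^ 2) *
        ENNReal.ofReal ‖(analyticOrderNatAt F z : ℂ) * g z‖ ≤
        ∫⁻ w, (Metric.ball z r).indicator (fun w => (analyticOrderNatAt F z : ℝ≥0∞) * G w) w := by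
      intro z _
      by_cases hz : F z = 0
      · have hs := hF.mem_strip z hz
        have := mul_enorm_le_lintegral_strip hg hr0 (z := z) (by linarith [hs.1])
          (by linarith [hs.2])
        have heq : ∀ w, (Metric.ball z r).indicator
            (fun w => (analyticOrderNatAt F z : ℝ≥0∞) * G w) w =
            (analyticOrderNatAt F z : ℝ≥0∞) * (Metric.ball z r).indicator G w := fun w => by
          by_cases hw : w ∈ Metric.ball z r
          · simp only [Set.indicator_of_mem hw]
          · simp only [Set.indicator_of_notMem hw, mul_zero]
        simp only [heq]
        rw [lintegral_const_mul' _ _ (ENNReal.natCast_ne_top _), norm_mul, Complex.norm_natCast,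
          ENNReal.ofReal_mul (Nat.cast_nonneg _), ENNReal.ofReal_natCast, mul_left_comm, ofReal_norm]
        gcongr
      · have : analyticOrderNatAt F z = 0 := by
          simp [analyticOrderNatAt, (hF.differentiable.analyticAt z).analyticOrderAt_eq_zero.2 hz]
        simp [this]
    rw [Finset.mul_sum]
    refine (Finset.sum_le_sum hpt).trans ?_
    rw [← lintegral_finsetSum']
    · rw [← lintegral_const_mul' _ _ ENNReal.ofReal_ne_top]
      refine lintegral_mono fun w => ?_
      have h1 : ∀ z, (Metric.ball z r).indicator
          (fun w => (analyticOrderNatAt F z : ℝ≥0∞) * G w) w =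
          (if F z = 0 ∧ w ∈ Metric.ball z r then (analyticOrderNatAt F z : ℝ≥0∞) else 0) * G w := by
        intro z
        by_cases hw : w ∈ Metric.ball z r
        · rw [Set.indicator_of_mem hw]
          by_cases hz : F z = 0
          · rw [if_pos ⟨hz, hw⟩]
          · have : analyticOrderNatAt F z = 0 := by
              simp [analyticOrderNatAt, (hF.differentiable.analyticAt z).analyticOrderAt_eq_zero.2 hz]
            simp [this]
        · rw [Set.indicator_of_notMem hw, if_neg (fun h => hw h.2), zero_mul]
      simp only [h1]
      rw [← Finset.sum_mul, ← Finset.sum_filter]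
      gcongr
      have h2 := hC w.re (T.filter fun z => F z = 0 ∧ w ∈ Metric.ball z r) fun z hz => by
        obtain ⟨_, h3, h4⟩ := Finset.mem_filter.1 hz
        refine ⟨h3, ?_⟩
        rw [← Complex.sub_re]
        refine (Complex.abs_re_le_norm _).trans ?_
        rw [Metric.mem_ball, dist_comm, dist_eq_norm] at h4
        linarith
      have h3 := ENNReal.ofReal_le_ofReal h2
      rw [ENNReal.ofReal_sum_of_nonneg fun _ _ => Nat.cast_nonneg _] at h3
      simpa only [ENNReal.ofReal_natCast] using h3
    · intro z _
      exact ((hmeas.const_mul _).indicator Metric.isOpen_ball.measurableSet).aemeasurable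
  have hfin : ENNReal.ofReal C * ∫⁻ w, G w ≠ ∞ := ENNReal.mul_ne_top ENNReal.ofReal_ne_top hGfin
  refine summable_of_sum_le (c := (ENNReal.ofReal C * ∫⁻ w, G w).toReal / (Real.pi * r ^ 2))
    (fun _ => norm_nonneg _) fun T => ?_
  rw [le_div_iff₀ (by positivity), mul_comm]
  have := (ENNReal.toReal_le_toReal (ne_top_of_le_ne_top hfin (hbound T)) hfin).2 (hbound T)
  rwa [← ENNReal.ofReal_sum_of_nonneg fun _ _ => norm_nonneg _, ← ENNReal.ofReal_mul (by positivity),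
    ENNReal.toReal_ofReal (mul_nonneg (by positivity) (Finset.sum_nonneg fun _ _ => norm_nonneg _))]
    at this

/-- The sum of `g` over the zeros of `F`, as a contour integral. -/
theorem hasSum (hF : HasStripZeros F y₁ y₂) {ε : ℝ} (hε : 0 < ε)
    (hg : DifferentiableOn ℂ g (strip (y₁ - ε) (y₂ + ε)))
    (hgi : IntegrableOn g (strip (y₁ - ε) (y₂ + ε)) volume) :
    HasSum (fun z => (analyticOrderNatAt F z : ℂ) * g z)
      ((2 * Real.pi * Complex.I)⁻¹ *
        ((∫ x : ℝ, g (x + y₁ * Complex.I) * logDeriv F (x + y₁ * Complex.I)) -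
          ∫ x : ℝ, g (x + y₂ * Complex.I) * logDeriv F (x + y₂ * Complex.I))) := by
  classical
  have hs := (hF.summable_norm hε hg hgi).of_norm
  obtain ⟨Z, hZ0, hZ, hlim⟩ := hF.exists_tendsto
  have hlt := hF.lt
  have h1 := hlim g _ isOpen_strip hg (fun z h1 h2 => ⟨by linarith, by linarith⟩)
    (integrable_line hg hgi (by linarith) (by linarith))
    (integrable_line hg hgi (by linarith) (by linarith))
    (decaysOnStrip_of_integrableOn hg hgi (by linarith) (by linarith))
  have hsupp : Function.support (fun z => (analyticOrderNatAt F z : ℂ) * g z) ⊆ {z | F z = 0} := by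
    intro z hz
    by_contra h0
    refine hz ?_
    have : analyticOrderNatAt F z = 0 := by
      simp [analyticOrderNatAt, (hF.differentiable.analyticAt z).analyticOrderAt_eq_zero.2 h0]
    simp [this]
  obtain ⟨S, hS⟩ := hs
  have hS' := (hasSum_subtype_iff_of_support_subset hsupp).2 hS
  set W : ℕ → Finset {z // F z = 0} := fun n => (Z n).subtype fun z => F z = 0 with hW
  have hWt : Tendsto W atTop atTop := by
    refine tendsto_atTop.2 fun T => ?_
    filter_upwards [(Filter.eventually_all_finset T).2 fun z _ => hZ z.1 z.2] with n hn z hz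
    exact Finset.mem_subtype.2 (hn z hz)
  -- Absolute convergence makes the sum independent of the exhaustion, hence equal to the limit
  -- along the rectangles.
  have h2 := hS'.comp hWt
  have h3 : ∀ n, ∑ z ∈ W n, (fun z => (analyticOrderNatAt F z : ℂ) * g z) z.1 =
      ∑ w ∈ Z n, (analyticOrderNatAt F w : ℂ) * g w := fun n =>
    Finset.sum_subtype_of_mem (fun z => (analyticOrderNatAt F z : ℂ) * g z) (hZ0 n)
  have h4 : S = _ := tendsto_nhds_unique (h2.congr h3) h1
  rwa [h4] at hS

end HasStripZeros

/-! Determinants `det (1 - S D(z))` with `D(z)` a diagonal matrix of exponentials -/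

section Jacobi

variable {ι : Type*} [Fintype ι] [DecidableEq ι]

/-- Jacobi's formula. -/
theorem hasDerivAt_det {M : ℂ → Matrix ι ι ℂ} {M' : Matrix ι ι ℂ} {z : ℂ}
    (h : ∀ i j, HasDerivAt (fun w => M w i j) (M' i j) z) :
    HasDerivAt (fun w => (M w).det) ((M z).adjugate * M').trace z := by
  have h1 : HasDerivAt (fun w => (M w).det) (∑ σ : Equiv.Perm ι, (Equiv.Perm.sign σ : ℂ) *
      ∑ i, (∏ j ∈ Finset.univ.erase i, M z (σ j) j) * M' (σ i) i) z := by
    have : (fun w => (M w).det) =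
        fun w => ∑ σ : Equiv.Perm ι, (Equiv.Perm.sign σ : ℂ) * ∏ i, M w (σ i) i := by
      funext w
      rw [Matrix.det_apply']
    rw [this]
    refine HasDerivAt.fun_sum fun σ _ => HasDerivAt.const_mul _ ?_
    have := HasDerivAt.fun_finsetProd (u := Finset.univ) (f := fun i w => M w (σ i) i)
      (f' := fun i => M' (σ i) i) (x := z) fun i _ => h (σ i) i
    simpa only [smul_eq_mul] using this
  convert h1 using 1
  simp only [Matrix.trace, Matrix.diag]
  -- By Cramer's rule, a diagonal entry of adj(M) M' is the determinant of M with column i replaced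
  -- by that of M'.
  have h2 : ∀ i, ((M z).adjugate * M') i i = ((M z).updateCol i fun k => M' k i).det := by
    intro i
    rw [← Matrix.cramer_apply, Matrix.cramer_eq_adjugate_mulVec]
    rfl
  simp only [h2, Matrix.det_apply', Finset.mul_sum]
  rw [Finset.sum_comm]
  refine Finset.sum_congr rfl fun σ _ => Finset.sum_congr rfl fun i _ => ?_
  congr 1
  rw [← Finset.mul_prod_erase _ _ (Finset.mem_univ i), mul_comm]
  congr 1
  · refine Finset.prod_congr rfl fun j hj => ?_
    rw [Matrix.updateCol_ne (Finset.ne_of_mem_erase hj)]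
  · rw [Matrix.updateCol_self]

end Jacobi

/-! ### Simultaneous recurrence of finitely many phases -/

theorem continuous_circle_coe : Continuous fun x : Circle => (x : ℂ) := by fun_prop

/-- The phases `exp (i t ℓ b)` are simultaneously close to `1` for arbitrarily large `t`. -/
theorem exists_tendsto_exp_one {ι : Type*} [Finite ι] (ℓ : ι → ℝ) : ∃ t : ℕ → ℝ, Tendsto t atTop atTop ∧
    Tendsto (fun n => fun b => Complex.exp (Complex.I * (t n : ℂ) * (ℓ b : ℂ))) atTop (𝓝 1) ∧
    Tendsto (fun n => fun b => Complex.exp (Complex.I * (-(t n) : ℂ) * (ℓ b : ℂ))) atTop (𝓝 1) := by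
  set x : ι → Circle := fun b => Circle.exp (ℓ b) with hx
  -- In the compact torus the powers of any element accumulate at 1. The negative times follow by
  -- inversion.
  obtain ⟨φ, hφ, hlim⟩ := (mapClusterPt_one_atTop_pow x).tendsto_subseq
  have hpow : ∀ (n : ℕ) (b : ι), (((x ^ n) b : Circle) : ℂ) = Complex.exp (Complex.I * (n : ℝ) * (ℓ b : ℂ)) := by
    intro n b
    rw [hx, Pi.pow_apply, Circle.coe_pow, Circle.coe_exp, ← Complex.exp_nat_mul]
    congr 1
    push_cast
    ring
  have hpowinv : ∀ (n : ℕ) (b : ι), ((((x ^ n) b)⁻¹ : Circle) : ℂ) =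
      Complex.exp (Complex.I * (-(n : ℝ) : ℂ) * (ℓ b : ℂ)) := by
    intro n b
    rw [Circle.coe_inv, hpow, ← Complex.exp_neg]
    congr 1
    ring
  refine ⟨fun n => (φ n : ℝ), tendsto_natCast_atTop_atTop.comp hφ.tendsto_atTop, ?_, ?_⟩
  · refine tendsto_pi_nhds.2 fun b => ?_
    have h1 := (tendsto_pi_nhds.1 hlim) b
    have h2 := (continuous_circle_coe.tendsto _).comp h1
    simp only [Pi.one_apply, Circle.coe_one] at h2 ⊢
    refine h2.congr fun n => ?_
    simpa using hpow (φ n) b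
  · refine tendsto_pi_nhds.2 fun b => ?_
    have h1 := (tendsto_pi_nhds.1 hlim) b
    have h2 := (continuous_circle_coe.tendsto _).comp h1.inv
    simp only [Pi.one_apply, inv_one, Circle.coe_one] at h2 ⊢
    refine h2.congr fun n => ?_
    simpa using hpowinv (φ n) b

/-! ### Secular determinants: logarithmic derivative, recurrence and Neumann series -/

section Propagator

variable {ι : Type*} [Fintype ι] [DecidableEq ι]

/-- The matrix `S D`, where `D` is the diagonal matrix with entries `θ b * exp (i z ℓ b)`. -/
noncomputable def twistedProp (S : Matrix ι ι ℂ) (ℓ : ι → ℝ) (θ : ι → ℂ) (z : ℂ) : Matrix ι ι ℂ :=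
  S * Matrix.diagonal fun b => θ b * Complex.exp (Complex.I * z * (ℓ b : ℂ))

/-- The matrix `S D(z)`, where `D(z)` is the diagonal matrix with entries `exp (i z ℓ b)`. -/
noncomputable def propMat (S : Matrix ι ι ℂ) (ℓ : ι → ℝ) (z : ℂ) : Matrix ι ι ℂ :=
  S * Matrix.diagonal fun b => Complex.exp (Complex.I * z * (ℓ b : ℂ))

/-- The determinant `det (1 - S D(z))`. -/
noncomputable def propDet (S : Matrix ι ι ℂ) (ℓ : ι → ℝ) (z : ℂ) : ℂ := (1 - propMat S ℓ z).det

/-- The derivative of `det (1 - S D(z))` in terms of the matrix `S D(z)`. -/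
noncomputable def propDetDeriv (ℓ : ι → ℝ) (X : Matrix ι ι ℂ) : ℂ :=
  ((1 - X).adjugate * -(X * Matrix.diagonal fun b => Complex.I * (ℓ b : ℂ))).trace

variable (S : Matrix ι ι ℂ) (ℓ : ι → ℝ)

theorem hasDerivAt_propDet (z : ℂ) :
    HasDerivAt (propDet S ℓ) (propDetDeriv ℓ (propMat S ℓ z)) z := by
  refine hasDerivAt_det fun i j => ?_
  simp only [Matrix.sub_apply, Matrix.neg_apply, Matrix.mul_diagonal, propMat]
  refine HasDerivAt.const_sub _ ?_
  have h1 : HasDerivAt (fun w : ℂ => Complex.I * w * (ℓ j : ℂ)) (Complex.I * (ℓ j : ℂ)) z := by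
    simpa using ((hasDerivAt_id z).const_mul Complex.I).mul_const (ℓ j : ℂ)
  have := (h1.cexp).const_mul (S i j)
  rwa [← mul_assoc] at this

theorem differentiable_propDet : Differentiable ℂ (propDet S ℓ) := fun z =>
  (hasDerivAt_propDet S ℓ z).differentiableAt

theorem logDeriv_propDet (z : ℂ) :
    logDeriv (propDet S ℓ) z = propDetDeriv ℓ (propMat S ℓ z) / (1 - propMat S ℓ z).det := by
  rw [logDeriv_apply, (hasDerivAt_propDet S ℓ z).deriv]
  rfl

/-- A translation of z becomes a change of the phases, a parameter in a finite-dimensional space.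
This reduces uniformity along the real direction to continuity at the phases 1. -/
theorem propMat_add (z t : ℂ) : propMat S ℓ (z + t) =
    twistedProp S ℓ (fun b => Complex.exp (Complex.I * t * (ℓ b : ℂ))) z := by
  unfold propMat twistedProp
  congr 2
  funext b
  rw [← Complex.exp_add]
  congr 1
  ring

theorem continuous_twistedProp_line (x₀ : ℝ) :
    Continuous fun p : (ι → ℂ) × ℝ => twistedProp S ℓ p.1 (x₀ + p.2 * Complex.I) := by
  unfold twistedProp
  exact continuous_const.matrix_mul (Continuous.matrix_diagonal (by fun_prop))

theorem continuous_propDetDeriv : Continuous (propDetDeriv ℓ) := by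
  unfold propDetDeriv
  exact ((continuous_const.sub continuous_id).matrix_adjugate.matrix_mul
    (continuous_id.matrix_mul continuous_const).neg).matrix_trace

/-- A bound for the logarithmic derivative on a vertical segment without zeros persists under small
changes of the phases. -/
theorem exists_eventually_vertical_bound {x₀ y₁ y₂ : ℝ}
    (hne : ∀ y ∈ Set.Icc y₁ y₂, propDet S ℓ (x₀ + y * Complex.I) ≠ 0) :
    ∃ C, ∀ᶠ θ in 𝓝 (1 : ι → ℂ), ∀ y ∈ Set.Icc y₁ y₂,
      (1 - twistedProp S ℓ θ (x₀ + y * Complex.I)).det ≠ 0 ∧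
      ‖propDetDeriv ℓ (twistedProp S ℓ θ (x₀ + y * Complex.I)) /
        (1 - twistedProp S ℓ θ (x₀ + y * Complex.I)).det‖ ≤ C := by
  have hXc := continuous_twistedProp_line S ℓ x₀
  set X : (ι → ℂ) × ℝ → Matrix ι ι ℂ := fun p => twistedProp S ℓ p.1 (x₀ + p.2 * Complex.I) with hX
  have hdet : Continuous fun p => (1 - X p).det := (continuous_const.sub hXc).matrix_det
  have hnum : Continuous fun p => propDetDeriv ℓ (X p) := (continuous_propDetDeriv ℓ).comp hXc
  have hdet1 : ∀ y ∈ Set.Icc y₁ y₂, (1 - X (1, y)).det ≠ 0 := by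
    intro y hy
    have : X (1, y) = propMat S ℓ (x₀ + y * Complex.I) := by
      simp [hX, twistedProp, propMat]
    rw [this]
    exact hne y hy
  set R : (ι → ℂ) × ℝ → ℝ := fun p => ‖propDetDeriv ℓ (X p) / (1 - X p).det‖ with hR
  have hRc : ∀ y ∈ Set.Icc y₁ y₂, ContinuousAt R (1, y) := fun y hy =>
    (hnum.continuousAt.div hdet.continuousAt (hdet1 y hy)).norm
  obtain ⟨C, hC⟩ : ∃ C, ∀ y ∈ Set.Icc y₁ y₂, R (1, y) ≤ C := by
    have hc : ContinuousOn (fun y : ℝ => R (1, y)) (Set.Icc y₁ y₂) := fun y hy =>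
      ((hRc y hy).comp (f := fun y : ℝ => ((1 : ι → ℂ), y)) (by fun_prop)).continuousWithinAt
    obtain ⟨C, hC⟩ := (isCompact_Icc.bddAbove_image hc)
    exact ⟨C, fun y hy => hC ⟨y, hy, rfl⟩⟩
  refine ⟨C + 1, ?_⟩
  have hev : ∀ᶠ θ in 𝓝 (1 : ι → ℂ), ∀ y ∈ Set.Icc y₁ y₂,
      (1 - X (θ, y)).det ≠ 0 ∧ R (θ, y) ≤ C + 1 := by
    -- Tube lemma: the bounds are open conditions in (θ, y), and y runs through a compact interval.
    refine isCompact_Icc.eventually_forall_of_forall_eventually fun y hy => ?_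
    have e1 := hdet.continuousAt.eventually_ne (x := ((1 : ι → ℂ), y)) (hdet1 y hy)
    have e2 := (hRc y hy).eventually_lt continuousAt_const (g := fun _ => C + 1)
      (by linarith [hC y hy])
    filter_upwards [e1, e2] with p hp1 hp2
    exact ⟨hp1, hp2.le⟩
  exact hev

/-- The good vertical segments are translates of a single zero-free one by almost periods of all the
phases. -/
theorem hasStripZeros_propDet {y₁ y₂ B : ℝ} (hlt : y₁ < y₂)
    (h1 : ∀ z, propDet S ℓ z = 0 → z ∈ strip y₁ y₂)
    (h2 : ∀ x : ℝ, ‖logDeriv (propDet S ℓ) (x + y₁ * Complex.I)‖ ≤ B ∧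
      ‖logDeriv (propDet S ℓ) (x + y₂ * Complex.I)‖ ≤ B) :
    HasStripZeros (propDet S ℓ) y₁ y₂ := by
  have hd := differentiable_propDet S ℓ
  have h0 : propDet S ℓ (0 + y₁ * Complex.I) ≠ 0 := fun h => absurd (h1 _ h).1 (by simp)
  refine ⟨hlt, hd, h1, ⟨B, h2⟩, ?_⟩
  have hfin := finite_zeros_of_isCompact hd h0 (isCompact_closedRect (a := 0) (b := 1) (c := y₁)
    (d := y₂))
  -- Only finitely many abscissae in [0, 1] carry a zero of the strip.
  obtain ⟨x₀, hx₀, hx₀'⟩ := ((Set.Icc_infinite (zero_lt_one' ℝ)).sdiff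
    (hfin.image Complex.re)).nonempty
  have hne : ∀ y ∈ Set.Icc y₁ y₂, propDet S ℓ (x₀ + y * Complex.I) ≠ 0 := by
    intro y hy h
    refine hx₀' ⟨x₀ + y * Complex.I, ⟨?_, h⟩, by simp⟩
    rw [mem_closedRect]
    simpa using ⟨hx₀, hy⟩
  obtain ⟨C, hev⟩ := exists_eventually_vertical_bound S ℓ hne
  obtain ⟨t, ht, ht1, ht2⟩ := exists_tendsto_exp_one ℓ
  obtain ⟨N, hN⟩ := eventually_atTop.1 ((ht1.eventually hev).and (ht2.eventually hev))
  have hprop : ∀ s : ℝ, (∀ y ∈ Set.Icc y₁ y₂,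
      (1 - twistedProp S ℓ (fun b => Complex.exp (Complex.I * (s : ℂ) * (ℓ b : ℂ)))
        (x₀ + y * Complex.I)).det ≠ 0 ∧
      ‖propDetDeriv ℓ (twistedProp S ℓ (fun b => Complex.exp (Complex.I * (s : ℂ) * (ℓ b : ℂ)))
        (x₀ + y * Complex.I)) /
        (1 - twistedProp S ℓ (fun b => Complex.exp (Complex.I * (s : ℂ) * (ℓ b : ℂ)))
        (x₀ + y * Complex.I)).det‖ ≤ C) →
      ∀ y ∈ Set.Icc y₁ y₂, propDet S ℓ ((x₀ + s : ℝ) + y * Complex.I) ≠ 0 ∧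
        ‖logDeriv (propDet S ℓ) ((x₀ + s : ℝ) + y * Complex.I)‖ ≤ C := by
    intro s hs y hy
    have heq : (((x₀ + s : ℝ) : ℂ) + y * Complex.I) = (x₀ + y * Complex.I) + (s : ℂ) := by
      push_cast
      ring
    rw [heq, logDeriv_propDet, propDet, propMat_add]
    exact hs y hy
  refine ⟨fun n => x₀ + -(t (n + N)), fun n => x₀ + t (n + N), C, ?_, ?_, fun n y hy => ?_⟩
  · exact tendsto_atBot_add_const_left _ _
      (tendsto_neg_atTop_atBot.comp (ht.comp (tendsto_add_atTop_nat N)))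
  · exact tendsto_atTop_add_const_left _ _ (ht.comp (tendsto_add_atTop_nat N))
  · obtain ⟨e1, e2⟩ := hN (n + N) (Nat.le_add_left _ _)
    refine ⟨hprop (-(t (n + N))) ?_ y hy, hprop (t (n + N)) e1 y hy⟩
    simpa only [Complex.ofReal_neg] using e2

open scoped Matrix.Norms.L2Operator in
theorem norm_entry_le_l2_opNorm (A : Matrix ι ι ℂ) (i j : ι) : ‖A i j‖ ≤ ‖A‖ := by
  have h := Matrix.l2_opNorm_mulVec A (EuclideanSpace.single j (1 : ℂ))
  rw [PiLp.norm_single, norm_one, mul_one] at h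
  refine le_trans ?_ h
  have h2 := PiLp.norm_apply_le (WithLp.toLp 2 (A.mulVec (EuclideanSpace.single j (1 : ℂ)).ofLp)) i
  have h3 : (A.mulVec (EuclideanSpace.single j (1 : ℂ)).ofLp) i = A i j := by
    simp [EuclideanSpace.single]
  refine le_trans (le_of_eq ?_) h2
  rw [← h3]

open scoped Matrix.Norms.L2Operator in
theorem l2_opNorm_le_of_sum_sq_le (A : Matrix ι ι ℂ) {K : ℝ} (hK : 0 ≤ K)
    (h : ∀ a : ι → ℂ, ∑ i, ‖A.mulVec a i‖ ^ 2 ≤ K ^ 2 * ∑ i, ‖a i‖ ^ 2) : ‖A‖ ≤ K := by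
  rw [Matrix.l2_opNorm_def]
  refine ContinuousLinearMap.opNorm_le_bound _ hK fun x => ?_
  rw [EuclideanSpace.norm_eq, EuclideanSpace.norm_eq]
  refine Real.sqrt_le_iff.2 ⟨by positivity, ?_⟩
  rw [mul_pow, Real.sq_sqrt (Finset.sum_nonneg fun _ _ => by positivity)]
  exact h x.ofLp

open scoped Matrix.Norms.L2Operator in
theorem l2_opNorm_propMat_le {K c : ℝ} (hS : ‖S‖ ≤ K) (hℓ : ∀ b, c ≤ ℓ b) {z : ℂ}
    (hz : 0 ≤ z.im) : ‖propMat S ℓ z‖ ≤ K * Real.exp (-(c * z.im)) := by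
  have hK : 0 ≤ K := (norm_nonneg _).trans hS
  unfold propMat
  refine (Matrix.l2_opNorm_mul _ _).trans (mul_le_mul hS ?_ (norm_nonneg _) hK)
  rw [Matrix.l2_opNorm_diagonal]
  refine (pi_norm_le_iff_of_nonneg (Real.exp_pos _).le).2 fun b => ?_
  rw [Complex.norm_exp, Real.exp_le_exp]
  simp only [Complex.mul_re, Complex.I_re, Complex.I_im, Complex.ofReal_re, Complex.ofReal_im,
    Complex.mul_im]
  nlinarith [mul_le_mul_of_nonneg_right (hℓ b) hz]

open scoped Matrix.Norms.L2Operator in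
theorem propDet_ne_zero {z : ℂ} (h : ‖propMat S ℓ z‖ < 1) : propDet S ℓ z ≠ 0 := by
  have := isUnit_one_sub_of_norm_lt_one h
  exact ((Matrix.isUnit_iff_isUnit_det _).1 this).ne_zero

-- Jacobi's formula gives F'/F = -i tr((1 - X)⁻¹ X diag ℓ), and (1 - X)⁻¹ X is the sum of the
-- positive powers of X. The diagonal entries of these powers are the weights of closed walks.
open scoped Matrix.Norms.L2Operator in
theorem hasSum_logDeriv_propDet {z : ℂ} (h : ‖propMat S ℓ z‖ < 1) :
    HasSum (fun k : ℕ => ∑ b, (ℓ b : ℂ) * (propMat S ℓ z ^ (k + 1)) b b)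
      (Complex.I * logDeriv (propDet S ℓ) z) := by
  set X := propMat S ℓ z with hX
  have hdet : (1 - X).det ≠ 0 := propDet_ne_zero S ℓ h
  have hgeo : HasSum (fun k : ℕ => X ^ k) (1 - X)⁻¹ := by
    have h1 := hasSum_geom_series_inverse X h
    rwa [← Matrix.nonsing_inv_eq_ringInverse] at h1
  have hgeo1 : HasSum (fun k : ℕ => X ^ (k + 1)) ((1 - X)⁻¹ * X) := by
    simpa only [pow_succ] using hgeo.mul_right X
  have hent : ∀ b, HasSum (fun k : ℕ => (X ^ (k + 1)) b b) (((1 - X)⁻¹ * X) b b) := fun b => by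
    have hc : Continuous fun A : Matrix ι ι ℂ => A b b := continuous_id.matrix_elem b b
    exact hgeo1.map (AddMonoidHom.mk' (fun A : Matrix ι ι ℂ => A b b) fun _ _ => rfl) hc
  have hs := hasSum_sum (s := Finset.univ) fun b _ => (hent b).mul_left (ℓ b : ℂ)
  have hadj : (1 - X).adjugate = (1 - X).det • (1 - X)⁻¹ := by
    rw [Matrix.inv_def, smul_smul, Ring.mul_inverse_cancel _ (Ne.isUnit hdet), one_smul]
  have htr : propDetDeriv ℓ X =
      (1 - X).det * (-Complex.I * ∑ b, (ℓ b : ℂ) * ((1 - X)⁻¹ * X) b b) := by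
    rw [propDetDeriv, hadj, Matrix.smul_mul, Matrix.trace_smul, smul_eq_mul, Matrix.mul_neg,
      ← Matrix.mul_assoc, Matrix.trace_neg, Matrix.trace, Finset.mul_sum, ← Finset.sum_neg_distrib]
    congr 1
    refine Finset.sum_congr rfl fun b _ => ?_
    rw [Matrix.diag_apply, Matrix.mul_diagonal]
    ring
  have hval : Complex.I * logDeriv (propDet S ℓ) z = ∑ b, (ℓ b : ℂ) * ((1 - X)⁻¹ * X) b b := by
    rw [logDeriv_propDet, ← hX, htr, mul_div_cancel_left₀ _ hdet, ← mul_assoc, mul_neg,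
      Complex.I_mul_I, neg_neg, one_mul]
  rw [hval]
  exact hs

end Propagator

/-! ### The functional equation that exchanges z and -z -/

section FunctionalEquation

variable {ι : Type*} [Fintype ι] [DecidableEq ι]

/-- Factor 1 - SE = -SE (1 - E⁻¹S⁻¹) with E = D(z). Here E⁻¹ = D(-z), and the last two factors may
be exchanged under det(1 - ·). -/
theorem propDet_eq_mul_propDet_neg {S R : Matrix ι ι ℂ} (hSR : S * R = 1) (ℓ : ι → ℝ) (z : ℂ) :
    propDet S ℓ z =
      (-S).det * Complex.exp (z * (Complex.I * ((∑ b, ℓ b : ℝ) : ℂ))) * propDet R ℓ (-z) := by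
  set E : Matrix ι ι ℂ := Matrix.diagonal fun b => Complex.exp (Complex.I * z * (ℓ b : ℂ)) with hE
  set E' : Matrix ι ι ℂ := Matrix.diagonal fun b => Complex.exp (Complex.I * -z * (ℓ b : ℂ)) with hE'
  have hEE : E * E' = 1 := by
    rw [hE, hE', Matrix.diagonal_mul_diagonal, ← Matrix.diagonal_one]
    congr 1
    funext b
    rw [← Complex.exp_add, ← Complex.exp_zero]
    congr 1
    ring
  have h1 : 1 - S * E = -S * E * (1 - E' * R) := by
    have : S * E * (E' * R) = 1 := by
      rw [Matrix.mul_assoc, ← Matrix.mul_assoc E, hEE, Matrix.one_mul, hSR]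
    rw [Matrix.neg_mul, Matrix.neg_mul, Matrix.mul_sub, this, Matrix.mul_one]
    abel
  have h2 : E.det = Complex.exp (z * (Complex.I * ((∑ b, ℓ b : ℝ) : ℂ))) := by
    rw [hE, Matrix.det_diagonal, ← Complex.exp_sum]
    congr 1
    push_cast
    rw [Finset.mul_sum, Finset.mul_sum]
    exact Finset.sum_congr rfl fun b _ => by ring
  rw [propDet, propMat, h1, Matrix.det_mul, Matrix.det_mul, Matrix.det_one_sub_mul_comm, h2]
  rfl

theorem propDet_submatrix (S : Matrix ι ι ℂ) {ℓ : ι → ℝ} (e : ι ≃ ι) (he : ∀ b, ℓ (e b) = ℓ b)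
    (z : ℂ) : propDet (S.submatrix e e) ℓ z = propDet S ℓ z := by
  rw [propDet, propDet, ← Matrix.det_submatrix_equiv_self e (1 - propMat S ℓ z)]
  congr 1
  ext b b'
  simp [propMat, Matrix.mul_diagonal, he, Matrix.one_apply]

theorem logDeriv_propDet_eq {S R : Matrix ι ι ℂ} (hSR : S * R = 1) (ℓ : ι → ℝ) {z : ℂ}
    (hz : propDet R ℓ (-z) ≠ 0) :
    propDet S ℓ z ≠ 0 ∧ logDeriv (propDet S ℓ) z =
      Complex.I * ((∑ b, ℓ b : ℝ) : ℂ) - logDeriv (propDet R ℓ) (-z) := by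
  have hdet : (-S).det ≠ 0 := by
    rw [Matrix.det_neg]
    refine mul_ne_zero (pow_ne_zero _ (by simp)) fun h => ?_
    have := congrArg Matrix.det hSR
    rw [Matrix.det_mul, h, zero_mul, Matrix.det_one] at this
    exact zero_ne_one this
  have hfun : propDet S ℓ = fun z => (-S).det *
      Complex.exp (z * (Complex.I * ((∑ b, ℓ b : ℝ) : ℂ))) * propDet R ℓ (-z) :=
    funext fun z => propDet_eq_mul_propDet_neg hSR ℓ z
  have hc : (-S).det * Complex.exp (z * (Complex.I * ((∑ b, ℓ b : ℝ) : ℂ))) ≠ 0 :=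
    mul_ne_zero hdet (Complex.exp_ne_zero _)
  refine ⟨by rw [hfun]; exact mul_ne_zero hc hz, ?_⟩
  have hd1 : HasDerivAt (fun z : ℂ => Complex.exp (z * (Complex.I * ((∑ b, ℓ b : ℝ) : ℂ))))
      (Complex.exp (z * (Complex.I * ((∑ b, ℓ b : ℝ) : ℂ))) *
        (Complex.I * ((∑ b, ℓ b : ℝ) : ℂ))) z := by
    have := ((hasDerivAt_id z).mul_const (Complex.I * ((∑ b, ℓ b : ℝ) : ℂ))).cexp
    simpa using this
  have hd2 : HasDerivAt (fun z : ℂ => propDet R ℓ (-z)) (-propDetDeriv ℓ (propMat R ℓ (-z))) z := by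
    have : HasDerivAt (fun z : ℂ => propDet R ℓ (-z)) (propDetDeriv ℓ (propMat R ℓ (-z)) * -1) z :=
      (hasDerivAt_propDet R ℓ (-z)).comp z (hasDerivAt_neg z)
    rwa [mul_neg_one] at this
  rw [hfun]
  rw [logDeriv_apply, ((hd1.const_mul (-S).det).fun_mul hd2).deriv, logDeriv_apply,
    (hasDerivAt_propDet R ℓ (-z)).deriv]
  field_simp
  ring

end FunctionalEquation

/-! ### Vertex scattering matrices: norms and inverses -/

/-- The norm of the map `a ↦ κ (∑ a) - a` on `ℂ ^ d`, whose eigenvalues are `κ d - 1` and `-1`. -/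
theorem sum_norm_sq_sub_le {ι : Type*} (t : Finset ι) (a : ι → ℂ) {κ K : ℝ} (hK : 1 ≤ K)
    (hκ : |κ * t.card - 1| ≤ K) :
    ∑ i ∈ t, ‖(κ : ℂ) * ∑ j ∈ t, a j - a i‖ ^ 2 ≤ K ^ 2 * ∑ i ∈ t, ‖a i‖ ^ 2 := by
  set s := ∑ j ∈ t, a j with hs
  have h1 : ∑ i ∈ t, ‖(κ : ℂ) * s - a i‖ ^ 2 =
      ∑ i ∈ t, ‖a i‖ ^ 2 + κ * (κ * t.card - 2) * ‖s‖ ^ 2 := by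
    have hre : ∑ i ∈ t, 2 * κ * (s.re * (a i).re + s.im * (a i).im) = 2 * κ * ‖s‖ ^ 2 := by
      rw [← Finset.mul_sum, Finset.sum_add_distrib, ← Finset.mul_sum, ← Finset.mul_sum, Complex.sq_norm,
        Complex.normSq_apply, hs, Complex.re_sum, Complex.im_sum]
    have hterm : ∀ i, ‖(κ : ℂ) * s - a i‖ ^ 2 =
        ‖a i‖ ^ 2 + κ ^ 2 * ‖s‖ ^ 2 - 2 * κ * (s.re * (a i).re + s.im * (a i).im) := by
      intro i
      simp only [Complex.sq_norm, Complex.normSq_apply, Complex.sub_re, Complex.sub_im,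
        Complex.re_ofReal_mul, Complex.im_ofReal_mul]
      ring
    simp only [hterm]
    rw [Finset.sum_sub_distrib, Finset.sum_add_distrib, hre, Finset.sum_const,
      nsmul_eq_mul]
    ring
  have h2 : ‖s‖ ^ 2 ≤ t.card * ∑ i ∈ t, ‖a i‖ ^ 2 := by
    refine (pow_le_pow_left₀ (norm_nonneg _) (norm_sum_le _ _) 2).trans ?_
    exact sq_sum_le_card_mul_sum_sq
  have hA : 0 ≤ ∑ i ∈ t, ‖a i‖ ^ 2 := Finset.sum_nonneg fun _ _ => by positivity
  have hK2 : (κ * t.card - 1) ^ 2 ≤ K ^ 2 := sq_le_sq' (abs_le.1 hκ).1 (abs_le.1 hκ).2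
  rw [h1]
  -- The sign decides which eigenvalue dominates: -1 if the coefficient of |s|² is nonpositive,
  -- otherwise κd - 1 through Cauchy–Schwarz, because 1 + κ(κd - 2)d = (κd - 1)².
  rcases le_total (κ * (κ * t.card - 2)) 0 with h | h
  · have h3 := le_mul_of_one_le_left hA (one_le_pow₀ hK (n := 2))
    have h4 := mul_nonpos_of_nonpos_of_nonneg h (sq_nonneg ‖s‖)
    linarith
  · calc ∑ i ∈ t, ‖a i‖ ^ 2 + κ * (κ * t.card - 2) * ‖s‖ ^ 2
        ≤ ∑ i ∈ t, ‖a i‖ ^ 2 + κ * (κ * t.card - 2) * (t.card * ∑ i ∈ t, ‖a i‖ ^ 2) := by gcongr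
      _ = (κ * t.card - 1) ^ 2 * ∑ i ∈ t, ‖a i‖ ^ 2 := by ring
      _ ≤ _ := by gcongr

namespace QuantumGraph

open Classical in
/-- The matrix `(b, b') ↦ κ(o_b) - δ_{b, \hat b'}` for `o_b = t_{b'}`. -/
noncomputable def vertexMat (Q : QuantumGraph) (κ : Q.V → ℝ) : Matrix Q.Bond Q.Bond ℂ :=
  Matrix.of fun b b' => if b.fst = b'.snd then (κ b.fst : ℂ) - (if b'.symm = b then 1 else 0) else 0

/-- The Kirchhoff coefficient `2 / (n + d)`. -/
noncomputable def outCoef (Q : QuantumGraph) (v : Q.V) : ℝ := 2 / ((Q.n v : ℝ) + Q.deg v)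

/-- The coefficient `2 / (d - n)` of the inverse of the scattering matrix. -/
noncomputable def inCoef (Q : QuantumGraph) (v : Q.V) : ℝ := 2 / ((Q.deg v : ℝ) - Q.n v)

/-- The involution that reverses bonds. -/
def bondFlip (Q : QuantumGraph) : Q.Bond ≃ Q.Bond :=
  ⟨SimpleGraph.Dart.symm, SimpleGraph.Dart.symm, SimpleGraph.Dart.symm_symm,
    SimpleGraph.Dart.symm_symm⟩

variable (Q : QuantumGraph)

theorem bondFlip_apply (b : Q.Bond) : Q.bondFlip b = b.symm := rfl

theorem edgeLength_symm {u v : Q.V} (h : Q.G.Adj u v) : Q.edgeLength h.symm = Q.edgeLength h := by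
  unfold edgeLength
  congr 2
  exact Sym2.eq_swap

theorem bondLength_symm (b : Q.Bond) : Q.bondLength b.symm = Q.bondLength b :=
  Q.edgeLength_symm b.adj

theorem bondLength_pos (b : Q.Bond) : 0 < Q.bondLength b := Q.L_pos _

theorem S_eq_vertexMat : Q.S = Q.vertexMat Q.outCoef := by
  ext b b'
  simp [S, sigma, vertexMat, outCoef]
  rfl

variable [Finite Q.V]

open Classical in
theorem secular_eq_propDet : Q.secular = propDet (Q.vertexMat Q.outCoef) Q.bondLength := by
  funext z
  rw [secular, propDet, U, S_eq_vertexMat]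
  rfl

open Classical in
theorem card_bonds_fst (v : Q.V) : (Finset.univ.filter fun b : Q.Bond => b.fst = v).card = Q.deg v := by
  have h : Q.G.neighborSet v = (fun b : Q.Bond => b.snd) '' {b | b.fst = v} := by
    ext w
    constructor
    · intro hw
      exact ⟨⟨(v, w), hw⟩, rfl, rfl⟩
    · rintro ⟨b, rfl, rfl⟩
      exact b.adj
  rw [deg, h, Set.InjOn.ncard_image, Set.ncard_eq_toFinset_card']
  · congr 1
    ext b
    simp
  · rintro b hb b' hb' hbb
    refine SimpleGraph.Dart.ext _ _ (Prod.ext ?_ hbb)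
    exact hb.trans hb'.symm

open Classical in
theorem vertexMat_mulVec (κ : Q.V → ℝ) (a : Q.Bond → ℂ) (b : Q.Bond) :
    (Q.vertexMat κ).mulVec a b =
      (κ b.fst : ℂ) * (∑ c : Q.Bond with c.fst = b.fst, a c.symm) - a b.symm := by
  rw [Matrix.mulVec, dotProduct, ← Equiv.sum_comp Q.bondFlip]
  have : ∀ c : Q.Bond, Q.vertexMat κ b (Q.bondFlip c) * a (Q.bondFlip c) =
      (if c.fst = b.fst then (κ b.fst : ℂ) * a c.symm else 0) - (if c = b then a c.symm else 0) := by
    intro c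
    simp only [bondFlip_apply, vertexMat, Matrix.of_apply, SimpleGraph.Dart.symm_symm]
    rcases eq_or_ne c b with rfl | hcb
    · simp [sub_mul]
    · by_cases h : c.fst = b.fst
      · simp [h, hcb]
      · simp [h, hcb, Ne.symm h]
  simp only [this]
  rw [Finset.sum_sub_distrib, ← Finset.sum_filter, ← Finset.mul_sum, Finset.sum_ite_eq']
  simp

-- After reversal of the incoming bonds the matrix is block diagonal, with one block κJ - 1 per
-- vertex, where J is the all-ones matrix of size d(v). The bound therefore does not depend on the
-- size of the graph.
open Classical in
open scoped Matrix.Norms.L2Operator in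
theorem l2_opNorm_vertexMat_le {κ : Q.V → ℝ} {K : ℝ} (hK : 1 ≤ K)
    (hκ : ∀ v, |κ v * Q.deg v - 1| ≤ K) : ‖Q.vertexMat κ‖ ≤ K := by
  refine l2_opNorm_le_of_sum_sq_le _ (by linarith) fun a => ?_
  simp only [vertexMat_mulVec]
  have hfib : ∀ f : Q.Bond → ℝ, ∑ b, f b =
      ∑ v ∈ Finset.univ.image (fun b : Q.Bond => b.fst), ∑ b : Q.Bond with b.fst = v, f b := fun f =>
    (Finset.sum_fiberwise_of_maps_to (fun b _ => Finset.mem_image_of_mem _ (Finset.mem_univ b)) f).symm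
  rw [hfib, ← Equiv.sum_comp Q.bondFlip fun b => ‖a b‖ ^ 2, hfib, Finset.mul_sum]
  refine Finset.sum_le_sum fun v _ => ?_
  have := sum_norm_sq_sub_le (Finset.univ.filter fun b : Q.Bond => b.fst = v) (fun b => a b.symm) hK
    (κ := κ v) (by rw [card_bonds_fst]; exact hκ v)
  refine le_trans (le_of_eq ?_) this
  refine Finset.sum_congr rfl fun b hb => ?_
  rw [(Finset.mem_filter.1 hb).2]

-- On a vertex with d bonds, (κJ - 1)(κ'J - 1) = (dκκ' - κ - κ')J + 1 for the all-ones matrix J.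
-- Conjugation by the reversal appears because the matrix maps incoming bonds to outgoing ones and
-- its inverse does the opposite.
open Classical in
theorem vertexMat_mul_submatrix {κ κ' : Q.V → ℝ}
    (h : ∀ b : Q.Bond, Q.deg b.fst * (κ b.fst * κ' b.fst) = κ b.fst + κ' b.fst) :
    Q.vertexMat κ * (Q.vertexMat κ').submatrix Q.bondFlip Q.bondFlip = 1 := by
  ext b c
  rw [Matrix.mul_apply, ← Equiv.sum_comp Q.bondFlip]
  simp only [Matrix.submatrix_apply, bondFlip_apply, SimpleGraph.Dart.symm_symm, vertexMat,
    Matrix.of_apply]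
  have hsnd : ∀ d : Q.Bond, d.symm.snd = d.fst := fun _ => rfl
  simp only [hsnd]
  by_cases hbc : b.fst = c.fst
  · have hterm : ∀ d : Q.Bond, ((if b.fst = d.fst then (κ b.fst : ℂ) - (if d = b then 1 else 0) else 0) *
        if d.fst = c.fst then (κ' d.fst : ℂ) - (if c = d then 1 else 0) else 0) =
        (if d.fst = b.fst then (κ b.fst * κ' b.fst : ℂ) else 0) - (if d = c then (κ b.fst : ℂ) else 0) -
          (if d = b then (κ' b.fst : ℂ) else 0) + (if d = c then (if b = c then 1 else 0) else 0) := by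
      intro d
      by_cases hd : d.fst = b.fst
      · rw [if_pos hd.symm, if_pos (hd.trans hbc), if_pos hd, hd]
        simp only [eq_comm (a := c) (b := d)]
        rcases eq_or_ne d c with rfl | hdc
        · rcases eq_or_ne d b with rfl | hdb
          · simp; ring
          · simp [hdb, hdb.symm]; ring
        · rcases eq_or_ne d b with rfl | hdb
          · simp [hdc]; ring
          · simp [hdb, hdc]
      · have h1 : d ≠ c := fun h => hd (by rw [h, hbc])
        have h2 : d ≠ b := fun h => hd (by rw [h])
        simp [hd, Ne.symm hd, h1, h2]
    simp only [hterm]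
    rw [Finset.sum_add_distrib, Finset.sum_sub_distrib, Finset.sum_sub_distrib,
      Finset.sum_ite_eq', Finset.sum_ite_eq', Finset.sum_ite_eq', ← Finset.sum_filter,
      Finset.sum_const, card_bonds_fst, nsmul_eq_mul, Matrix.one_apply]
    simp only [Finset.mem_univ, if_true]
    have := h b
    have h' : ((Q.deg b.fst : ℂ) * (κ b.fst * κ' b.fst)) = κ b.fst + κ' b.fst := by exact_mod_cast this
    rw [h']
    ring
  · rw [Matrix.one_apply_ne (fun h => hbc (by rw [h]))]
    refine Finset.sum_eq_zero fun d _ => ?_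
    by_cases hd : b.fst = d.fst
    · rw [if_neg (fun h => hbc (hd.trans h)), mul_zero]
    · rw [if_neg hd, zero_mul]

theorem sum_bondLength : ∑ b, Q.bondLength b = 2 * Q.totalLength := by
  classical
  have h : ∀ b : Q.Bond, Q.bondLength b = Q.L ⟨b.edge, b.edge_mem⟩ := fun b => rfl
  simp only [h]
  rw [totalLength, Finset.mul_sum, ← Finset.sum_fiberwise_of_maps_to
    (s := Finset.univ) (t := Finset.univ) (g := fun b : Q.Bond => (⟨b.edge, b.edge_mem⟩ : Q.G.edgeSet))
    (fun _ _ => Finset.mem_univ _)]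
  refine Finset.sum_congr rfl fun e _ => ?_
  have hcard : (Finset.univ.filter fun b : Q.Bond =>
      (⟨b.edge, b.edge_mem⟩ : Q.G.edgeSet) = e).card = 2 := by
    obtain ⟨e, he⟩ := e
    induction e using Sym2.ind with
    | h u v =>
      have : (Finset.univ.filter fun b : Q.Bond =>
          (⟨b.edge, b.edge_mem⟩ : Q.G.edgeSet) = ⟨s(u, v), he⟩) =
          {(⟨(u, v), he⟩ : Q.Bond), (⟨(u, v), he⟩ : Q.Bond).symm} := by
        ext b
        simp only [Finset.mem_filter, Finset.mem_univ, true_and, Subtype.mk.injEq,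
          Finset.mem_insert, Finset.mem_singleton]
        exact SimpleGraph.dart_edge_eq_iff b ⟨(u, v), he⟩
      rw [this, Finset.card_pair]
      exact (SimpleGraph.Dart.symm_ne _).symm
  rw [Finset.sum_congr rfl (g := fun _ => Q.L e) fun b hb => by rw [(Finset.mem_filter.1 hb).2],
    Finset.sum_const, hcard]
  simp

end QuantumGraph

/-! ### Geometric bounds for the walk sums above and below the strip -/

/-- A bound for the norm of the inverse of the scattering matrix. -/
noncomputable def invBound (D n₀ : ℕ) : ℝ := max 1 ((D : ℝ) + n₀)

/-- The ratio of the geometric series that bounds the sum over closed walks at height `y`. -/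
noncomputable def walkRatio (D n₀ : ℕ) (Lmin y : ℝ) : ℝ :=
  if 0 < y then Real.exp (-(Lmin * y)) else invBound D n₀ * Real.exp (-(Lmin * -y))

theorem one_le_invBound (D n₀ : ℕ) : 1 ≤ invBound D n₀ := le_max_left _ _

/-- The maximum with 1 changes nothing in Y: if D + n₀ = 0, both logarithms are 0 thanks to the
convention log 0 = 0. -/
theorem log_invBound (D n₀ : ℕ) : Real.log (invBound D n₀) = Real.log ((D : ℝ) + n₀) := by
  rcases Nat.eq_zero_or_pos (D + n₀) with h | h
  · have h' : (D : ℝ) + n₀ = 0 := by exact_mod_cast h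
    simp [invBound, h']
  · have h' : (1 : ℝ) ≤ (D : ℝ) + n₀ := by exact_mod_cast h
    rw [invBound, max_eq_right h']

theorem stripBottom_nonpos {D n₀ : ℕ} {Lmin : ℝ} (hL : 0 < Lmin) : stripBottom D n₀ Lmin ≤ 0 := by
  rw [stripBottom, ← log_invBound]
  exact div_nonpos_of_nonpos_of_nonneg
    (neg_nonpos.2 (Real.log_nonneg (one_le_invBound D n₀))) hL.le

theorem walkRatio_pos (D n₀ : ℕ) (Lmin y : ℝ) : 0 < walkRatio D n₀ Lmin y := by
  unfold walkRatio
  split_ifs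
  · exact Real.exp_pos _
  · exact mul_pos (lt_of_lt_of_le one_pos (one_le_invBound D n₀)) (Real.exp_pos _)

theorem walkRatio_lt_one {D n₀ : ℕ} {Lmin y : ℝ} (hL : 0 < Lmin)
    (hy : y < stripBottom D n₀ Lmin ∨ 0 < y) : walkRatio D n₀ Lmin y < 1 := by
  unfold walkRatio
  split_ifs with h
  · rw [Real.exp_lt_one_iff]
    nlinarith
  · have hy' := hy.resolve_right h
    rw [stripBottom, ← log_invBound, lt_div_iff₀ hL] at hy'
    have hK : 0 < invBound D n₀ := lt_of_lt_of_le one_pos (one_le_invBound D n₀)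
    calc invBound D n₀ * Real.exp (-(Lmin * -y))
        < invBound D n₀ * Real.exp (-Real.log (invBound D n₀)) := by
          gcongr
          linarith
      _ = 1 := by
          rw [Real.exp_neg, Real.exp_log hK, mul_inv_cancel₀ hK.ne']

namespace QuantumGraph

variable (Q : QuantumGraph)

/-- The coefficient at the vertices used above the real axis (`2 / (n + d)`) resp. below it. -/
noncomputable def coefAt (z : ℂ) (v : Q.V) : ℝ := if 0 < z.im then Q.outCoef v else Q.inCoef v

/-- The argument of the phases, with nonnegative imaginary part. -/
noncomputable def upperArg (z : ℂ) : ℂ := if 0 < z.im then z else -z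

variable {Q}

/-- The eigenvalue is (d - n)/(d + n). For a vertex with n + d = 0 the coefficient is 2/0 = 0 and
the eigenvalue is read as -1. -/
theorem abs_outCoef_mul_deg_sub_one_le (v : Q.V) : |Q.outCoef v * Q.deg v - 1| ≤ 1 := by
  unfold outCoef
  rcases Nat.eq_zero_or_pos (Q.n v + Q.deg v) with h | h
  · have h' : (Q.n v : ℝ) + Q.deg v = 0 := by exact_mod_cast h
    simp [h']
  · have h' : 0 < (Q.n v : ℝ) + Q.deg v := by exact_mod_cast h
    have h1 : (0 : ℝ) ≤ Q.n v := Nat.cast_nonneg _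
    have h2 : (0 : ℝ) ≤ Q.deg v := Nat.cast_nonneg _
    have h3 : 2 / ((Q.n v : ℝ) + Q.deg v) * Q.deg v ≤ 2 := by
      rw [div_mul_eq_mul_div, div_le_iff₀ h']
      linarith
    have h4 : 0 ≤ 2 / ((Q.n v : ℝ) + Q.deg v) * Q.deg v := by positivity
    rw [abs_le]
    constructor <;> linarith

variable {D n₀ : ℕ} {Lmin Lmax : ℝ}

/-- The eigenvalue is (d + n)/(d - n), whose denominator is a nonzero integer, so the quotient is at
most d + n in absolute value. -/
theorem IsBounded.abs_inCoef_mul_deg_sub_one_le (hQ : Q.IsBounded D n₀ Lmin Lmax)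
    (hu : Q.IsUnbalanced) (v : Q.V) : |Q.inCoef v * Q.deg v - 1| ≤ invBound D n₀ := by
  have hne : (Q.deg v : ℝ) - Q.n v ≠ 0 := by
    rw [sub_ne_zero]
    exact fun h => hu v (by exact_mod_cast h.symm)
  have h1 : Q.inCoef v * Q.deg v - 1 = ((Q.deg v : ℝ) + Q.n v) / ((Q.deg v : ℝ) - Q.n v) := by
    unfold inCoef
    field_simp
    ring
  have h2 : 1 ≤ |(Q.deg v : ℝ) - Q.n v| := by
    have : (Q.deg v : ℤ) - Q.n v ≠ 0 := by
      rw [sub_ne_zero]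
      exact fun h => hu v (by exact_mod_cast h.symm)
    have := Int.one_le_abs this
    exact_mod_cast this
  have h3 : (Q.deg v : ℝ) ≤ D := by exact_mod_cast hQ.deg_le v
  have h4 : (Q.n v : ℝ) ≤ n₀ := by exact_mod_cast hQ.n_le v
  rw [h1, abs_div, abs_of_nonneg (by positivity)]
  refine (div_le_self (by positivity) h2).trans ?_
  exact le_trans (by linarith) (le_max_right _ _)

theorem IsUnbalanced.deg_mul_coef (hu : Q.IsUnbalanced) (v : Q.V) :
    Q.deg v * (Q.outCoef v * Q.inCoef v) = Q.outCoef v + Q.inCoef v := by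
  have hne : (Q.deg v : ℝ) - Q.n v ≠ 0 := by
    rw [sub_ne_zero]
    exact fun h => hu v (by exact_mod_cast h.symm)
  have hne2 : (Q.n v : ℝ) + Q.deg v ≠ 0 := by
    intro h
    have h' : Q.n v + Q.deg v = 0 := by exact_mod_cast h
    exact hu v (by omega)
  unfold outCoef inCoef
  field_simp
  ring

theorem IsBounded.le_bondLength (hQ : Q.IsBounded D n₀ Lmin Lmax) (b : Q.Bond) :
    Lmin ≤ Q.bondLength b := hQ.le_L _

theorem IsBounded.bondLength_le (hQ : Q.IsBounded D n₀ Lmin Lmax) (b : Q.Bond) :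
    Q.bondLength b ≤ Lmax := hQ.L_le _

variable [Finite Q.V]

open Classical in
/-- The weighted sum over the closed walks with `k + 1` steps. -/
noncomputable def walkSum (Q : QuantumGraph) [Finite Q.V] (z : ℂ) (k : ℕ) : ℂ :=
  ∑ b, (Q.bondLength b : ℂ) *
    (propMat (Q.vertexMat (Q.coefAt z)) Q.bondLength (upperArg z) ^ (k + 1)) b b

open Classical in
open scoped Matrix.Norms.L2Operator in
theorem IsBounded.norm_propMat_le (hQ : Q.IsBounded D n₀ Lmin Lmax) (hu : Q.IsUnbalanced) (z : ℂ) :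
    ‖propMat (Q.vertexMat (Q.coefAt z)) Q.bondLength (upperArg z)‖ ≤ walkRatio D n₀ Lmin z.im := by
  unfold walkRatio
  split_ifs with h
  · have h1 : Q.coefAt z = Q.outCoef := funext fun v => if_pos h
    have h2 : upperArg z = z := if_pos h
    rw [h1, h2]
    have := l2_opNorm_propMat_le _ _ (Q.l2_opNorm_vertexMat_le le_rfl
      (fun v => abs_outCoef_mul_deg_sub_one_le v)) hQ.le_bondLength h.le
    rwa [one_mul] at this
  · have h1 : Q.coefAt z = Q.inCoef := funext fun v => if_neg h
    have h2 : upperArg z = -z := if_neg h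
    rw [h1, h2]
    have := l2_opNorm_propMat_le _ _ (Q.l2_opNorm_vertexMat_le (one_le_invBound D n₀)
      (hQ.abs_inCoef_mul_deg_sub_one_le hu)) hQ.le_bondLength (z := -z) (by simpa using not_lt.1 h)
    simpa using this

/-- Above the axis this is the Neumann series for S itself; below, the one for S⁻¹ at -z. The term
-2𝓛 comes from the exponential factor of the functional equation, since the bond lengths add up to
twice the total length 𝓛. -/
theorem IsBounded.secular_ne_zero_and_hasSum (hQ : Q.IsBounded D n₀ Lmin Lmax)
    (hu : Q.IsUnbalanced) (hL : 0 < Lmin) {z : ℂ}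
    (hz : z.im < stripBottom D n₀ Lmin ∨ 0 < z.im) :
    Q.secular z ≠ 0 ∧ HasSum (Q.walkSum z) (if 0 < z.im then Complex.I * logDeriv Q.secular z
      else -((2 * Q.totalLength : ℝ) : ℂ) - Complex.I * logDeriv Q.secular z) := by
  classical
  have hnorm := (hQ.norm_propMat_le hu z).trans_lt (walkRatio_lt_one hL hz)
  have hs := hasSum_logDeriv_propDet _ _ hnorm
  have hne := propDet_ne_zero _ _ hnorm
  rw [secular_eq_propDet]
  by_cases h : 0 < z.im
  · have h1 : Q.coefAt z = Q.outCoef := funext fun v => if_pos h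
    have h2 : upperArg z = z := if_pos h
    rw [h1, h2] at hne
    refine ⟨hne, ?_⟩
    rw [if_pos h]
    convert! hs using 2
    rw [h1, h2]
  · have h1 : Q.coefAt z = Q.inCoef := funext fun v => if_neg h
    have h2 : upperArg z = -z := if_neg h
    rw [h1, h2] at hne
    -- Reversal preserves lengths, so conjugating by it does not change the determinant.
    have hflip := propDet_submatrix (Q.vertexMat Q.inCoef) Q.bondFlip (ℓ := Q.bondLength)
      (fun b => Q.bondLength_symm b)
    have hSR := Q.vertexMat_mul_submatrix (fun b => hu.deg_mul_coef b.fst)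
    have h3 := logDeriv_propDet_eq hSR Q.bondLength (z := z) (by rw [hflip]; exact hne)
    refine ⟨h3.1, ?_⟩
    have hval : -((2 * Q.totalLength : ℝ) : ℂ) -
        Complex.I * logDeriv (propDet (Q.vertexMat Q.outCoef) Q.bondLength) z =
        Complex.I * logDeriv (propDet (Q.vertexMat (Q.coefAt z)) Q.bondLength) (upperArg z) := by
      rw [h3.2, Q.sum_bondLength, funext hflip, mul_sub, ← mul_assoc, Complex.I_mul_I, h1, h2]
      ring
    rw [if_neg h, hval]
    exact hs

open Classical in
theorem IsBounded.norm_propMat_pow_le (hQ : Q.IsBounded D n₀ Lmin Lmax) (hu : Q.IsUnbalanced)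
    (z : ℂ) (k : ℕ) (b : Q.Bond) :
    ‖(propMat (Q.vertexMat (Q.coefAt z)) Q.bondLength (upperArg z) ^ (k + 1)) b b‖ ≤
      walkRatio D n₀ Lmin z.im ^ (k + 1) := by
  open scoped Matrix.Norms.L2Operator in
  refine (norm_entry_le_l2_opNorm _ b b).trans ((norm_pow_le' _ k.succ_pos).trans ?_)
  exact pow_le_pow_left₀ (norm_nonneg _) (hQ.norm_propMat_le hu z) _

theorem IsBounded.totalLength_nonneg : 0 ≤ Q.totalLength :=
  Finset.sum_nonneg fun e _ => (Q.L_pos e).le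

theorem totalLength_pos (Q : QuantumGraph) [Finite Q.V] [Nonempty Q.Bond] : 0 < Q.totalLength := by
  have h : 0 < ∑ b, Q.bondLength b :=
    Finset.sum_pos (fun b _ => Q.bondLength_pos b) Finset.univ_nonempty
  rw [sum_bondLength] at h
  linarith

theorem IsBounded.norm_walkSum_le (hQ : Q.IsBounded D n₀ Lmin Lmax) (hu : Q.IsUnbalanced)
    (z : ℂ) (k : ℕ) :
    ‖Q.walkSum z k‖ ≤ 2 * Q.totalLength * walkRatio D n₀ Lmin z.im ^ (k + 1) := by
  classical
  unfold walkSum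
  refine (norm_sum_le _ _).trans ?_
  rw [← sum_bondLength, Finset.sum_mul]
  refine Finset.sum_le_sum fun b _ => ?_
  rw [norm_mul, Complex.norm_real, Real.norm_of_nonneg (Q.bondLength_pos b).le]
  exact mul_le_mul_of_nonneg_left (hQ.norm_propMat_pow_le hu z k b) (Q.bondLength_pos b).le

theorem IsBounded.norm_logDeriv_secular_le (hQ : Q.IsBounded D n₀ Lmin Lmax)
    (hu : Q.IsUnbalanced) (hL : 0 < Lmin) {z : ℂ}
    (hz : z.im < stripBottom D n₀ Lmin ∨ 0 < z.im) :
    ‖logDeriv Q.secular z‖ ≤ 2 * Q.totalLength * (1 - walkRatio D n₀ Lmin z.im)⁻¹ := by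
  set q := walkRatio D n₀ Lmin z.im with hq
  have hq0 : 0 < q := walkRatio_pos _ _ _ _
  have hq1 : q < 1 := walkRatio_lt_one hL hz
  have hT : 0 ≤ Q.totalLength := IsBounded.totalLength_nonneg
  have hs := (hQ.secular_ne_zero_and_hasSum hu hL hz).2
  have hg : HasSum (fun k : ℕ => 2 * Q.totalLength * (q ^ k * q))
      (2 * Q.totalLength * ((1 - q)⁻¹ * q)) :=
    ((hasSum_geometric_of_lt_one hq0.le hq1).mul_right q).mul_left _
  have h2 := hs.norm_le_of_bounded hg fun k => by
    rw [← pow_succ]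
    exact hQ.norm_walkSum_le hu z k
  -- The extra 1 absorbs the term -2𝓛 of the case below the axis.
  have h3 : 1 + (1 - q)⁻¹ * q = (1 - q)⁻¹ := by
    have : 1 - q ≠ 0 := by linarith
    field_simp
    ring
  rw [← h3]
  split_ifs at h2 with h
  · rw [norm_mul, Complex.norm_I, one_mul] at h2
    nlinarith
  · have h4 : ‖Complex.I * logDeriv Q.secular z‖ ≤
        ‖((2 * Q.totalLength : ℝ) : ℂ)‖ +
          ‖-((2 * Q.totalLength : ℝ) : ℂ) - Complex.I * logDeriv Q.secular z‖ := by
      have h5 := norm_add_le ((2 * Q.totalLength : ℝ) : ℂ)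
        (-((2 * Q.totalLength : ℝ) : ℂ) - Complex.I * logDeriv Q.secular z)
      rwa [← add_sub_assoc, add_neg_cancel, zero_sub, norm_neg] at h5
    rw [norm_mul, Complex.norm_I, one_mul, Complex.norm_real,
      Real.norm_of_nonneg (by positivity)] at h4
    linarith

theorem IsBounded.hasStripZeros (hQ : Q.IsBounded D n₀ Lmin Lmax) (hu : Q.IsUnbalanced)
    (hL : 0 < Lmin) {y₁ y₂ : ℝ} (h1 : y₁ < stripBottom D n₀ Lmin) (h2 : 0 < y₂) :
    HasStripZeros Q.secular y₁ y₂ := by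
  classical
  have hb := stripBottom_nonpos (D := D) (n₀ := n₀) hL
  have hl : ∀ (y : ℝ), (y < stripBottom D n₀ Lmin ∨ 0 < y) → ∀ x : ℝ,
      ‖logDeriv Q.secular (x + y * Complex.I)‖ ≤
        2 * Q.totalLength * (1 - walkRatio D n₀ Lmin y)⁻¹ := by
    intro y hy x
    have := hQ.norm_logDeriv_secular_le hu hL (z := x + y * Complex.I) (by simpa using hy)
    simpa using this
  have hz : ∀ z, Q.secular z = 0 → z ∈ strip y₁ y₂ := by
    intro z hz
    by_contra h
    refine (hQ.secular_ne_zero_and_hasSum hu hL (z := z) ?_).1 hz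
    by_contra h'
    push Not at h'
    exact h ⟨by linarith [h'.1], by linarith [h'.2]⟩
  rw [secular_eq_propDet] at hl hz ⊢
  exact hasStripZeros_propDet _ _ (by linarith) hz fun x =>
    ⟨(hl y₁ (Or.inl h1) x).trans (le_max_left _ _), (hl y₂ (Or.inr h2) x).trans (le_max_right _ _)⟩

end QuantumGraph

/-! Zeros of the secular function are resonances -/

/-- The plane wave combination `x ↦ p e^{izx} + q e^{-izx}`. -/
noncomputable def planeWave (z p q : ℂ) (x : ℝ) : ℂ :=
  p * Complex.exp (Complex.I * z * x) + q * Complex.exp (-(Complex.I * z * x))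

section PlaneWave

variable (z p q : ℂ)

theorem hasDerivAt_planeWave (x : ℝ) :
    HasDerivAt (planeWave z p q) (planeWave z (Complex.I * z * p) (-(Complex.I * z * q)) x) x := by
  have h0 : HasDerivAt (fun x : ℝ => Complex.I * z * (x : ℂ)) (Complex.I * z) x := by
    simpa using (Complex.ofRealCLM.hasDerivAt (x := x)).const_mul (Complex.I * z)
  have := (h0.cexp.const_mul p).fun_add (h0.fun_neg.cexp.const_mul q)
  refine this.congr_deriv ?_
  unfold planeWave
  ring

theorem deriv_planeWave :
    deriv (planeWave z p q) = planeWave z (Complex.I * z * p) (-(Complex.I * z * q)) :=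
  funext fun x => (hasDerivAt_planeWave z p q x).deriv

theorem contDiff_planeWave : ContDiff ℝ 2 (planeWave z p q) := by
  have h0 : ContDiff ℝ 2 fun x : ℝ => Complex.I * z * (x : ℂ) :=
    contDiff_const.mul Complex.ofRealCLM.contDiff
  exact (contDiff_const.mul h0.cexp).add (contDiff_const.mul h0.neg.cexp)

theorem planeWave_zero_right : planeWave z p q 0 = p + q := by
  simp [planeWave]

theorem derivWithin_planeWave_zero {s : Set ℝ} (hs : UniqueDiffOn ℝ s) (h0 : (0 : ℝ) ∈ s) :
    derivWithin (planeWave z p q) s 0 = Complex.I * z * (p - q) := by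
  rw [(hasDerivAt_planeWave z p q 0).hasDerivWithinAt.derivWithin (hs 0 h0), planeWave_zero_right]
  ring

theorem neg_iteratedDerivWithin_planeWave {s : Set ℝ} (hs : UniqueDiffOn ℝ s) {x : ℝ} (hx : x ∈ s) :
    -iteratedDerivWithin 2 (planeWave z p q) s x = z ^ 2 * planeWave z p q x := by
  rw [iteratedDerivWithin_eq_iteratedDeriv hs (contDiff_planeWave z p q).contDiffAt hx,
    iteratedDeriv_succ, iteratedDeriv_one, deriv_planeWave, deriv_planeWave]
  unfold planeWave
  linear_combination -(z ^ 2 * (p * Complex.exp (Complex.I * z * x) +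
    q * Complex.exp (-(Complex.I * z * x)))) * Complex.I_mul_I

end PlaneWave

namespace QuantumGraph

variable (Q : QuantumGraph) [Finite Q.V]

open Classical in
/-- A wave function made of plane waves that satisfies the Kirchhoff conditions gives a resonance. -/
theorem isResonance_of_planeWave (z : ℂ) (α : Q.Bond → ℂ) (A : Q.V → ℂ)
    (hA : ∀ b : Q.Bond, α b + α b.symm * Complex.exp (Complex.I * z * Q.bondLength b) = A b.fst)
    (hcur : ∀ v, ∑ b : Q.Bond with b.fst = v, Complex.I * z *
      (α b - α b.symm * Complex.exp (Complex.I * z * Q.bondLength b)) +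
      Q.n v * (Complex.I * z * A v) = 0)
    (hnt : ∃ b : Q.Bond, ∃ x ∈ Set.Icc 0 (Q.bondLength b),
      planeWave z (α b) (α b.symm * Complex.exp (Complex.I * z * Q.bondLength b)) x ≠ 0) :
    Q.IsResonance z := by
  have hI : ∀ b : Q.Bond, UniqueDiffOn ℝ (Set.Icc 0 (Q.bondLength b)) := fun b =>
    uniqueDiffOn_Icc (Q.bondLength_pos b)
  refine ⟨⟨fun b => planeWave z (α b) (α b.symm * Complex.exp (Complex.I * z * Q.bondLength b)),
    fun l => planeWave z (A l.1) 0⟩, ⟨fun b => (contDiff_planeWave _ _ _).contDiffOn,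
      fun l => (contDiff_planeWave _ _ _).contDiffOn, fun b x _ => ?_⟩,
    ⟨⟨A, fun b => ?_, fun l => ?_⟩, fun v => ?_⟩, Or.inl hnt,
    fun b x hx => neg_iteratedDerivWithin_planeWave _ _ _ (hI b) hx,
    fun l x hx => neg_iteratedDerivWithin_planeWave _ _ _ (uniqueDiffOn_Ici 0) hx,
    fun l x _ => ?_⟩
  · simp only [planeWave, SimpleGraph.Dart.symm_symm, bondLength_symm]
    have h1 : Complex.exp (Complex.I * z * Q.bondLength b) * Complex.exp (-(Complex.I * z * x)) =
        Complex.exp (Complex.I * z * ((Q.bondLength b - x : ℝ) : ℂ)) := by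
      rw [← Complex.exp_add]
      congr 1
      push_cast
      ring
    have h2 : Complex.exp (Complex.I * z * Q.bondLength b) *
        Complex.exp (-(Complex.I * z * ((Q.bondLength b - x : ℝ) : ℂ))) =
        Complex.exp (Complex.I * z * x) := by
      rw [← Complex.exp_add]
      congr 1
      push_cast
      ring
    linear_combination α b.symm * h1 - α b * h2
  · exact (planeWave_zero_right _ _ _).trans (hA b)
  · exact (planeWave_zero_right _ _ _).trans (add_zero _)
  · refine (congrArg₂ (· + ·) ?_ ?_).trans (hcur v)
    · exact Finset.sum_congr rfl fun b _ =>
        derivWithin_planeWave_zero _ _ _ (hI b) ⟨le_rfl, (Q.bondLength_pos b).le⟩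
    · refine (Finset.sum_congr rfl fun k _ => derivWithin_planeWave_zero z (A v) 0
        (uniqueDiffOn_Ici 0) Set.self_mem_Ici).trans ?_
      simp
  · simp [planeWave]

theorem isResonance_zero [Nonempty Q.Bond] : Q.IsResonance 0 := by
  classical
  refine Q.isResonance_of_planeWave 0 (fun _ => 1) (fun _ => 2) (fun b => ?_) (fun v => ?_) ?_
  · norm_num
  · simp
  · obtain ⟨b⟩ := ‹Nonempty Q.Bond›
    refine ⟨b, 0, ⟨le_rfl, (Q.bondLength_pos b).le⟩, ?_⟩
    simp [planeWave]

/-- A vector α in the kernel of 1 - U(z) lists the amplitudes of the waves leaving the vertices, and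
β those of the arriving ones. The relation α = κs - β makes α + β constant at each vertex, which is
continuity, and the value 2/(n + d) of κ balances the currents. The converse is not needed: a
resonance that is not a zero has multiplicity 0. -/
theorem isResonance_of_secular_eq_zero [Nonempty Q.Bond] {z : ℂ} (h : Q.secular z = 0) :
    Q.IsResonance z := by
  classical
  rcases eq_or_ne z 0 with rfl | hz
  · exact Q.isResonance_zero
  rw [secular_eq_propDet] at h
  obtain ⟨α, hα, hαU⟩ := Matrix.exists_mulVec_eq_zero_iff.2 h
  set β : Q.Bond → ℂ := fun b => α b.symm * Complex.exp (Complex.I * z * Q.bondLength b) with hβ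
  set s : Q.V → ℂ := fun v => ∑ c : Q.Bond with c.fst = v, β c with hs
  have hrel : ∀ b, α b = Q.outCoef b.fst * s b.fst - β b := by
    intro b
    have h1 := congrFun hαU b
    rw [Matrix.sub_mulVec, Matrix.one_mulVec, propMat, ← Matrix.mulVec_mulVec, Pi.sub_apply,
      Pi.zero_apply, sub_eq_zero, vertexMat_mulVec] at h1
    rw [h1]
    have h2 : ∀ c : Q.Bond, (Matrix.diagonal fun b => Complex.exp (Complex.I * z * Q.bondLength b)).mulVec
        α c.symm = β c := by
      intro c
      rw [Matrix.mulVec_diagonal, bondLength_symm, mul_comm]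
    simp only [h2, hs]
  have hI : Complex.I * z ≠ 0 := mul_ne_zero Complex.I_ne_zero hz
  refine Q.isResonance_of_planeWave z α (fun v => Q.outCoef v * s v) (fun b => ?_) (fun v => ?_) ?_
  · rw [hrel b]
    ring
  · have h1 : ∑ b : Q.Bond with b.fst = v, Complex.I * z * (α b - β b) =
        Complex.I * z * (Q.deg v * (Q.outCoef v * s v) - 2 * s v) := by
      rw [← Finset.mul_sum]
      congr 1
      have h2 : ∀ b ∈ Finset.univ.filter (fun b : Q.Bond => b.fst = v),
          α b - β b = Q.outCoef v * s v - 2 * β b := by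
        intro b hb
        rw [hrel b, (Finset.mem_filter.1 hb).2]
        ring
      rw [Finset.sum_congr rfl h2, Finset.sum_sub_distrib, Finset.sum_const, card_bonds_fst,
        ← Finset.mul_sum, nsmul_eq_mul]
    rw [h1]
    have h3 : ((Q.n v : ℂ) + Q.deg v) * (Q.outCoef v * s v) = 2 * s v := by
      -- Where the coefficient is 2/0 there are no bonds, so s vanishes.
      rcases Nat.eq_zero_or_pos (Q.n v + Q.deg v) with h0 | h0
      · have hd : Q.deg v = 0 := by omega
        have hs0 : s v = 0 := by
          have := Q.card_bonds_fst v
          rw [hd, Finset.card_eq_zero] at this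
          simp only [hs, this, Finset.sum_empty]
        rw [hs0]
        ring
      · have h' : ((Q.n v : ℂ) + Q.deg v) ≠ 0 := by exact_mod_cast h0.ne'
        unfold outCoef
        push_cast
        field_simp
    linear_combination (Complex.I * z) * h3
  -- If all waves vanished, their values and derivatives at 0 would give α + β = 0 and iz(α - β) =
  -- 0, hence α = 0. This uses z ≠ 0, which is why the origin is treated apart by a constant
  -- function.
  · by_contra hcon
    push Not at hcon
    refine hα (funext fun b => ?_)
    have h0 : (0 : ℝ) ∈ Set.Icc 0 (Q.bondLength b) := ⟨le_rfl, (Q.bondLength_pos b).le⟩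
    have h1 := hcon b 0 h0
    rw [planeWave_zero_right] at h1
    have h2 := derivWithin_planeWave_zero z (α b) (β b) (uniqueDiffOn_Icc (Q.bondLength_pos b)) h0
    rw [derivWithin_congr (f := fun _ => 0) (fun x hx => hcon b x hx) (hcon b 0 h0)] at h2
    simp only [derivWithin_fun_const, Pi.zero_apply] at h2
    have h3 : α b - β b = 0 := by
      have := h2.symm
      rwa [mul_eq_zero, or_iff_right hI] at this
    have h4 : 2 * α b = 0 := by linear_combination h1 + h3
    simpa using h4

/-- The integral against the resonance measure is a sum over the zeros of the secular function. -/
theorem integral_resonanceMeasure [Nonempty Q.Bond] {g : ℂ → ℂ} {s : ℂ}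
    (hc : {z | Q.secular z = 0}.Countable) (hd : Differentiable ℂ Q.secular)
    (hn : Summable fun z => ‖(analyticOrderNatAt Q.secular z : ℂ) * g z‖)
    (hs : HasSum (fun z => (analyticOrderNatAt Q.secular z : ℂ) * g z) s) :
    Integrable g Q.resonanceMeasure ∧
      ∫ z, g z ∂Q.resonanceMeasure = ((Q.totalLength⁻¹ : ℝ) : ℂ) * s := by
  have hm : ∀ z, Q.secular z ≠ 0 → Q.multiplicity z = 0 := fun z hz => by
    simp [multiplicity, analyticOrderNatAt, (hd.analyticAt z).analyticOrderAt_eq_zero.2 hz]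
  have : Countable {z // Q.secular z = 0} := hc.to_subtype
  set ν : {z // Q.secular z = 0} → Measure ℂ := fun z =>
    (Q.multiplicity z : ℝ≥0∞) • Measure.dirac (z : ℂ) with hν
  -- Every zero is a resonance, and the other resonances have weight 0, so the sum may be taken over
  -- the countable set of zeros.
  have hmeas : (Measure.sum fun z : Q.Res => (Q.multiplicity z : ℝ≥0∞) • Measure.dirac (z : ℂ)) =
      Measure.sum ν := by
    refine Measure.ext fun B hB => ?_
    rw [Measure.sum_apply _ hB, Measure.sum_apply _ hB]
    set f : ℂ → ℝ≥0∞ := fun z => ((Q.multiplicity z : ℝ≥0∞) • Measure.dirac z) B with hf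
    have hsupp : Function.support f ⊆ {z | Q.secular z = 0} := fun z hz => by
      by_contra h0
      exact hz (by simp [hf, hm z h0])
    exact (tsum_subtype_eq_of_support_subset (f := f) (hsupp.trans fun z hz =>
      Q.isResonance_of_secular_eq_zero hz)).trans (tsum_subtype_eq_of_support_subset hsupp).symm
  have hsupp : Function.support (fun z => (analyticOrderNatAt Q.secular z : ℂ) * g z) ⊆
      {z | Q.secular z = 0} := fun z hz => by
    by_contra h0
    have := hm z h0
    rw [multiplicity] at this
    exact hz (by simp [this])
  have hνi : ∀ z, Integrable g (ν z) := fun z =>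
    (integrable_dirac (by simp [enorm_lt_top])).smul_measure (ENNReal.natCast_ne_top _)
  have hint : Integrable g (Measure.sum ν) := by
    refine ⟨AEStronglyMeasurable.sum_measure fun z => (hνi z).1, ?_⟩
    rw [hasFiniteIntegral_iff_enorm, lintegral_sum_measure]
    have h1 : ∀ z : {z // Q.secular z = 0}, ∫⁻ w, ‖g w‖ₑ ∂ν z =
        ‖(analyticOrderNatAt Q.secular z : ℂ) * g z‖ₑ := fun z => by
      rw [hν, lintegral_smul_measure, lintegral_dirac, enorm_mul, smul_eq_mul]
      congr 1
      rw [← ofReal_norm, Complex.norm_natCast, ENNReal.ofReal_natCast]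
      rfl
    simp only [h1]
    have h2 : Summable fun z : {z // Q.secular z = 0} =>
        ‖(analyticOrderNatAt Q.secular z : ℂ) * g z‖ := hn.subtype _
    simp only [← ofReal_norm]
    rw [← ENNReal.ofReal_tsum_of_nonneg (fun _ => norm_nonneg _) h2]
    exact ENNReal.ofReal_lt_top
  have hval : ∫ z, g z ∂(Measure.sum ν) = s := by
    have h1 := hasSum_integral_measure hint
    have h2 : ∀ z : {z // Q.secular z = 0}, ∫ w, g w ∂ν z =
        (analyticOrderNatAt Q.secular z : ℂ) * g z := fun z => by
      rw [hν, integral_smul_measure, integral_dirac]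
      simp [multiplicity]
    simp only [h2] at h1
    exact h1.unique ((hasSum_subtype_iff_of_support_subset hsupp).2 hs)
  unfold resonanceMeasure
  rw [hmeas]
  refine ⟨hint.smul_measure ENNReal.ofReal_ne_top, ?_⟩
  rw [integral_smul_measure, hval, ENNReal.toReal_ofReal (inv_nonneg.2 Q.totalLength_pos.le),
    Complex.real_smul]

end QuantumGraph

/-! Sums over closed walks as functions on the space of rooted quantum graphs -/

/-- The amplitude of the walks with `k` steps from the oriented edge `(u₀, v₀)` to `(u, v)`. -/
noncomputable def walkAmp {V : Type*} (G : SimpleGraph V) (κ : V → ℝ) (z : ℂ) (u₀ v₀ : V)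
    (ℓ : V → V → ℝ) : ℕ → V → V → ℂ
  | 0, u, v => open Classical in if u = u₀ ∧ v = v₀ then 1 else 0
  | k + 1, u, v => open Classical in ∑ᶠ w ∈ G.neighborSet u, ((κ u : ℂ) - if w = v then 1 else 0) *
      Complex.exp (Complex.I * z * (ℓ w u : ℂ)) * walkAmp G κ z u₀ v₀ ℓ k w u

theorem continuous_walkAmp {V : Type*} {G : SimpleGraph V} (hG : ∀ v, (G.neighborSet v).Finite)
    (κ : V → ℝ) (z : ℂ) (u₀ v₀ : V) (k : ℕ) (u v : V) :
    Continuous fun ℓ : V → V → ℝ => walkAmp G κ z u₀ v₀ ℓ k u v := by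
  induction k generalizing u v with
  | zero => exact continuous_const
  | succ k ih =>
    simp only [walkAmp, finsum_mem_eq_finite_toFinset_sum _ (hG u)]
    refine continuous_finsetSum _ fun w _ => (continuous_const.mul ?_).mul (ih w u)
    fun_prop

/-- Neighborhoods in a product contain uniform neighborhoods. -/
theorem exists_uniform_of_mem_nhds {V : Type*} {ℓ₀ : V → V → ℝ} {S : Set (V → V → ℝ)}
    (hS : S ∈ 𝓝 ℓ₀) : ∃ δ > 0, ∀ ℓ : V → V → ℝ, (∀ u v, |ℓ u v - ℓ₀ u v| < δ) → ℓ ∈ S := by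
  by_contra hcon
  push Not at hcon
  choose ℓ hℓ hℓS using fun n : ℕ => hcon (1 / ((n : ℝ) + 1)) (by positivity)
  have hlim : Tendsto ℓ atTop (𝓝 ℓ₀) := by
    refine tendsto_pi_nhds.2 fun u => tendsto_pi_nhds.2 fun v => ?_
    rw [tendsto_iff_dist_tendsto_zero]
    refine squeeze_zero (fun _ => dist_nonneg) (fun n => ?_) tendsto_one_div_add_atTop_nhds_zero_nat
    exact (hℓ n u v).le
  obtain ⟨n, hn⟩ := (hlim.eventually hS).exists
  exact hℓS n hn

namespace QuantumGraph

variable (Q : QuantumGraph)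

open Classical in
/-- The length of the edge between two vertices, and `0` if they are not adjacent. -/
noncomputable def len (u v : Q.V) : ℝ := if h : Q.G.Adj u v then Q.edgeLength h else 0

theorem len_of_adj {u v : Q.V} (h : Q.G.Adj u v) : Q.len u v = Q.edgeLength h := dif_pos h

theorem mem_ball_zero {v w : Q.V} : w ∈ Q.ball v 0 ↔ w = v := by
  change Q.G.edist v w ≤ ((0 : ℕ) : ℕ∞) ↔ w = v
  rw [Nat.cast_zero, nonpos_iff_eq_zero, SimpleGraph.edist_eq_zero_iff, eq_comm]

theorem ball_mono {v : Q.V} {r s : ℕ} (h : r ≤ s) : Q.ball v r ⊆ Q.ball v s := fun _ hw =>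
  le_trans (show Q.G.edist v _ ≤ (r : ℕ∞) from hw) (by exact_mod_cast h)

theorem mem_ball_succ_of_adj {v u w : Q.V} {s : ℕ} (hu : u ∈ Q.ball v s) (h : Q.G.Adj u w) :
    w ∈ Q.ball v (s + 1) := by
  refine SimpleGraph.edist_triangle.trans (b := Q.G.edist v u + Q.G.edist u w) ?_
  have h1 : Q.G.edist u w = 1 := SimpleGraph.edist_eq_one_iff_adj.2 h
  rw [h1]
  push_cast
  exact add_le_add_left hu 1

theorem exists_adj_of_mem_ball_succ {v w : Q.V} {s : ℕ} (h : w ∈ Q.ball v (s + 1)) :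
    w ∈ Q.ball v s ∨ ∃ u ∈ Q.ball v s, Q.G.Adj u w := by
  have h' : Q.G.edist w v ≤ ((s + 1 : ℕ) : ℕ∞) := by
    rw [SimpleGraph.edist_comm]
    exact h
  obtain ⟨p, hp⟩ := SimpleGraph.exists_walk_of_edist_ne_top
    (ne_top_of_le_ne_top (ENat.natCast_ne_top _) h')
  rw [← hp] at h'
  cases p with
  | nil => exact Or.inl (by simp [ball])
  | @cons _ u _ hadj q =>
    refine Or.inr ⟨u, ?_, hadj.symm⟩
    have h2 : q.length ≤ s := by
      rw [SimpleGraph.Walk.length_cons] at h'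
      have : q.length + 1 ≤ s + 1 := by exact_mod_cast h'
      omega
    change Q.G.edist v u ≤ s
    rw [SimpleGraph.edist_comm]
    exact (SimpleGraph.Walk.edist_le q).trans (by exact_mod_cast h2)

end QuantumGraph

/-! ### Local isomorphisms and continuity on the space of rooted graphs -/

namespace RootedQuantumGraph

/-- A map of the vertices that restricts to an isomorphism of the balls of radius `r` around the roots,
up to an error less than `ε` in the lengths. -/
structure IsLocalIso (A B : RootedQuantumGraph) (r : ℕ) (ε : ℝ) (f : A.Q.V → B.Q.V) : Prop where
  fst : f A.root.fst = B.root.fst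
  snd : 1 ≤ r → f A.root.snd = B.root.snd
  injOn : Set.InjOn f (A.Q.ball A.root.fst r)
  bijOn : ∀ s, s + 1 ≤ r → ∀ u ∈ A.Q.ball A.root.fst s,
    Set.BijOn f (A.Q.G.neighborSet u) (B.Q.G.neighborSet (f u))
  n : ∀ u ∈ A.Q.ball A.root.fst r, B.Q.n (f u) = A.Q.n u
  len : ∀ u ∈ A.Q.ball A.root.fst r, ∀ v ∈ A.Q.ball A.root.fst r, A.Q.G.Adj u v →
    |B.Q.len (f u) (f v) - A.Q.len u v| < ε

/-- The isomorphism of induced balls is extended arbitrarily to a map of all vertices. It follows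
that balls of smaller radius map into balls of the same radius, and that neighbourhoods of vertices
off the outermost sphere are matched completely. -/
theorem Close.exists_isLocalIso {A B : RootedQuantumGraph} {ε : ℝ} (h : A.Close ε B) :
    ∃ f, A.IsLocalIso B ⌊ε⁻¹⌋₊ ε f := by
  classical
  obtain ⟨φ, h1, h2, h3, h4⟩ := h
  set f : A.Q.V → B.Q.V := fun v =>
    if h : v ∈ A.Q.ball A.root.fst ⌊ε⁻¹⌋₊ then (φ ⟨v, h⟩ : B.Q.V) else B.root.fst with hf
  have hfv : ∀ v (h : v ∈ A.Q.ball A.root.fst ⌊ε⁻¹⌋₊), f v = φ ⟨v, h⟩ := fun v h => dif_pos h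
  have hroot : A.root.fst ∈ A.Q.ball A.root.fst ⌊ε⁻¹⌋₊ := by simp [QuantumGraph.ball]
  have hfroot : f A.root.fst = B.root.fst := by
    rw [hfv _ hroot]
    exact h1 _ rfl
  have hadj : ∀ u (hu : u ∈ A.Q.ball A.root.fst ⌊ε⁻¹⌋₊) v (hv : v ∈ A.Q.ball A.root.fst ⌊ε⁻¹⌋₊),
      A.Q.G.Adj u v → B.Q.G.Adj (f u) (f v) := by
    intro u hu v hv huv
    rw [hfv u hu, hfv v hv]
    have h5 : (A.Q.G.induce (A.Q.ball A.root.fst ⌊ε⁻¹⌋₊)).Adj ⟨u, hu⟩ ⟨v, hv⟩ :=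
      SimpleGraph.induce_adj.2 huv
    exact SimpleGraph.induce_adj.1 (φ.map_adj_iff.2 h5)
  have hball : ∀ s, s ≤ ⌊ε⁻¹⌋₊ → ∀ u ∈ A.Q.ball A.root.fst s, f u ∈ B.Q.ball B.root.fst s := by
    intro s
    induction s with
    | zero =>
      intro _ u hu
      rw [A.Q.mem_ball_zero.1 hu, hfroot]
      exact B.Q.mem_ball_zero.2 rfl
    | succ s ih =>
      intro hs u hu
      rcases A.Q.exists_adj_of_mem_ball_succ hu with h5 | ⟨w, hw, hwu⟩
      · exact B.Q.ball_mono (Nat.le_succ s) (ih (by omega) u h5)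
      · exact B.Q.mem_ball_succ_of_adj (ih (by omega) w hw)
          (hadj w (A.Q.ball_mono (by omega) hw) u (A.Q.ball_mono hs hu) hwu)
  have hinj : Set.InjOn f (A.Q.ball A.root.fst ⌊ε⁻¹⌋₊) := by
    intro u hu v hv huv
    rw [hfv u hu, hfv v hv] at huv
    exact congrArg Subtype.val (φ.injective (Subtype.ext huv))
  refine ⟨f, hfroot, fun hr1 => ?_, hinj, fun s hs u hu => ?_, fun u hu => ?_, fun u hu v hv huv => ?_⟩
  · have hmem : A.root.snd ∈ A.Q.ball A.root.fst ⌊ε⁻¹⌋₊ :=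
      A.Q.ball_mono hr1 (A.Q.mem_ball_succ_of_adj (A.Q.mem_ball_zero.2 rfl) A.root.adj)
    rw [hfv _ hmem]
    exact h2 _ rfl
  · have hu' := A.Q.ball_mono (show s ≤ ⌊ε⁻¹⌋₊ by omega) hu
    have hnb : ∀ w ∈ A.Q.G.neighborSet u, w ∈ A.Q.ball A.root.fst ⌊ε⁻¹⌋₊ := fun w hw =>
      A.Q.ball_mono hs (A.Q.mem_ball_succ_of_adj hu hw)
    refine ⟨fun w hw => hadj u hu' w (hnb w hw) hw, hinj.mono hnb, fun w' hw' => ?_⟩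
    -- Since f u is at distance at most s < r from the root, all its neighbours are still in the
    -- range of φ.
    have hwB : w' ∈ B.Q.ball B.root.fst ⌊ε⁻¹⌋₊ :=
      B.Q.ball_mono hs (B.Q.mem_ball_succ_of_adj (hball s (by omega) u hu) hw')
    obtain ⟨w, hw⟩ := φ.surjective ⟨w', hwB⟩
    have hfw : f w = w' := by
      rw [hfv w.1 w.2]
      exact congrArg Subtype.val hw
    refine ⟨w, ?_, hfw⟩
    have h5 : (B.Q.G.induce (B.Q.ball B.root.fst ⌊ε⁻¹⌋₊)).Adj (φ ⟨u, hu'⟩) (φ w) := by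
      rw [hw]
      refine SimpleGraph.induce_adj.2 ?_
      rw [← hfv u hu']
      exact hw'
    exact SimpleGraph.induce_adj.1 (φ.map_adj_iff.1 h5)
  · rw [hfv u hu]
    exact h3 _
  · have h5 := h4 ⟨u, hu⟩ ⟨v, hv⟩ (SimpleGraph.induce_adj.2 huv)
    have h6 := hadj u hu v hv huv
    rw [B.Q.len_of_adj h6, A.Q.len_of_adj huv]
    convert h5 using 5
    · exact hfv u hu
    · exact hfv v hv

theorem Equivalent.exists_comp {A B : RootedQuantumGraph} (h : A.Equivalent B) :
    ∃ ψ : A.Q.V → B.Q.V, ∀ (C : RootedQuantumGraph) (r : ℕ) (ε : ℝ) (f : B.Q.V → C.Q.V),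
      B.IsLocalIso C r ε f → A.IsLocalIso C r ε (f ∘ ψ) := by
  obtain ⟨ψ, h1, h2, h3, h4⟩ := h
  refine ⟨ψ, fun C r ε f hf => ?_⟩
  have hball : ∀ s u, u ∈ A.Q.ball A.root.fst s → ψ u ∈ B.Q.ball B.root.fst s := by
    intro s
    induction s with
    | zero =>
      intro u hu
      rw [A.Q.mem_ball_zero.1 hu]
      exact B.Q.mem_ball_zero.2 h1
    | succ s ih =>
      intro u hu
      rcases A.Q.exists_adj_of_mem_ball_succ hu with h5 | ⟨w, hw, hwu⟩
      · exact B.Q.ball_mono (Nat.le_succ s) (ih u h5)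
      · exact B.Q.mem_ball_succ_of_adj (ih w hw) (ψ.map_adj_iff.2 hwu)
  have hψ : ∀ u, Set.BijOn ψ (A.Q.G.neighborSet u) (B.Q.G.neighborSet (ψ u)) := fun u =>
    ⟨fun w hw => ψ.map_adj_iff.2 hw, ψ.injective.injOn, fun w hw => by
      obtain ⟨w, rfl⟩ := ψ.surjective w
      exact ⟨w, ψ.map_adj_iff.1 hw, rfl⟩⟩
  have hlen : ∀ u v, A.Q.G.Adj u v → B.Q.len (ψ u) (ψ v) = A.Q.len u v := fun u v huv => by
    rw [A.Q.len_of_adj huv, B.Q.len_of_adj (ψ.map_adj_iff.2 huv), h3]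
  refine ⟨?_, fun hr => ?_, fun u hu v hv huv => ?_, fun s hs u hu => ?_, fun u hu => ?_,
    fun u hu v hv huv => ?_⟩
  · rw [Function.comp_apply, h1, hf.fst]
  · rw [Function.comp_apply, h2, hf.snd hr]
  · exact ψ.injective (hf.injOn (hball r u hu) (hball r v hv) huv)
  · exact (hf.bijOn s hs (ψ u) (hball s u hu)).comp (hψ u)
  · rw [Function.comp_apply, hf.n _ (hball r u hu), h4]
  · rw [← hlen u v huv]
    exact hf.len _ (hball r u hu) _ (hball r v hv) (ψ.map_adj_iff.2 huv)

theorem isLocalIso_id (A : RootedQuantumGraph) (r : ℕ) {ε : ℝ} (hε : 0 < ε) :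
    A.IsLocalIso A r ε id :=
  ⟨rfl, fun _ => rfl, Set.injOn_id _, fun _ _ _ _ => Set.bijOn_id _, fun _ _ => rfl,
    fun _ _ _ _ _ => by simpa using hε⟩

/-- A function of rooted quantum graphs that depends continuously on large balls around the root. -/
def IsLocalFunction (h : RootedQuantumGraph → ℂ) : Prop :=
  ∀ A, ∀ η > 0, ∃ δ > 0, ∀ ε, 0 < ε → ε < δ → ∀ B f, A.IsLocalIso B ⌊ε⁻¹⌋₊ ε f → ‖h B - h A‖ < η

/-- An equivalence is a local isomorphism for every radius and every error, so the two values are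
arbitrarily close. -/
theorem IsLocalFunction.congr {h : RootedQuantumGraph → ℂ} (hh : IsLocalFunction h)
    {A B : RootedQuantumGraph} (hAB : A.Equivalent B) : h A = h B := by
  obtain ⟨ψ, hψ⟩ := hAB.exists_comp
  symm
  rw [← sub_eq_zero, ← norm_le_zero_iff]
  refine le_of_forall_pos_le_add fun η hη => ?_
  obtain ⟨δ, hδ, H⟩ := hh A η hη
  rw [zero_add]
  exact (H (δ / 2) (half_pos hδ) (half_lt_self hδ) B _
    (hψ B _ _ _ (B.isLocalIso_id _ (half_pos hδ)))).le

theorem IsLocalFunction.exists_continuous {h : RootedQuantumGraph → ℂ} (hh : IsLocalFunction h) :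
    ∃ H : ROQ → ℂ, Continuous H ∧ ∀ Q b, H (ROQ.mk Q b) = h ⟨Q, b⟩ := by
  set H : ROQ → ℂ := Quotient.lift h fun A B hAB => hh.congr hAB with hH
  have hmk : ∀ Q b, H (ROQ.mk Q b) = h ⟨Q, b⟩ := fun Q b => rfl
  refine ⟨H, continuous_def.2 fun s hs => ?_, hmk⟩
  intro X hX
  obtain ⟨⟨Q, b⟩, rfl⟩ := Quotient.exists_rep X
  obtain ⟨η, hη, hηs⟩ := Metric.isOpen_iff.1 hs _ hX
  obtain ⟨δ, hδ, hloc⟩ := hh ⟨Q, b⟩ η hη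
  refine ⟨ENNReal.ofReal δ, ENNReal.ofReal_pos.2 hδ, fun Y hY => hηs ?_⟩
  obtain ⟨t, ⟨ε, hε, rfl, A, B, hA, hB, hAB⟩, ht⟩ := sInf_lt_iff.1 hY
  have hεδ : ε < δ := (ENNReal.ofReal_lt_ofReal_iff hδ).1 ht
  obtain ⟨f, hf⟩ := hAB.exists_isLocalIso
  -- The distance allows other representatives, so the local isomorphism out of A is precomposed
  -- with an equivalence to start from the chosen one.
  have hAQ : RootedQuantumGraph.Equivalent ⟨Q, b⟩ A := Quotient.exact hA.symm
  obtain ⟨ψ, hψ⟩ := hAQ.exists_comp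
  have h1 := hloc ε hε hεδ B _ (hψ B _ _ _ hf)
  rw [Metric.mem_ball, dist_eq_norm, ← hB, hmk]
  exact h1

/-- The length of the root. -/
noncomputable def rootLength (A : RootedQuantumGraph) : ℂ := (A.Q.bondLength A.root : ℂ)

/-- The sum over the closed walks of `k + 1` steps from the root, weighted by its length. -/
noncomputable def rootAmp (z : ℂ) (k : ℕ) (A : RootedQuantumGraph) : ℂ :=
  (A.Q.bondLength A.root : ℂ) *
    walkAmp A.Q.G (A.Q.coefAt z) (QuantumGraph.upperArg z) A.root.fst A.root.snd A.Q.len (k + 1)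
      A.root.fst A.root.snd

theorem bondLength_root (A : RootedQuantumGraph) :
    A.Q.bondLength A.root = A.Q.len A.root.fst A.root.snd := (A.Q.len_of_adj A.root.adj).symm

theorem root_snd_mem_ball (A : RootedQuantumGraph) {r : ℕ} (hr : 1 ≤ r) :
    A.root.snd ∈ A.Q.ball A.root.fst r :=
  A.Q.ball_mono hr (A.Q.mem_ball_succ_of_adj (A.Q.mem_ball_zero.2 rfl) A.root.adj)

theorem root_fst_mem_ball (A : RootedQuantumGraph) (r : ℕ) : A.root.fst ∈ A.Q.ball A.root.fst r :=
  A.Q.ball_mono (Nat.zero_le r) (A.Q.mem_ball_zero.2 rfl)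

theorem le_floor_inv {ε : ℝ} (hε : 0 < ε) {m : ℕ} (h : ε < 1 / ((m : ℝ) + 1)) : m ≤ ⌊ε⁻¹⌋₊ := by
  refine Nat.le_floor ?_
  have : (m : ℝ) + 1 < ε⁻¹ := by
    rw [lt_inv_comm₀ (by positivity) hε]
    simpa using h
  linarith

theorem isLocalFunction_rootLength : IsLocalFunction rootLength := by
  intro A η hη
  -- Below 1/2 the radius is at least 1, so the terminus of the root is visible.
  refine ⟨min η (1 / ((1 : ℕ) + 1)), lt_min hη (by positivity), fun ε hε hεδ B f hf => ?_⟩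
  have hr : 1 ≤ ⌊ε⁻¹⌋₊ := le_floor_inv hε (hεδ.trans_le (min_le_right _ _))
  have h1 := hf.len _ (A.root_fst_mem_ball _) _ (A.root_snd_mem_ball hr) A.root.adj
  rw [hf.fst, hf.snd hr, ← bondLength_root, ← bondLength_root] at h1
  rw [rootLength, rootLength, ← Complex.ofReal_sub, Complex.norm_real, Real.norm_eq_abs]
  exact h1.trans (hεδ.trans_le (min_le_left _ _))

theorem IsLocalIso.coefAt_eq {A B : RootedQuantumGraph} {r : ℕ} {ε : ℝ} {f : A.Q.V → B.Q.V}
    (hf : A.IsLocalIso B r ε f) {s : ℕ} (hs : s + 1 ≤ r) {u : A.Q.V}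
    (hu : u ∈ A.Q.ball A.root.fst s) (z : ℂ) : B.Q.coefAt z (f u) = A.Q.coefAt z u := by
  have h1 := hf.n u (A.Q.ball_mono (by omega) hu)
  have h2 : B.Q.deg (f u) = A.Q.deg u := (hf.bijOn s hs u hu).ncard_eq.symm
  simp only [QuantumGraph.coefAt, QuantumGraph.outCoef, QuantumGraph.inCoef, h1, h2]

/-- Walks in B are pulled back to A, and only the lengths are changed, to those ℓ of B. The
unfolding moves one step away from the root at each stage, and every vertex whose coefficient is
used needs its full neighbourhood in the ball, whence s + k + 1 ≤ r. -/
theorem IsLocalIso.walkAmp_eq {A B : RootedQuantumGraph} {r : ℕ} {ε : ℝ} {f : A.Q.V → B.Q.V}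
    (hf : A.IsLocalIso B r ε f) (z w : ℂ) {ℓ : A.Q.V → A.Q.V → ℝ}
    (hℓ : ∀ u ∈ A.Q.ball A.root.fst r, ∀ v ∈ A.Q.ball A.root.fst r, A.Q.G.Adj u v →
      B.Q.len (f u) (f v) = ℓ u v) (k s : ℕ) (hs : s + k + 1 ≤ r) {u v : A.Q.V}
    (hu : u ∈ A.Q.ball A.root.fst s) (hv : A.Q.G.Adj u v) :
    walkAmp B.Q.G (B.Q.coefAt z) w B.root.fst B.root.snd B.Q.len k (f u) (f v) =
      walkAmp A.Q.G (A.Q.coefAt z) w A.root.fst A.root.snd ℓ k u v := by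
  classical
  induction k generalizing s u v with
  | zero =>
    have hv' : v ∈ A.Q.ball A.root.fst r := A.Q.ball_mono hs (A.Q.mem_ball_succ_of_adj hu hv)
    have hu' := A.Q.ball_mono (show s ≤ r by omega) hu
    have h1 : f u = B.root.fst ↔ u = A.root.fst := by
      rw [← hf.fst]
      exact hf.injOn.eq_iff hu' (A.root_fst_mem_ball r)
    have h2 : f v = B.root.snd ↔ v = A.root.snd := by
      rw [← hf.snd (by omega)]
      exact hf.injOn.eq_iff hv' (A.root_snd_mem_ball (by omega))
    simp only [walkAmp, h1, h2]
  | succ k ih =>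
    have hv' : v ∈ A.Q.ball A.root.fst r :=
      A.Q.ball_mono (by omega) (A.Q.mem_ball_succ_of_adj hu hv)
    have hu' := A.Q.ball_mono (show s ≤ r by omega) hu
    simp only [walkAmp]
    symm
    refine finsum_mem_eq_of_bijOn f (hf.bijOn s (by omega) u hu) fun x hx => ?_
    have hx1 := A.Q.mem_ball_succ_of_adj hu hx
    have hx' := A.Q.ball_mono (show s + 1 ≤ r by omega) hx1
    rw [ih (s + 1) (by omega) hx1 (SimpleGraph.Adj.symm hx), hf.coefAt_eq (by omega) hu,
      hℓ x hx' u hu' (SimpleGraph.Adj.symm hx)]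
    simp only [hf.injOn.eq_iff hx' hv']

/-- The combinatorial and the metric part separate: once the balls agree, the value on B is the
amplitude on the fixed graph of A with perturbed lengths, a continuous function of these lengths. -/
theorem isLocalFunction_rootAmp (z : ℂ) (k : ℕ) : IsLocalFunction (rootAmp z k) := by
  classical
  intro A η hη
  set Ψ : (A.Q.V → A.Q.V → ℝ) → ℂ := fun ℓ => (ℓ A.root.fst A.root.snd : ℂ) *
    walkAmp A.Q.G (A.Q.coefAt z) (QuantumGraph.upperArg z) A.root.fst A.root.snd ℓ (k + 1)
      A.root.fst A.root.snd with hΨ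
  have hΨc : Continuous Ψ := by
    refine Continuous.mul ?_ (continuous_walkAmp A.Q.locallyFinite _ _ _ _ _ _ _)
    fun_prop
  have hΨA : rootAmp z k A = Ψ A.Q.len := by
    rw [rootAmp, bondLength_root]
  obtain ⟨δ, hδ, hδΨ⟩ := exists_uniform_of_mem_nhds
    (hΨc.continuousAt.preimage_mem_nhds (Metric.ball_mem_nhds (Ψ A.Q.len) hη))
  -- Radius k + 2: one for each of the k + 1 steps, and one for the terminus of the bond.
  refine ⟨min δ (1 / ((k + 2 : ℕ) + 1)), lt_min hδ (by positivity), fun ε hε hεδ B f hf => ?_⟩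
  set r := ⌊ε⁻¹⌋₊
  have hr : k + 2 ≤ r := le_floor_inv hε (hεδ.trans_le (min_le_right _ _))
  have hεδ' : ε < δ := hεδ.trans_le (min_le_left _ _)
  set ℓ : A.Q.V → A.Q.V → ℝ := fun u v =>
    if u ∈ A.Q.ball A.root.fst r ∧ v ∈ A.Q.ball A.root.fst r ∧ A.Q.G.Adj u v then
      B.Q.len (f u) (f v) else A.Q.len u v with hℓdef
  have hℓ : ∀ u ∈ A.Q.ball A.root.fst r, ∀ v ∈ A.Q.ball A.root.fst r, A.Q.G.Adj u v →
      B.Q.len (f u) (f v) = ℓ u v := fun u hu v hv huv => (if_pos ⟨hu, hv, huv⟩).symm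
  have hclose : ∀ u v, |ℓ u v - A.Q.len u v| < δ := by
    intro u v
    by_cases h : u ∈ A.Q.ball A.root.fst r ∧ v ∈ A.Q.ball A.root.fst r ∧ A.Q.G.Adj u v
    · rw [← hℓ u h.1 v h.2.1 h.2.2]
      exact (hf.len u h.1 v h.2.1 h.2.2).trans hεδ'
    · simp only [hℓdef, if_neg h, sub_self, abs_zero]
      exact hδ
  have hΨB : rootAmp z k B = Ψ ℓ := by
    have h1 := hf.walkAmp_eq z (QuantumGraph.upperArg z) hℓ (k + 1) 0 (by omega)
      (A.root_fst_mem_ball 0) A.root.adj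
    rw [rootAmp, bondLength_root, hΨ]
    simp only
    rw [← h1, ← hℓ _ (A.root_fst_mem_ball r) _ (A.root_snd_mem_ball (by omega)) A.root.adj, hf.fst,
      hf.snd (by omega)]
  have := hδΨ ℓ hclose
  rwa [Set.mem_preimage, Metric.mem_ball, dist_eq_norm, ← hΨA, ← hΨB] at this

end RootedQuantumGraph

/-! ### Matrix powers as walk amplitudes -/

namespace QuantumGraph

variable (Q : QuantumGraph) [Finite Q.V]

open Classical in
theorem propMat_pow_apply (κ : Q.V → ℝ) (z : ℂ) (b : Q.Bond) (k : ℕ) (d : Q.Bond) :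
    (propMat (Q.vertexMat κ) Q.bondLength z ^ k) d b =
      walkAmp Q.G κ z b.fst b.snd Q.len k d.fst d.snd := by
  induction k generalizing d with
  | zero =>
    rw [pow_zero, Matrix.one_apply, walkAmp]
    refine if_congr ⟨?_, fun h => ?_⟩ rfl rfl
    · rintro rfl
      exact ⟨rfl, rfl⟩
    · exact SimpleGraph.Dart.ext _ _ (Prod.ext h.1 h.2)
  | succ k ih =>
    rw [pow_succ', Matrix.mul_apply, walkAmp]
    simp only [ih]
    have h0 : ∀ d' : Q.Bond, propMat (Q.vertexMat κ) Q.bondLength z d d' *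
        walkAmp Q.G κ z b.fst b.snd Q.len k d'.fst d'.snd =
        if d'.snd = d.fst then ((κ d.fst : ℂ) - if d'.fst = d.snd then 1 else 0) *
          Complex.exp (Complex.I * z * (Q.len d'.fst d.fst : ℂ)) *
          walkAmp Q.G κ z b.fst b.snd Q.len k d'.fst d.fst else 0 := by
      intro d'
      rw [propMat, Matrix.mul_diagonal, vertexMat, Matrix.of_apply]
      by_cases h : d'.snd = d.fst
      · rw [if_pos h.symm, if_pos h, h]
        have h1 : Q.bondLength d' = Q.len d'.fst d.fst := by
          rw [← h]
          exact (Q.len_of_adj d'.adj).symm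
        have h2 : d'.symm = d ↔ d'.fst = d.snd :=
          ⟨fun e => by rw [← e]; rfl, fun e => SimpleGraph.Dart.ext _ _ (Prod.ext h e)⟩
        rw [h1]
        simp only [h2]
      · rw [if_neg (Ne.symm h), if_neg h, zero_mul, zero_mul]
    simp only [h0]
    rw [← Finset.sum_filter, ← finsum_mem_coe_finset]
    -- The bonds d' that end at the origin of d correspond, through their own origins, to the
    -- neighbours of that vertex.
    refine finsum_mem_eq_of_bijOn (fun d' : Q.Bond => d'.fst) ⟨fun d' hd' => ?_, ?_, ?_⟩
      fun d' _ => rfl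
    · have h : d'.snd = d.fst := by simpa using hd'
      rw [← h]
      exact d'.adj.symm
    · intro d₁ h₁ d₂ h₂ h
      have h1 : d₁.snd = d.fst := by simpa using h₁
      have h2 : d₂.snd = d.fst := by simpa using h₂
      exact SimpleGraph.Dart.ext _ _ (Prod.ext h (h1.trans h2.symm))
    · intro w hw
      exact ⟨⟨(w, d.fst), SimpleGraph.Adj.symm hw⟩, by simp, rfl⟩

theorem walkSum_eq_sum_rootAmp (z : ℂ) (k : ℕ) :
    Q.walkSum z k = ∑ b, RootedQuantumGraph.rootAmp z k ⟨Q, b⟩ := by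
  unfold walkSum RootedQuantumGraph.rootAmp
  exact Finset.sum_congr rfl fun b _ => by rw [propMat_pow_apply]

end QuantumGraph

/-! ### Truncated bounded continuous observables and the limiting density -/

/-- The radial retraction onto the disc of radius `R`. -/
noncomputable def clip (R : ℝ) (w : ℂ) : ℂ := ((R / max R ‖w‖ : ℝ) : ℂ) * w

theorem continuous_clip {R : ℝ} (hR : 0 < R) : Continuous (clip R) := by
  unfold clip
  refine Continuous.mul (Complex.continuous_ofReal.comp ?_) continuous_id
  exact continuous_const.div (continuous_const.max continuous_norm) fun w =>
    (hR.trans_le (le_max_left _ _)).ne'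

theorem norm_clip_le {R : ℝ} (hR : 0 < R) (w : ℂ) : ‖clip R w‖ ≤ R := by
  have h : 0 < max R ‖w‖ := hR.trans_le (le_max_left _ _)
  rw [clip, norm_mul, Complex.norm_real, Real.norm_of_nonneg (by positivity), div_mul_eq_mul_div,
    div_le_iff₀ h]
  exact mul_le_mul_of_nonneg_left (le_max_right _ _) hR.le

theorem clip_eq {R : ℝ} (hR : 0 < R) {w : ℂ} (hw : ‖w‖ ≤ R) : clip R w = w := by
  rw [clip, max_eq_left hw, div_self hR.ne', Complex.ofReal_one, one_mul]

namespace ROQ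

/-- The sum over closed walks from the root as a function on `ROQ`. -/
noncomputable def amp (z : ℂ) (k : ℕ) : ROQ → ℂ :=
  (RootedQuantumGraph.isLocalFunction_rootAmp z k).exists_continuous.choose

theorem continuous_amp (z : ℂ) (k : ℕ) : Continuous (amp z k) :=
  (RootedQuantumGraph.isLocalFunction_rootAmp z k).exists_continuous.choose_spec.1

theorem amp_mk (z : ℂ) (k : ℕ) (Q : QuantumGraph) (b : Q.Bond) :
    amp z k (mk Q b) = RootedQuantumGraph.rootAmp z k ⟨Q, b⟩ :=
  (RootedQuantumGraph.isLocalFunction_rootAmp z k).exists_continuous.choose_spec.2 Q b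

/-- The length of the root as a function on `ROQ`. -/
noncomputable def rootLen : ROQ → ℂ :=
  RootedQuantumGraph.isLocalFunction_rootLength.exists_continuous.choose

theorem continuous_rootLen : Continuous rootLen :=
  RootedQuantumGraph.isLocalFunction_rootLength.exists_continuous.choose_spec.1

theorem rootLen_mk (Q : QuantumGraph) (b : Q.Bond) : rootLen (mk Q b) = (Q.bondLength b : ℂ) :=
  RootedQuantumGraph.isLocalFunction_rootLength.exists_continuous.choose_spec.2 Q b

/-- The root length, truncated to `[Lmin, Lmax]`. -/
noncomputable def truncLen (Lmin Lmax : ℝ) (X : ROQ) : ℝ := max Lmin (min Lmax (rootLen X).re)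

/-- The sum over all closed walks from the root, with truncated terms. -/
noncomputable def walkSeries (D n₀ : ℕ) (Lmin Lmax : ℝ) (z : ℂ) (X : ROQ) : ℂ :=
  ∑' k : ℕ, clip (Lmax * walkRatio D n₀ Lmin z.im ^ (k + 1)) (amp z k X)

variable {D n₀ : ℕ} {Lmin Lmax : ℝ}

theorem continuous_truncLen : Continuous (truncLen Lmin Lmax) :=
  continuous_const.max (continuous_const.min (Complex.continuous_re.comp continuous_rootLen))

theorem le_truncLen (X : ROQ) : Lmin ≤ truncLen Lmin Lmax X := le_max_left _ _

theorem truncLen_le (hL : Lmin ≤ Lmax) (X : ROQ) : truncLen Lmin Lmax X ≤ Lmax :=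
  max_le hL (min_le_left _ _)

theorem hasSum_walkRatio (hLmin : 0 < Lmin) {y : ℝ} (hy : y < stripBottom D n₀ Lmin ∨ 0 < y) :
    HasSum (fun k : ℕ => Lmax * walkRatio D n₀ Lmin y ^ (k + 1))
      (Lmax * ((1 - walkRatio D n₀ Lmin y)⁻¹ * walkRatio D n₀ Lmin y)) := by
  simpa only [pow_succ] using ((hasSum_geometric_of_lt_one (walkRatio_pos D n₀ Lmin y).le
    (walkRatio_lt_one hLmin hy)).mul_right _).mul_left Lmax

theorem radius_pos (hLmax : 0 < Lmax) (y : ℝ) (k : ℕ) :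
    0 < Lmax * walkRatio D n₀ Lmin y ^ (k + 1) :=
  mul_pos hLmax (pow_pos (walkRatio_pos _ _ _ _) _)

/-- Weierstrass test on all of `ROQ`. The truncation makes it work for graphs without bounds on
their data, so nothing about the support of ℙ is needed; on bounded unbalanced finite graphs the
truncation has no effect. -/
theorem continuous_walkSeries (hLmin : 0 < Lmin) (hLmax : 0 < Lmax) {z : ℂ}
    (hz : z.im < stripBottom D n₀ Lmin ∨ 0 < z.im) :
    Continuous (walkSeries D n₀ Lmin Lmax z) :=
  continuous_tsum (fun k => (continuous_clip (radius_pos hLmax _ k)).comp (continuous_amp z k))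
    (hasSum_walkRatio hLmin hz).summable fun k _ => norm_clip_le (radius_pos hLmax _ k) _

theorem norm_walkSeries_le (hLmin : 0 < Lmin) (hLmax : 0 < Lmax) {z : ℂ}
    (hz : z.im < stripBottom D n₀ Lmin ∨ 0 < z.im) (X : ROQ) :
    ‖walkSeries D n₀ Lmin Lmax z X‖ ≤
      Lmax * ((1 - walkRatio D n₀ Lmin z.im)⁻¹ * walkRatio D n₀ Lmin z.im) :=
  tsum_of_norm_bounded (hasSum_walkRatio hLmin hz) fun k => norm_clip_le (radius_pos hLmax _ k) _

/-- The limiting density on the lines `Im z = y`. -/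
noncomputable def density (D n₀ : ℕ) (Lmin Lmax : ℝ) (P : ProbabilityMeasure ROQ) (z : ℂ) : ℂ :=
  ((Real.pi⁻¹ : ℝ) : ℂ) * ((if 0 < z.im then 0 else 1) +
    (∫ X, walkSeries D n₀ Lmin Lmax z X ∂(P : Measure ROQ)) /
      ((∫ X, truncLen Lmin Lmax X ∂(P : Measure ROQ) : ℝ) : ℂ))

/-- A bound for the limiting density. -/
noncomputable def densityBound (D n₀ : ℕ) (Lmin Lmax y : ℝ) : ℝ :=
  Real.pi⁻¹ * (1 + Lmax * ((1 - walkRatio D n₀ Lmin y)⁻¹ * walkRatio D n₀ Lmin y) / Lmin)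

theorem abs_truncLen_le (hLmin : 0 < Lmin) (hL : Lmin ≤ Lmax) (X : ROQ) :
    ‖truncLen Lmin Lmax X‖ ≤ Lmax := by
  rw [Real.norm_of_nonneg (hLmin.le.trans (le_truncLen X))]
  exact truncLen_le hL X

theorem integrable_truncLen (hLmin : 0 < Lmin) (hL : Lmin ≤ Lmax) (μ : Measure ROQ)
    [IsFiniteMeasure μ] : Integrable (truncLen Lmin Lmax) μ :=
  (BoundedContinuousFunction.ofNormedAddCommGroup _ continuous_truncLen Lmax
    (abs_truncLen_le hLmin hL)).integrable μ

theorem integrable_walkSeries (hLmin : 0 < Lmin) (hLmax : 0 < Lmax) {z : ℂ}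
    (hz : z.im < stripBottom D n₀ Lmin ∨ 0 < z.im) (μ : Measure ROQ) [IsFiniteMeasure μ] :
    Integrable (walkSeries D n₀ Lmin Lmax z) μ :=
  (BoundedContinuousFunction.ofNormedAddCommGroup _ (continuous_walkSeries hLmin hLmax hz) _
    (norm_walkSeries_le hLmin hLmax hz)).integrable μ

theorem le_integral_truncLen (hLmin : 0 < Lmin) (hL : Lmin ≤ Lmax) (P : ProbabilityMeasure ROQ) :
    Lmin ≤ ∫ X, truncLen Lmin Lmax X ∂(P : Measure ROQ) := by
  have := integral_mono (integrable_const (μ := (P : Measure ROQ)) Lmin)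
    (integrable_truncLen hLmin hL P) fun X => le_truncLen X
  simpa using this

theorem norm_density_le (hLmin : 0 < Lmin) (hL : Lmin ≤ Lmax) (P : ProbabilityMeasure ROQ) {z : ℂ}
    (hz : z.im < stripBottom D n₀ Lmin ∨ 0 < z.im) :
    ‖density D n₀ Lmin Lmax P z‖ ≤ densityBound D n₀ Lmin Lmax z.im := by
  have hLmax := hLmin.trans_le hL
  have h1 := le_integral_truncLen hLmin hL P
  have h2 : ‖∫ X, walkSeries D n₀ Lmin Lmax z X ∂(P : Measure ROQ)‖ ≤
      Lmax * ((1 - walkRatio D n₀ Lmin z.im)⁻¹ * walkRatio D n₀ Lmin z.im) := by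
    have := norm_integral_le_of_norm_le_const (μ := (P : Measure ROQ))
      (Eventually.of_forall (norm_walkSeries_le hLmin hLmax hz))
    simpa using this
  unfold density densityBound
  rw [norm_mul, Complex.norm_real, Real.norm_of_nonneg (inv_nonneg.2 Real.pi_pos.le)]
  refine mul_le_mul_of_nonneg_left ((norm_add_le _ _).trans (add_le_add ?_ ?_))
    (inv_nonneg.2 Real.pi_pos.le)
  · split_ifs <;> simp
  · rw [norm_div, Complex.norm_real, Real.norm_of_nonneg (hLmin.le.trans h1)]
    exact div_le_div₀ ((norm_nonneg _).trans h2) h2 hLmin h1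

/-- Numerator and denominator are integrals of bounded continuous functions, and the denominator is
at least Lmin. -/
theorem tendsto_density (hLmin : 0 < Lmin) (hL : Lmin ≤ Lmax) {ν : ℕ → ProbabilityMeasure ROQ}
    {P : ProbabilityMeasure ROQ} (h : Tendsto ν atTop (𝓝 P)) {z : ℂ}
    (hz : z.im < stripBottom D n₀ Lmin ∨ 0 < z.im) :
    Tendsto (fun N => density D n₀ Lmin Lmax (ν N) z) atTop
      (𝓝 (density D n₀ Lmin Lmax P z)) := by
  have hLmax := hLmin.trans_le hL
  have h1 := (ProbabilityMeasure.tendsto_iff_forall_integral_rclike_tendsto ℂ).1 h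
    (BoundedContinuousFunction.ofNormedAddCommGroup _ (continuous_walkSeries hLmin hLmax hz) _
      (norm_walkSeries_le hLmin hLmax hz))
  have h2 := ProbabilityMeasure.tendsto_iff_forall_integral_tendsto.1 h
    (BoundedContinuousFunction.ofNormedAddCommGroup _ continuous_truncLen Lmax
      (abs_truncLen_le hLmin hL))
  have h3 := (Complex.continuous_ofReal.tendsto _).comp h2
  refine ((h1.div h3 ?_).const_add _).const_mul _
  have := le_integral_truncLen hLmin hL P
  exact_mod_cast (hLmin.trans_le this).ne'

end ROQ

/-! ### The density of a finite graph and the passage to the limit -/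

namespace QuantumGraph

variable {Q : QuantumGraph} [Finite Q.V] {D n₀ : ℕ} {Lmin Lmax : ℝ}

theorem IsBounded.norm_rootAmp_le (hQ : Q.IsBounded D n₀ Lmin Lmax) (hu : Q.IsUnbalanced) (z : ℂ)
    (k : ℕ) (b : Q.Bond) : ‖RootedQuantumGraph.rootAmp z k ⟨Q, b⟩‖ ≤
      Lmax * walkRatio D n₀ Lmin z.im ^ (k + 1) := by
  classical
  have h := hQ.norm_propMat_pow_le hu z k b
  rw [propMat_pow_apply] at h
  rw [RootedQuantumGraph.rootAmp, norm_mul, Complex.norm_real,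
    Real.norm_of_nonneg (Q.bondLength_pos b).le]
  exact mul_le_mul (hQ.bondLength_le b) h (norm_nonneg _)
    ((Q.bondLength_pos b).le.trans (hQ.bondLength_le b))

variable [Nonempty Q.Bond]

theorem integral_rootedLaw {E : Type*} [NormedAddCommGroup E] [NormedSpace ℝ E] [CompleteSpace E]
    [SecondCountableTopology E] {f : ROQ → E} (hf : Continuous f)
    (hfi : ∀ μ : Measure ROQ, IsFiniteMeasure μ → Integrable f μ) :
    ∫ X, f X ∂(Q.rootedLaw : Measure ROQ) =
      (Fintype.card Q.Bond : ℝ)⁻¹ • ∑ b, f (ROQ.mk Q b) := by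
  borelize E
  have h : (Q.rootedLaw : Measure ROQ) =
      (Fintype.card Q.Bond : ℝ≥0∞)⁻¹ • ∑ b : Q.Bond, Measure.dirac (ROQ.mk Q b) := rfl
  rw [h, integral_smul_measure, integral_finsetSum_measure fun b _ => hfi _ inferInstance]
  congr 1
  · simp
  · exact Finset.sum_congr rfl fun b _ => integral_dirac' _ _ hf.stronglyMeasurable

theorem IsBounded.integral_truncLen (hQ : Q.IsBounded D n₀ Lmin Lmax) (hLmin : 0 < Lmin)
    (hL : Lmin ≤ Lmax) : ∫ X, ROQ.truncLen Lmin Lmax X ∂(Q.rootedLaw : Measure ROQ) =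
      (Fintype.card Q.Bond : ℝ)⁻¹ * (2 * Q.totalLength) := by
  rw [integral_rootedLaw ROQ.continuous_truncLen fun μ _ => ROQ.integrable_truncLen hLmin hL μ,
    smul_eq_mul, ← sum_bondLength]
  congr 1
  refine Finset.sum_congr rfl fun b _ => ?_
  rw [ROQ.truncLen, ROQ.rootLen_mk, Complex.ofReal_re, min_eq_right (hQ.bondLength_le b),
    max_eq_right (hQ.le_bondLength b)]

theorem IsBounded.integral_walkSeries (hQ : Q.IsBounded D n₀ Lmin Lmax) (hu : Q.IsUnbalanced)
    (hLmin : 0 < Lmin) (hL : Lmin ≤ Lmax) {z : ℂ}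
    (hz : z.im < stripBottom D n₀ Lmin ∨ 0 < z.im) :
    ∫ X, ROQ.walkSeries D n₀ Lmin Lmax z X ∂(Q.rootedLaw : Measure ROQ) =
      (Fintype.card Q.Bond : ℝ)⁻¹ • ∑' k, Q.walkSum z k := by
  have hLmax := hLmin.trans_le hL
  rw [integral_rootedLaw (ROQ.continuous_walkSeries hLmin hLmax hz)
    fun μ _ => ROQ.integrable_walkSeries hLmin hLmax hz μ]
  congr 1
  have h1 : ∀ b, ROQ.walkSeries D n₀ Lmin Lmax z (ROQ.mk Q b) =
      ∑' k, RootedQuantumGraph.rootAmp z k ⟨Q, b⟩ := fun b => tsum_congr fun k => by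
    rw [ROQ.amp_mk, clip_eq (ROQ.radius_pos hLmax _ k) (hQ.norm_rootAmp_le hu z k b)]
  have hs : ∀ b ∈ (Finset.univ : Finset Q.Bond),
      Summable fun k => RootedQuantumGraph.rootAmp z k ⟨Q, b⟩ := fun b _ =>
    Summable.of_norm_bounded (ROQ.hasSum_walkRatio hLmin hz).summable
      fun k => hQ.norm_rootAmp_le hu z k b
  simp only [h1, walkSum_eq_sum_rootAmp]
  exact (Summable.tsum_finsetSum hs).symm

/-- The number of bonds cancels in the quotient of expectations, leaving iF'/F over 2𝓛 above the
axis. Below it, the summand 1 of the density cancels the term -2𝓛. The opposite signs are the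
orientations of the two horizontal sides. -/
theorem IsBounded.density_rootedLaw (hQ : Q.IsBounded D n₀ Lmin Lmax) (hu : Q.IsUnbalanced)
    (hLmin : 0 < Lmin) (hL : Lmin ≤ Lmax) {z : ℂ}
    (hz : z.im < stripBottom D n₀ Lmin ∨ 0 < z.im) :
    ROQ.density D n₀ Lmin Lmax Q.rootedLaw z =
      ((Q.totalLength⁻¹ : ℝ) : ℂ) * ((if 0 < z.im then -1 else 1) *
        ((2 * Real.pi * Complex.I)⁻¹ * logDeriv Q.secular z)) := by
  have hT : (Q.totalLength : ℂ) ≠ 0 := by exact_mod_cast Q.totalLength_pos.ne'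
  have hpi : (Real.pi : ℂ) ≠ 0 := by exact_mod_cast Real.pi_ne_zero
  have hcard : (Fintype.card Q.Bond : ℂ) ≠ 0 := by exact_mod_cast Fintype.card_ne_zero
  rw [ROQ.density, hQ.integral_truncLen hLmin hL, hQ.integral_walkSeries hu hLmin hL hz,
    (hQ.secular_ne_zero_and_hasSum hu hLmin hz).2.tsum_eq, Complex.real_smul]
  push_cast
  rw [mul_inv, Complex.inv_I]
  split_ifs
  · field_simp
    ring
  · field_simp
    ring

theorem IsBounded.integral_eq_density (hQ : Q.IsBounded D n₀ Lmin Lmax) (hu : Q.IsUnbalanced)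
    (hLmin : 0 < Lmin) (hL : Lmin ≤ Lmax) {y₁ y₂ ε : ℝ} (h1 : y₁ < stripBottom D n₀ Lmin)
    (h2 : 0 < y₂) (hε : 0 < ε) {g : ℂ → ℂ}
    (hg : DifferentiableOn ℂ g (strip (y₁ - ε) (y₂ + ε)))
    (hgi : IntegrableOn g (strip (y₁ - ε) (y₂ + ε)) volume) :
    Integrable g Q.resonanceMeasure ∧ ∫ z, g z ∂Q.resonanceMeasure =
      (∫ x : ℝ, g (x + y₁ * Complex.I) *
        ROQ.density D n₀ Lmin Lmax Q.rootedLaw (x + y₁ * Complex.I)) +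
      ∫ x : ℝ, g (x + y₂ * Complex.I) *
        ROQ.density D n₀ Lmin Lmax Q.rootedLaw (x + y₂ * Complex.I) := by
  have hF := hQ.hasStripZeros hu hLmin h1 h2
  have hres := Q.integral_resonanceMeasure hF.countable_zeros hF.differentiable
    (hF.summable_norm hε hg hgi) (hF.hasSum hε hg hgi)
  have hb := stripBottom_nonpos (D := D) (n₀ := n₀) hLmin
  refine ⟨hres.1, hres.2.trans ?_⟩
  have e1 : ∀ x : ℝ, g (x + y₁ * Complex.I) *
      ROQ.density D n₀ Lmin Lmax Q.rootedLaw (x + y₁ * Complex.I) =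
      ((Q.totalLength⁻¹ : ℝ) : ℂ) * (2 * Real.pi * Complex.I)⁻¹ *
        (g (x + y₁ * Complex.I) * logDeriv Q.secular (x + y₁ * Complex.I)) := fun x => by
    rw [hQ.density_rootedLaw hu hLmin hL (by simpa using Or.inl h1),
      if_neg (by simpa using by linarith)]
    ring
  have e2 : ∀ x : ℝ, g (x + y₂ * Complex.I) *
      ROQ.density D n₀ Lmin Lmax Q.rootedLaw (x + y₂ * Complex.I) =
      -(((Q.totalLength⁻¹ : ℝ) : ℂ) * (2 * Real.pi * Complex.I)⁻¹) *
        (g (x + y₂ * Complex.I) * logDeriv Q.secular (x + y₂ * Complex.I)) := fun x => by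
    rw [hQ.density_rootedLaw hu hLmin hL (by simpa using Or.inr h2), if_pos (by simpa using h2)]
    ring
  simp only [e1, e2]
  rw [integral_const_mul, integral_const_mul]
  ring

theorem IsBounded.continuous_density_line (hQ : Q.IsBounded D n₀ Lmin Lmax) (hu : Q.IsUnbalanced)
    (hLmin : 0 < Lmin) (hL : Lmin ≤ Lmax) {y : ℝ} (hy : y < stripBottom D n₀ Lmin ∨ 0 < y) :
    Continuous fun x : ℝ => ROQ.density D n₀ Lmin Lmax Q.rootedLaw (x + y * Complex.I) := by
  have hF := hQ.hasStripZeros hu hLmin (sub_one_lt _) one_pos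
  have hc := hF.continuous_logDeriv_line (y := y) fun x =>
    (hQ.secular_ne_zero_and_hasSum hu hLmin (by simpa using hy)).1
  have : (fun x : ℝ => ROQ.density D n₀ Lmin Lmax Q.rootedLaw (x + y * Complex.I)) =
      fun x : ℝ => ((Q.totalLength⁻¹ : ℝ) : ℂ) * ((if 0 < y then -1 else 1) *
        ((2 * Real.pi * Complex.I)⁻¹ * logDeriv Q.secular (x + y * Complex.I))) := funext fun x => by
    rw [hQ.density_rootedLaw hu hLmin hL (by simpa using hy)]
    simp
  rw [this]
  exact continuous_const.mul (continuous_const.mul (continuous_const.mul hc))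

end QuantumGraph

/-- Dominated convergence: the densities converge pointwise on the line and share a bound that
depends on the height only. -/
theorem tendsto_integral_mul_density {D n₀ : ℕ} {Lmin Lmax : ℝ} (hLmin : 0 < Lmin) (hL : Lmin ≤ Lmax)
    {P : ProbabilityMeasure ROQ} (Q : ℕ → QuantumGraph) [∀ N, Finite (Q N).V]
    [∀ N, Nonempty (Q N).Bond]
    (hQ : ∀ N, (Q N).IsBounded D n₀ Lmin Lmax ∧ (Q N).IsUnbalanced)
    (hP : QuantumGraph.BSConvergesTo Q P) {y : ℝ} (hy : y < stripBottom D n₀ Lmin ∨ 0 < y)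
    {g : ℂ → ℂ} (hg : Integrable fun x : ℝ => g (x + y * Complex.I)) :
    Integrable (fun x : ℝ => g (x + y * Complex.I) *
      ROQ.density D n₀ Lmin Lmax P (x + y * Complex.I)) ∧
    Tendsto (fun N => ∫ x : ℝ, g (x + y * Complex.I) *
      ROQ.density D n₀ Lmin Lmax (Q N).rootedLaw (x + y * Complex.I)) atTop
      (𝓝 (∫ x : ℝ, g (x + y * Complex.I) *
        ROQ.density D n₀ Lmin Lmax P (x + y * Complex.I))) := by
  have hyx : ∀ x : ℝ, (x + y * Complex.I : ℂ).im < stripBottom D n₀ Lmin ∨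
      0 < (x + y * Complex.I : ℂ).im := fun x => by simpa using hy
  have hlim : ∀ x : ℝ, Tendsto (fun N => ROQ.density D n₀ Lmin Lmax (Q N).rootedLaw
      (x + y * Complex.I)) atTop (𝓝 (ROQ.density D n₀ Lmin Lmax P (x + y * Complex.I))) := fun x =>
    ROQ.tendsto_density hLmin hL hP (hyx x)
  have hb : ∀ (P : ProbabilityMeasure ROQ) (x : ℝ),
      ‖ROQ.density D n₀ Lmin Lmax P (x + y * Complex.I)‖ ≤ ROQ.densityBound D n₀ Lmin Lmax y :=
    fun P x => by simpa using ROQ.norm_density_le hLmin hL P (hyx x)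
  have hmN : ∀ N, AEStronglyMeasurable (fun x : ℝ => ROQ.density D n₀ Lmin Lmax (Q N).rootedLaw
      (x + y * Complex.I)) volume := fun N =>
    ((hQ N).1.continuous_density_line (hQ N).2 hLmin hL hy).aestronglyMeasurable
  -- The limiting density inherits measurability as a pointwise limit of the continuous densities of
  -- the finite graphs.
  have hm : AEStronglyMeasurable (fun x : ℝ => ROQ.density D n₀ Lmin Lmax P
      (x + y * Complex.I)) volume :=
    aestronglyMeasurable_of_tendsto_ae atTop hmN (Eventually.of_forall hlim)
  refine ⟨hg.mul_bdd hm (Eventually.of_forall (hb P)), ?_⟩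
  refine tendsto_integral_of_dominated_convergence
    (fun x => ‖g (x + y * Complex.I)‖ * ROQ.densityBound D n₀ Lmin Lmax y)
    (fun N => hg.1.mul (hmN N)) (hg.norm.mul_const _)
    (fun N => Eventually.of_forall fun x => ?_)
    (Eventually.of_forall fun x => (hlim x).const_mul _)
  rw [norm_mul]
  exact mul_le_mul_of_nonneg_left (hb _ x) (norm_nonneg _)

theorem theorem3 (D n₀ : ℕ) (Lmin Lmax : ℝ) (hLmin : 0 < Lmin) (hL : Lmin ≤ Lmax) :
    ∃ M : ℝ → ℝ, ∀ P : ProbabilityMeasure ROQ, ∃ Λ : ℂ → ℂ,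
      (∀ x y : ℝ, (y < stripBottom D n₀ Lmin ∨ 0 < y) → ‖Λ (x + y * Complex.I)‖ ≤ M y) ∧
      ∀ (Q : ℕ → QuantumGraph) [∀ N, Finite (Q N).V] [∀ N, Nonempty (Q N).Bond],
        (∀ N, (Q N).IsBounded D n₀ Lmin Lmax ∧ (Q N).IsUnbalanced) →
        QuantumGraph.BSConvergesTo Q P →
        ∀ (y₁ y₂ ε : ℝ) (g : ℂ → ℂ), y₁ < stripBottom D n₀ Lmin → 0 < y₂ → 0 < ε →
          DifferentiableOn ℂ g (strip (y₁ - ε) (y₂ + ε)) →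
          IntegrableOn g (strip (y₁ - ε) (y₂ + ε)) volume →
          (∀ N, Integrable g (Q N).resonanceMeasure) ∧
          Integrable (fun x : ℝ => g (x + y₁ * Complex.I) * Λ (x + y₁ * Complex.I)) ∧
          Integrable (fun x : ℝ => g (x + y₂ * Complex.I) * Λ (x + y₂ * Complex.I)) ∧
          Tendsto (fun N => ∫ z, g z ∂(Q N).resonanceMeasure) atTop
            (𝓝 ((∫ x : ℝ, g (x + y₁ * Complex.I) * Λ (x + y₁ * Complex.I)) +
              ∫ x : ℝ, g (x + y₂ * Complex.I) * Λ (x + y₂ * Complex.I))) := by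
  refine ⟨ROQ.densityBound D n₀ Lmin Lmax, fun P => ⟨ROQ.density D n₀ Lmin Lmax P, fun x y hy => ?_,
    ?_⟩⟩
  · have := ROQ.norm_density_le hLmin hL P (z := x + y * Complex.I) (by simpa using hy)
    simpa using this
  intro Q _ _ hQ hP y₁ y₂ ε g h1 h2 hε hg hgi
  have hb := stripBottom_nonpos (D := D) (n₀ := n₀) hLmin
  have hmain := fun N => (hQ N).1.integral_eq_density (hQ N).2 hLmin hL h1 h2 hε hg hgi
  have t1 := tendsto_integral_mul_density hLmin hL Q hQ hP (Or.inl h1)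
    (integrable_line hg hgi (y := y₁) (by linarith) (by linarith))
  have t2 := tendsto_integral_mul_density hLmin hL Q hQ hP (Or.inr h2)
    (integrable_line hg hgi (y := y₂) (by linarith) (by linarith))
  refine ⟨fun N => (hmain N).1, t1.1, t2.1, ?_⟩
  simp only [fun N => (hmain N).2]
  exact t1.2.add t2.2
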